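/- Let $n\ge 2$, let $(\cdot,\cdot)$ be the quadratic form of signature $(n+1,1)$ on $\mathbb R^{n+2}$, let $Q^n=\{(x,x)=0\}\subset P^{n+1}$ and let the de Sitter space $S^{n+1}_1$ be the exterior $\{(x,x)>0\}$ of $Q^n$. Let $U^n\subset S^{n+1}_1$ be a smooth immersed lightlike hypersurface, i.e. all its tangent hyperplanes are tangent to $Q^n$; let $A_0$ be the point of $Q^n$ at which the tangent hyperplane at $x\in U^n$ touches $Q^n$, let $xA_0$ be the isotropic rectilinear generator through $x$, and let $V$ be the submanifold of $Q^n$ described by $A_0$. Assume that $U^n$ has maximal rank, i.e. $\dim V=n-1$. In a local field of frames $A_0,A_i,A_n,A_{n+1}$ ($1\le i\le n-1$), with $A_0$ as above, $A_n$ on the generator $xA_0$, $(A_i,A_j)=g_{ij}$, $(A_n,A_n)=1$, $(A_0,A_{n+1})=-1$ and all other scalar products zero, write $dA_\xi=\omega_\xi^\eta A_\eta$ and $$\omega_i^n=\lambda_{ij}\omega_0^j,\quad \lambda=\tfrac1{n-1}g^{ij}\lambda_{ij},\quad a_{ij}=\lambda_{ij}-\lambda g_{ij},\quad a^i_j=g^{ik}a_{kj},$$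 $$d\lambda_{ij}-\lambda_{ik}\omega^k_j-\lambda_{kj}\omega^k_i+\lambda_{ij}\omega_0^0+g_{ij}\omega_n^0=\lambda_{ijk}\omega_0^k,\quad \lambda_k=\tfrac1{n-1}g^{ij}\lambda_{ijk},$$ $$C=A_n+\lambda A_0,\qquad C_i=\lambda_iA_0-a_i^jA_j .$$ Suppose that the tensor $a_{ij}$ is nondegenerate at every point of $U^n$. Then: (1) These expansions exist in every such frame field. The point $C$ (the harmonic pole of $A_0$ with respect to the singular points of the generator) and the span $\zeta=C_1\wedge\dots\wedge C_{n-1}$ do not depend on the frame or on the point $A_n$ of the generator. The points $C_i$ are linearly independent and together with $C$ span the $(n-1)$-dimensional tangent subspace $T_C(W)$ of the submanifold $W$ described by $C$, and $\zeta=T_{A_0}(V)\cap T_C(W)$. (2) The $(n-2)$-planes $\zeta$ form a normalization of $U^n$: they lie in $T_{A_0}(V)$, do not contain $A_0$, depend smoothly on the point of $U^n$ and are constant along the generators. (3) This normalization induces on $U^n$ a smooth torsion-free affine connection, whose matrix in the coframe $(\omega_n^0,\omega_n^i)$ of every frame field with $A_n=x$ and $A_i\in\zeta$ is $\begin{pmatrix}\omega_0^0&\omega_i^0\\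 \omega_0^i&\omega_j^i\end{pmatrix}$. (4) The subspaces $\Delta_x=x\wedge\zeta$ lie in the tangent hyperplanes of $U^n$, are complementary there to the generators, and define a screen distribution on $U^n$, given by $\omega_n^0=0$ in the frames of (3). (5) $C$, $\zeta$, $\Delta$ and the connection are invariant under the motions of $S^{n+1}_1$ and under changes of the parametrization of $U^n$; $C$ and $\zeta$ are unchanged when the point $x$ of each generator is replaced by another point of the same generator. (6) $\zeta$, $T_C(W)$ and $\Delta$ at a point are determined by the third-order neighborhood (the $3$-jet) of $U^n$ at that point; the affine connection at a point is determined by the third-order neighborhood of the generator, i.e. by the $3$-jet there of the pair $(x,A_0)$ of points spanning the generators. -/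

import Mathlib

open Module Filter Topology
open scoped Manifold ContDiff LinearAlgebra.Projectivization

noncomputable section

namespace DeSitter

/-- Homogeneous coordinate vectors of the projective space `P^{n+1}`. -/
abbrev Amb (n : ℕ) : Type := Fin (n + 2) → ℝ

/-- The quadratic form of signature `(n+1, 1)`, as a symmetric bilinear form. Its isotropic points
form the absolute `Q^n`; the points with positive scalar square form the de Sitter space. -/
def form (n : ℕ) : LinearMap.BilinForm ℝ (Amb n) :=
  LinearMap.mk₂ ℝ
    (fun x y => (∑ i : Fin (n + 1), x i.castSucc * y i.castSucc) -
      x (Fin.last (n + 1)) * y (Fin.last (n + 1)))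
    (fun x x' y => by simp only [Pi.add_apply, add_mul, Finset.sum_add_distrib]; ring)
    (fun c x y => by
      simp only [Pi.smul_apply, smul_eq_mul, mul_assoc, ← Finset.mul_sum]; ring)
    (fun x y y' => by simp only [Pi.add_apply, mul_add, Finset.sum_add_distrib]; ring)
    (fun c x y => by
      simp only [Pi.smul_apply, smul_eq_mul, mul_left_comm _ c, ← Finset.mul_sum]; ring)

section Projective

variable {n : ℕ} {M : Type*} [TopologicalSpace M] [ChartedSpace (EuclideanSpace ℝ (Fin n)) M]

/-- `f` is a smooth lift near `p` (homogeneous coordinates) of a moving point `P` of `P^{n+1}`. -/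
def IsLift (P : M → Submodule ℝ (Amb n)) (p : M) (f : M → Amb n) : Prop :=
  ∀ᶠ q in 𝓝 p, ContMDiffAt (𝓡 n) 𝓘(ℝ, Amb n) ∞ f q ∧ f q ≠ 0 ∧ P q = ℝ ∙ f q

/-- The (projective) tangent subspace at `p` of the submanifold described by the moving point `P`:
it is spanned by `f p` and all the `df(v)`, for a lift `f` of `P`. (The supremum over all lifts is
only a way of not choosing one: any two lifts span the same subspace.) -/
def projTangent (P : M → Submodule ℝ (Amb n)) (p : M) : Submodule ℝ (Amb n) :=
  ⨆ (f : M → Amb n) (_ : IsLift P p f),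
    (ℝ ∙ f p) ⊔ LinearMap.range (mvfderiv (𝓡 n) f p).toLinearMap

/-- Vectors `v` in `T_p M` such that the moving point `P` is displaced by `v` within
the subspace `S`. -/
def directionsIn (P : M → Submodule ℝ (Amb n)) (S : Submodule ℝ (Amb n)) (p : M) :
    Submodule ℝ (TangentSpace (𝓡 n) p) :=
  ⨅ (f : M → Amb n) (_ : IsLift P p f), S.comap (mvfderiv (𝓡 n) f p).toLinearMap

/-- Two maps have the same `k`-jet at `p` (read in the preferred chart at `p`). -/
def SameJet (k : ℕ) (f f' : M → Amb n) (p : M) : Prop :=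
  ∀ j ≤ k,
    iteratedFDeriv ℝ j (f ∘ (extChartAt (𝓡 n) p).symm) (extChartAt (𝓡 n) p p) =
      iteratedFDeriv ℝ j (f' ∘ (extChartAt (𝓡 n) p).symm) (extChartAt (𝓡 n) p p)

/-- Two moving points of `P^{n+1}` have the same `k`-jet at `p`. -/
def SamePointJet (k : ℕ) (P P' : M → Submodule ℝ (Amb n)) (p : M) : Prop :=
  ∃ f f' : M → Amb n, IsLift P p f ∧ IsLift P' p f' ∧ SameJet k f f' p

end Projective

/-- A lightlike hypersurface of the de Sitter space: an `n`-dimensional immersed hypersurface of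
the exterior of the absolute, all of whose tangent hyperplanes are tangent to the absolute. -/
structure LightlikeHypersurface (n : ℕ) (M : Type*) [TopologicalSpace M]
    [ChartedSpace (EuclideanSpace ℝ (Fin n)) M] where
  /-- the point `x` -/
  point : M → ℙ ℝ (Amb n)
  smooth : ∀ p, ∃ f, IsLift (fun q => (point q).submodule) p f
  exterior : ∀ p, ∀ v ∈ (point p).submodule, v ≠ 0 → 0 < form n v v
  regular : ∀ p, finrank ℝ (projTangent (fun q => (point q).submodule) p) = n + 1
  lightlike : ∀ p, ∃ y : Amb n, y ≠ 0 ∧ form n y y = 0 ∧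
    projTangent (fun q => (point q).submodule) p = (form n).orthogonal (ℝ ∙ y)

namespace LightlikeHypersurface

variable {n : ℕ} {M : Type*} [TopologicalSpace M] [ChartedSpace (EuclideanSpace ℝ (Fin n)) M]

/-- The point `x` of the hypersurface, as a line in the space of homogeneous coordinates. -/
def pt (U : LightlikeHypersurface n M) (p : M) : Submodule ℝ (Amb n) := (U.point p).submodule

/-- The tangent hyperplane `η` of the hypersurface. -/
def tangentHyperplane (U : LightlikeHypersurface n M) (p : M) : Submodule ℝ (Amb n) :=
  projTangent U.pt p

/-- The point `A₀` of the absolute at which the tangent hyperplane touches it (the point that is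
polar-conjugate to the tangent hyperplane). It describes the submanifold `V`. -/
def tangency (U : LightlikeHypersurface n M) (p : M) : Submodule ℝ (Amb n) :=
  (form n).orthogonal (U.tangentHyperplane p)

/-- The rectilinear isotropic generator through the point `x`, i.e. the line `x ∧ A₀`. -/
def generator (U : LightlikeHypersurface n M) (p : M) : Submodule ℝ (Amb n) :=
  U.pt p ⊔ U.tangency p

/-- The tangent subspace `T_{A₀}(V)`. -/
def tangentV (U : LightlikeHypersurface n M) (p : M) : Submodule ℝ (Amb n) :=
  projTangent U.tangency p

/-- The hypersurface has maximal rank `n - 1`: the submanifold `V` of the absolute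
has dimension `n - 1`. -/
def MaximalRank (U : LightlikeHypersurface n M) : Prop :=
  ∀ p, finrank ℝ (U.tangentV p) = n

/-- A smooth field, over an open set `O`, of frames `A₀, A₁, …, A_{n-1}, A_n, A_{n+1}` adapted to
the lightlike hypersurface. The point `A_n` may be any point of the generator (it need not be the
point `x`), so the generator is the line `A_n A₀`. -/
structure Frame (U : LightlikeHypersurface n M) (O : Set M) where
  A0 : M → Amb n
  A : Fin (n - 1) → M → Amb n
  An : M → Amb n
  Ainf : M → Amb n
  isOpen : IsOpen O
  smooth_A0 : ContMDiffOn (𝓡 n) 𝓘(ℝ, Amb n) ∞ A0 O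
  smooth_A : ∀ i, ContMDiffOn (𝓡 n) 𝓘(ℝ, Amb n) ∞ (A i) O
  smooth_An : ContMDiffOn (𝓡 n) 𝓘(ℝ, Amb n) ∞ An O
  smooth_Ainf : ContMDiffOn (𝓡 n) 𝓘(ℝ, Amb n) ∞ Ainf O
  gram_0_0 : ∀ p ∈ O, form n (A0 p) (A0 p) = 0
  gram_0_i : ∀ p ∈ O, ∀ i, form n (A0 p) (A i p) = 0
  gram_0_n : ∀ p ∈ O, form n (A0 p) (An p) = 0
  gram_0_inf : ∀ p ∈ O, form n (A0 p) (Ainf p) = -1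
  gram_i_n : ∀ p ∈ O, ∀ i, form n (A i p) (An p) = 0
  gram_i_inf : ∀ p ∈ O, ∀ i, form n (A i p) (Ainf p) = 0
  gram_n_n : ∀ p ∈ O, form n (An p) (An p) = 1
  gram_n_inf : ∀ p ∈ O, form n (An p) (Ainf p) = 0
  gram_inf_inf : ∀ p ∈ O, form n (Ainf p) (Ainf p) = 0
  indep : ∀ p ∈ O, LinearIndependent ℝ (fun i => A i p)
  A0_mem : ∀ p ∈ O, A0 p ∈ U.tangency p
  pt_le : ∀ p ∈ O, U.pt p ≤ Submodule.span ℝ {An p, A0 p}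

namespace Frame

variable {U : LightlikeHypersurface n M} {O : Set M}

/-- `g_{ij} = (A_i, A_j)`. -/
def g (𝔄 : U.Frame O) (p : M) : Matrix (Fin (n - 1)) (Fin (n - 1)) ℝ :=
  Matrix.of fun i j => form n (𝔄.A i p) (𝔄.A j p)

/-- The coordinate of a vector on `A₀` in the frame (by the table of scalar products). -/
def coord0 (𝔄 : U.Frame O) (p : M) (w : Amb n) : ℝ := -form n w (𝔄.Ainf p)

/-- The coordinate of a vector on `A_i` in the frame. -/
def coord (𝔄 : U.Frame O) (p : M) (i : Fin (n - 1)) (w : Amb n) : ℝ :=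
  ∑ j, (𝔄.g p)⁻¹ i j * form n w (𝔄.A j p)

/-- The coordinate of a vector on `A_n` in the frame. -/
def coordn (𝔄 : U.Frame O) (p : M) (w : Amb n) : ℝ := form n w (𝔄.An p)

/-- The form `ω_0^0`. -/
def w00 (𝔄 : U.Frame O) (p : M) (v : TangentSpace (𝓡 n) p) : ℝ :=
  𝔄.coord0 p (mvfderiv (𝓡 n) 𝔄.A0 p v)

/-- The forms `ω_0^i`. -/
def w0i (𝔄 : U.Frame O) (p : M) (i : Fin (n - 1)) (v : TangentSpace (𝓡 n) p) : ℝ :=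
  𝔄.coord p i (mvfderiv (𝓡 n) 𝔄.A0 p v)

/-- The forms `ω_i^0`. -/
def wi0 (𝔄 : U.Frame O) (p : M) (i : Fin (n - 1)) (v : TangentSpace (𝓡 n) p) : ℝ :=
  𝔄.coord0 p (mvfderiv (𝓡 n) (𝔄.A i) p v)

/-- The forms `ω_i^j` (lower index first). -/
def wij (𝔄 : U.Frame O) (p : M) (i j : Fin (n - 1)) (v : TangentSpace (𝓡 n) p) : ℝ :=
  𝔄.coord p j (mvfderiv (𝓡 n) (𝔄.A i) p v)

/-- The forms `ω_i^n`. -/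
def win (𝔄 : U.Frame O) (p : M) (i : Fin (n - 1)) (v : TangentSpace (𝓡 n) p) : ℝ :=
  𝔄.coordn p (mvfderiv (𝓡 n) (𝔄.A i) p v)

/-- The form `ω_n^0`. -/
def wn0 (𝔄 : U.Frame O) (p : M) (v : TangentSpace (𝓡 n) p) : ℝ :=
  𝔄.coord0 p (mvfderiv (𝓡 n) 𝔄.An p v)

/-- The forms `ω_n^i`. -/
def wni (𝔄 : U.Frame O) (p : M) (i : Fin (n - 1)) (v : TangentSpace (𝓡 n) p) : ℝ :=
  𝔄.coord p i (mvfderiv (𝓡 n) 𝔄.An p v)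

open Classical in
/-- The coefficients `c` in the expansion `α = c_j ω_0^j` of a 1-form `α` at `p`. -/
def coeffs (𝔄 : U.Frame O) (p : M) (α : TangentSpace (𝓡 n) p → ℝ) : Fin (n - 1) → ℝ :=
  if h : ∃ c : Fin (n - 1) → ℝ, ∀ v, α v = ∑ j, c j * 𝔄.w0i p j v then h.choose else 0

/-- The quantities `λ_{ij}`, defined by `ω_i^n = λ_{ij} ω_0^j`. -/
def lam (𝔄 : U.Frame O) (p : M) (i j : Fin (n - 1)) : ℝ := 𝔄.coeffs p (𝔄.win p i) j

/-- `λ = (1/(n-1)) λ_{ij} g^{ij}`. -/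
def lamMean (𝔄 : U.Frame O) (p : M) : ℝ :=
  1 / ((n : ℝ) - 1) * ∑ i, ∑ j, 𝔄.lam p i j * (𝔄.g p)⁻¹ i j

/-- The traceless tensor `a_{ij} = λ_{ij} - λ g_{ij}`. -/
def a (𝔄 : U.Frame O) (p : M) : Matrix (Fin (n - 1)) (Fin (n - 1)) ℝ :=
  Matrix.of fun i j => 𝔄.lam p i j - 𝔄.lamMean p * 𝔄.g p i j

/-- The harmonic pole `C = A_n + λ A₀` of `A₀` with respect to the singular points of the
generator. -/
def C (𝔄 : U.Frame O) (p : M) : Amb n := 𝔄.An p + 𝔄.lamMean p • 𝔄.A0 p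

/-- The form `∇λ_{ij} + λ_{ij} ω_0^0 + g_{ij} ω_n^0`, where
`∇λ_{ij} = dλ_{ij} - λ_{ik} ω_j^k - λ_{kj} ω_i^k`. -/
def dlam (𝔄 : U.Frame O) (p : M) (i j : Fin (n - 1)) (v : TangentSpace (𝓡 n) p) : ℝ :=
  mvfderiv (𝓡 n) (fun q => 𝔄.lam q i j) p v
    - ∑ k, 𝔄.lam p i k * 𝔄.wij p j k v - ∑ k, 𝔄.lam p k j * 𝔄.wij p i k v
    + 𝔄.lam p i j * 𝔄.w00 p v + 𝔄.g p i j * 𝔄.wn0 p v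

/-- The quantities `λ_{ijk}`, defined by `∇λ_{ij} + λ_{ij} ω_0^0 + g_{ij} ω_n^0 = λ_{ijk} ω_0^k`. -/
def lam3 (𝔄 : U.Frame O) (p : M) (i j k : Fin (n - 1)) : ℝ := 𝔄.coeffs p (𝔄.dlam p i j) k

/-- `λ_k = (1/(n-1)) g^{ij} λ_{ijk}`. -/
def lamVec (𝔄 : U.Frame O) (p : M) (k : Fin (n - 1)) : ℝ :=
  1 / ((n : ℝ) - 1) * ∑ i, ∑ j, (𝔄.g p)⁻¹ i j * 𝔄.lam3 p i j k

/-- The affinor `a^i_j = g^{ik} a_{kj}`. -/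
def affinor (𝔄 : U.Frame O) (p : M) : Matrix (Fin (n - 1)) (Fin (n - 1)) ℝ :=
  (𝔄.g p)⁻¹ * 𝔄.a p

/-- The points `C_i = λ_i A₀ - a_i^j A_j`. -/
def Ci (𝔄 : U.Frame O) (p : M) (i : Fin (n - 1)) : Amb n :=
  𝔄.lamVec p i • 𝔄.A0 p - ∑ j, 𝔄.affinor p j i • 𝔄.A j p

/-- The expansions defining `λ_{ij}` and `λ_{ijk}` do exist at `p`, and `λ_{ij}` is symmetric. -/
def Expansions (𝔄 : U.Frame O) (p : M) : Prop :=
  (∀ i v, 𝔄.win p i v = ∑ j, 𝔄.lam p i j * 𝔄.w0i p j v) ∧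
  (∀ i j, 𝔄.lam p i j = 𝔄.lam p j i) ∧
  (∀ i j v, 𝔄.dlam p i j v = ∑ k, 𝔄.lam3 p i j k * 𝔄.w0i p k v)

/-- The vertex `A_n` of the frame is the point `x` of the hypersurface, and the vertices `A_i` lie
in (hence span) the normalizing subspace. -/
def Reduced (𝔄 : U.Frame O) (ζ : M → Submodule ℝ (Amb n)) : Prop :=
  (∀ p ∈ O, U.pt p = ℝ ∙ 𝔄.An p) ∧
  (∀ p ∈ O, ζ p = Submodule.span ℝ (Set.range fun i => 𝔄.A i p))

end Frame

/-- The tensor `a_{ij}` is nondegenerate on the hypersurface. -/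
def Nondegenerate (U : LightlikeHypersurface n M) : Prop :=
  ∀ p, ∃ (O : Set M) (𝔄 : U.Frame O), p ∈ O ∧ (𝔄.a p).det ≠ 0

/-- The point `C` of the generator (computed in all adapted frames). It describes the
submanifold `W`. -/
def pole (U : LightlikeHypersurface n M) (p : M) : Submodule ℝ (Amb n) :=
  ⨆ (O : Set M) (𝔄 : U.Frame O) (_ : p ∈ O), ℝ ∙ 𝔄.C p

/-- The tangent subspace `T_C(W)`. -/
def tangentW (U : LightlikeHypersurface n M) (p : M) : Submodule ℝ (Amb n) :=
  projTangent U.pole p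

/-- The subspace `ζ = C_1 ∧ … ∧ C_{n-1}` (computed in all adapted frames). -/
def zeta (U : LightlikeHypersurface n M) (p : M) : Submodule ℝ (Amb n) :=
  ⨆ (O : Set M) (𝔄 : U.Frame O) (_ : p ∈ O), Submodule.span ℝ (Set.range (𝔄.Ci p))

/-- A normalization of the lightlike hypersurface: a smooth field of `(n-2)`-dimensional subspaces
`ζ` of `T_{A₀}(V)` not containing `A₀`, which is constant along the rectilinear generators. -/
structure IsNormalization (U : LightlikeHypersurface n M) (ζ : M → Submodule ℝ (Amb n)) :
    Prop where
  le_tangentV : ∀ p, ζ p ≤ U.tangentV p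
  finrank_eq : ∀ p, finrank ℝ (ζ p) = n - 1
  not_mem : ∀ p, ζ p ⊓ U.tangency p = ⊥
  smooth : ∀ p, ∃ (O : Set M) (𝔄 : U.Frame O), p ∈ O ∧ 𝔄.Reduced ζ
  const : ∀ γ : ℝ → M, ContMDiff 𝓘(ℝ, ℝ) (𝓡 n) ∞ γ → (∀ t, U.pt (γ t) ≤ U.generator (γ 0)) →
    ∀ t, ζ (γ t) = ζ (γ 0)

/-- The screen `Δ_x = x ∧ ζ`. -/
def screen (U : LightlikeHypersurface n M) (p : M) : Submodule ℝ (Amb n) := U.pt p ⊔ U.zeta p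

/-- The screen distribution, as a distribution on the manifold `M`. -/
def screenDistribution (U : LightlikeHypersurface n M) (p : M) :
    Submodule ℝ (TangentSpace (𝓡 n) p) :=
  directionsIn U.pt (U.screen p) p

/-- The isotropic distribution on `M`, tangent to the rectilinear generators. -/
def isotropicDistribution (U : LightlikeHypersurface n M) (p : M) :
    Submodule ℝ (TangentSpace (𝓡 n) p) :=
  directionsIn U.pt (U.generator p) p

variable [IsManifold (𝓡 n) ∞ M]

/-- Affine connections on `M`. -/
abbrev Connection (n : ℕ) (M : Type*) [TopologicalSpace M]
    [ChartedSpace (EuclideanSpace ℝ (Fin n)) M] [IsManifold (𝓡 n) ∞ M] :=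
  CovariantDerivative (𝓡 n) (EuclideanSpace ℝ (Fin n)) (TangentSpace (𝓡 n) : M → Type _)

/-- The vector field `Y` on `M` is differentiable at `p`. -/
def FieldDiffAt (Y : (q : M) → TangentSpace (𝓡 n) q) (p : M) : Prop :=
  MDifferentiableAt (𝓡 n) (𝓡 n).tangent (fun q => (⟨q, Y q⟩ : TangentBundle (𝓡 n) M)) p

/-- The vector field `Y` on `M` is smooth on `O`. -/
def FieldSmoothOn (Y : (q : M) → TangentSpace (𝓡 n) q) (O : Set M) : Prop :=
  ContMDiffOn (𝓡 n) (𝓡 n).tangent ∞ (fun q => (⟨q, Y q⟩ : TangentBundle (𝓡 n) M)) O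

/-- `∇` is the affine connection induced on the hypersurface by the normalization `ζ`: in the
coframe `ω_n^0, ω_n^i` of every reduced frame, the matrix of the connection forms is
`(ω_0^0, ω_i^0; ω_0^i, ω_j^i)`, that is, `ω_n^a(∇_v Y) = d(ω_n^a(Y))(v) + ω_b^a(v) ω_n^b(Y)`
for `a, b = 0, 1, …, n - 1`. -/
def IsInducedConnection (U : LightlikeHypersurface n M) (ζ : M → Submodule ℝ (Amb n))
    (D : Connection n M) : Prop :=
  ∀ (O : Set M) (𝔄 : U.Frame O), 𝔄.Reduced ζ → ∀ p ∈ O,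
    ∀ Y : (q : M) → TangentSpace (𝓡 n) q, FieldDiffAt Y p → ∀ v : TangentSpace (𝓡 n) p,
      𝔄.wn0 p (D Y p v) =
        mvfderiv (𝓡 n) (fun q => 𝔄.wn0 q (Y q)) p v
          + 𝔄.w00 p v * 𝔄.wn0 p (Y p) + ∑ j, 𝔄.wi0 p j v * 𝔄.wni p j (Y p) ∧
      ∀ i, 𝔄.wni p i (D Y p v) =
        mvfderiv (𝓡 n) (fun q => 𝔄.wni q i (Y q)) p v
          + 𝔄.w0i p i v * 𝔄.wn0 p (Y p) + ∑ j, 𝔄.wij p j i v * 𝔄.wni p j (Y p)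

/-- The connection `∇` is smooth: `∇_X Y` is smooth on every open set on which the vector fields
`X` and `Y` are. -/
def IsSmoothConnection (D : Connection n M) : Prop :=
  ∀ O : Set M, IsOpen O → ∀ X Y : (q : M) → TangentSpace (𝓡 n) q,
    FieldSmoothOn X O → FieldSmoothOn Y O → FieldSmoothOn (fun q => D Y q (X q)) O

end LightlikeHypersurface

end DeSitter

end

/-! The normalization of a lightlike hypersurface of maximal rank in the de Sitter space.

Everything is computed with smooth lifts of moving points. The point `A₀` is polar to `x` and to
`dx`, so in an adapted frame neither `dA₀` nor `dA_n` has components along `A_n` and `A_{n+1}`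
(`Frame.dA0_eq`, `Frame.dAn_eq`), and maximal rank says that the forms `ω_0^i` are independent
(`Frame.exists_w0i_eq`). The symmetry of the second derivatives of `A₀` is the equation
`ω_0^i ∧ ω_i^n = 0`; by the lemma of Cartan it produces the symmetric `λ_{ij}`, and differentiating
once more produces the `λ_{ijk}` (`Frame.form_dA0_dAn_symm`, `Frame.dlam_symm`, `Frame.expansions`).

The mean `λ` is, up to the factor `-1/(n-1)`, the trace of the form `(dA₀, dA_n)` with respect to
the form `(dA₀, dA₀)` (`Frame.lamMean_eq_trace`). This formula does not use the vertices `A_i`, and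
a shift of `A_n` along the generator changes `λ` just so that `C = A_n + λ A₀` only changes sign
(`Frame.C_change`). The trace of the expansion of `∇λ_{ij}` gives `dC = ω_0^k C_k` (`Frame.dC_eq`).
Hence `ζ` is the image of `dC` (`Frame.zeta_eq_range`), the tangent subspace `T_C(W)` is the sum of
`C` and `ζ`, and `a_{ij}` is nondegenerate exactly when `dC` and `dA₀` modulo `A₀` have the same
kernel, a condition free of the frame (`Frame.det_a_ne_zero_iff`). As `T_{A₀}(V)` and `ζ` are
orthogonal to `A_n` and `(C, A_n) = 1`, the intersection of `T_{A₀}(V)` with `T_C(W)` is `ζ`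
(`Frame.zeta_eq_inf`).

Derivatives of `C` along coordinate fields are vertices `A_i` of a frame with `A_n = x` and
`A_i ∈ ζ` (`Frame.exists_reduced`). In such a reduced frame all components of `dA_i` outside
`ζ` vanish along the generators, so `ζ` is constant there (`zeta_const`). The induced connection is
the projection of the second derivative of `x` to the tangent space along the span of `A_n` and
`A_{n+1}`; this span depends only on `x`, `A₀` and `ζ` (`Frame.tangentCoords_change`), the
components of the projection are those of the required matrix (`isInducedConnection_iff`), and the
torsion vanishes because second derivatives commute. The screen distribution is the kernel of
`ω_n^0` (`Frame.mem_screenDistribution_iff`).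

Invariance is seen by carrying frames along: a motion together with a change of parameters maps a
frame to a frame (`Frame.push`), and hypersurfaces with the same generators share their frames
(`Frame.transfer`). For the order of the neighborhoods, jets are compared through iterated
derivatives along coordinate fields, and the solution of a linear system inherits the order of its
coefficients (`JetEq.solve`). The polarity equations give the `2`-jet of `A₀` from the `3`-jet of
`x` (`jetEq_tangency`), the trace formula then gives the `1`-jet of `C` (`Frame.jetEq_C`), and with
it `ζ`, `T_C(W)` and the screen (`eq_of_jetEq`). Besides `ζ` at the point, the connection uses only the
`2`-jet of `x` (`connection_eq_of_jetEq`). -/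

/-! ### Vector-valued functions and coordinate fields on a manifold -/

noncomputable section
namespace DeSitter

section Calculus

variable {n : ℕ} {M : Type*} [TopologicalSpace M] [ChartedSpace (EuclideanSpace ℝ (Fin n)) M]
  {W W₁ W₂ : Type*} [NormedAddCommGroup W] [NormedSpace ℝ W]
  [NormedAddCommGroup W₁] [NormedSpace ℝ W₁] [NormedAddCommGroup W₂] [NormedSpace ℝ W₂]

/-- `F` is a smooth vector-valued function at the point `p` of an `n`-manifold. -/
abbrev SmoothAt (n : ℕ) {M : Type*} [TopologicalSpace M]
    [ChartedSpace (EuclideanSpace ℝ (Fin n)) M] {W : Type*} [NormedAddCommGroup W]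
    [NormedSpace ℝ W] (F : M → W) (p : M) : Prop :=
  ContMDiffAt (𝓡 n) 𝓘(ℝ, W) ∞ F p

/-- `F` is a differentiable vector-valued function at the point `p` of an `n`-manifold. -/
abbrev DiffAt (n : ℕ) {M : Type*} [TopologicalSpace M]
    [ChartedSpace (EuclideanSpace ℝ (Fin n)) M] {W : Type*} [NormedAddCommGroup W]
    [NormedSpace ℝ W] (F : M → W) (p : M) : Prop :=
  MDifferentiableAt (𝓡 n) 𝓘(ℝ, W) F p

lemma SmoothAt.diffAt {F : M → W} {p : M} (h : SmoothAt n F p) : DiffAt n F p :=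
  h.mdifferentiableAt (by simp)

lemma DiffAt.differentiableAt {F : M → W} {p : M} (h : DiffAt n F p) :
    DifferentiableAt ℝ (F ∘ (extChartAt (𝓡 n) p).symm) (extChartAt (𝓡 n) p p) := by
  have := (mdifferentiableAt_iff _ _).1 h |>.2
  rw [writtenInExtChartAt, extChartAt_model_space_eq_id, modelWithCornersSelf_coe,
    Set.range_id, differentiableWithinAt_univ] at this
  exact this

lemma DiffAt.mvfderiv_apply {F : M → W} {p : M} (h : DiffAt n F p)
    (v : EuclideanSpace ℝ (Fin n)) :
    mvfderiv (𝓡 n) F p v =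
      fderiv ℝ (F ∘ (extChartAt (𝓡 n) p).symm) (extChartAt (𝓡 n) p p) v := by
  rw [h.mvfderiv, writtenInExtChartAt, extChartAt_model_space_eq_id, modelWithCornersSelf_coe,
    Set.range_id, fderivWithin_univ]
  rfl

lemma mvfderiv_congr {F G : M → W} {p : M} (h : F =ᶠ[𝓝 p] G) :
    mvfderiv (𝓡 n) F p = mvfderiv (𝓡 n) G p := by
  have h1 := h.mfderiv_eq (I := 𝓡 n) (I' := 𝓘(ℝ, W))
  ext v
  simp only [mvfderiv]
  exact congrArg (fun T : EuclideanSpace ℝ (Fin n) →L[ℝ] W => T v) h1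

lemma mvfderiv_clm (B : W →L[ℝ] W₁) {F : M → W} {p : M} (hF : DiffAt n F p)
    (v : TangentSpace (𝓡 n) p) :
    mvfderiv (𝓡 n) (fun q => B (F q)) p v = B (mvfderiv (𝓡 n) F p v) := by
  have hd : DiffAt n (fun q => B (F q)) p := B.mdifferentiableAt.comp p hF
  rw [hd.mvfderiv_apply v, hF.mvfderiv_apply v]
  have := (B.hasFDerivAt.comp _ hF.differentiableAt.hasFDerivAt).fderiv
  exact congrArg (fun T : EuclideanSpace ℝ (Fin n) →L[ℝ] W₁ => T v) this

lemma DiffAt.bilin (B : W₁ →L[ℝ] W₂ →L[ℝ] W) {F : M → W₁} {G : M → W₂} {p : M}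
    (hF : DiffAt n F p) (hG : DiffAt n G p) : DiffAt n (fun q => B (F q) (G q)) p :=
  (B.mdifferentiableAt.comp p hF).clm_apply hG

lemma SmoothAt.bilin (B : W₁ →L[ℝ] W₂ →L[ℝ] W) {F : M → W₁} {G : M → W₂} {p : M}
    (hF : SmoothAt n F p) (hG : SmoothAt n G p) : SmoothAt n (fun q => B (F q) (G q)) p :=
  (B.contMDiff.contMDiffAt.comp p hF).clm_apply hG

lemma mvfderiv_bilin (B : W₁ →L[ℝ] W₂ →L[ℝ] W) {F : M → W₁} {G : M → W₂} {p : M}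
    (hF : DiffAt n F p) (hG : DiffAt n G p) (v : TangentSpace (𝓡 n) p) :
    mvfderiv (𝓡 n) (fun q => B (F q) (G q)) p v =
      B (mvfderiv (𝓡 n) F p v) (G p) + B (F p) (mvfderiv (𝓡 n) G p v) := by
  rw [(hF.bilin B hG).mvfderiv_apply v, hF.mvfderiv_apply v, hG.mvfderiv_apply v]
  have := ((B.hasFDerivAt.comp _ hF.differentiableAt.hasFDerivAt).clm_apply
    hG.differentiableAt.hasFDerivAt).fderiv
  refine (congrArg (fun T : EuclideanSpace ℝ (Fin n) →L[ℝ] W => T v) this).trans ?_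
  have h0 : (extChartAt (𝓡 n) p).symm (extChartAt (𝓡 n) p p) = p := extChartAt_to_inv p
  simp only [Function.comp_apply, h0]
  exact add_comm _ _

variable [IsManifold (𝓡 n) ∞ M]

/-- The coordinate vector field of the preferred chart at `p` with constant components `u`. -/
def coordField (p : M) (u : EuclideanSpace ℝ (Fin n)) (q : M) : TangentSpace (𝓡 n) q :=
  (trivializationAt (EuclideanSpace ℝ (Fin n)) (TangentSpace (𝓡 n) : M → Type _) p).symmL ℝ q u

lemma SmoothAt.eventually_one {F : M → W} {p : M} (hF : SmoothAt n F p) :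
    ∀ᶠ r in 𝓝 p, ContMDiffAt (𝓡 n) 𝓘(ℝ, W) 1 F r :=
  (contMDiffAt_iff_contMDiffAt_nhds (by simp)).1 (hF.of_le (by simp))

lemma coordField_self (p : M) (u : EuclideanSpace ℝ (Fin n)) : coordField p u p = u := by
  unfold coordField
  rw [TangentBundle.symmL_trivializationAt (mem_chart_source _ p),
    mfderivWithin_range_extChartAt_symm]
  rfl

/-- The derivative along a coordinate field is the derivative of the function read in the chart. -/
lemma mvfderiv_coordField {p q : M} (hq : q ∈ (chartAt (EuclideanSpace ℝ (Fin n)) p).source)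
    {F : M → W} (hF : DiffAt n F q) (u : EuclideanSpace ℝ (Fin n)) :
    mvfderiv (𝓡 n) F q (coordField p u q) =
      fderiv ℝ (F ∘ (extChartAt (𝓡 n) p).symm) (extChartAt (𝓡 n) p q) u := by
  unfold coordField
  rw [TangentBundle.symmL_trivializationAt hq]
  have hq' : extChartAt (𝓡 n) p q ∈ (extChartAt (𝓡 n) p).target :=
    (extChartAt (𝓡 n) p).map_source (by simpa using hq)
  have hs : MDifferentiableWithinAt 𝓘(ℝ, EuclideanSpace ℝ (Fin n)) (𝓡 n)
      (extChartAt (𝓡 n) p).symm (Set.range (𝓡 n)) (extChartAt (𝓡 n) p q) :=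
    mdifferentiableWithinAt_extChartAt_symm hq'
  have h0 : (extChartAt (𝓡 n) p).symm (extChartAt (𝓡 n) p q) = q :=
    (extChartAt (𝓡 n) p).left_inv (by simpa using hq)
  rw [modelWithCornersSelf_coe, Set.range_id, mdifferentiableWithinAt_univ] at hs
  rw [modelWithCornersSelf_coe, Set.range_id, mfderivWithin_univ]
  have hc := mfderiv_comp_apply_of_eq (I := 𝓘(ℝ, EuclideanSpace ℝ (Fin n))) (I' := 𝓡 n)
    (I'' := 𝓘(ℝ, W)) (g := F) _ hF hs h0 u
  rw [mfderiv_eq_fderiv] at hc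
  exact hc.symm

lemma contMDiffAt_iff_chart {p q : M} (hq : q ∈ (chartAt (EuclideanSpace ℝ (Fin n)) p).source)
    {F : M → W} {k : WithTop ℕ∞} (hk : k ≤ ∞) :
    ContMDiffAt (𝓡 n) 𝓘(ℝ, W) k F q ↔
      ContDiffAt ℝ k (F ∘ (extChartAt (𝓡 n) p).symm) (extChartAt (𝓡 n) p q) := by
  have : IsManifold (𝓡 n) k M := IsManifold.of_le hk
  rw [contMDiffAt_iff_source_of_mem_source hq, modelWithCornersSelf_coe, Set.range_id,
    contMDiffWithinAt_univ, contMDiffAt_iff_contDiffAt]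

/-- Derivatives of smooth functions along coordinate fields are smooth, on the whole domain of the
chart. -/
lemma SmoothAt.coordDeriv {p q : M}
    (hq : q ∈ (chartAt (EuclideanSpace ℝ (Fin n)) p).source)
    {F : M → W} (hF : SmoothAt n F q) (u : EuclideanSpace ℝ (Fin n)) :
    SmoothAt n (fun r => mvfderiv (𝓡 n) F r (coordField p u r)) q := by
  have hq' : q ∈ (extChartAt (𝓡 n) p).source := by simpa using hq
  have h1 : ∀ᶠ r in 𝓝 q, ContMDiffAt (𝓡 n) 𝓘(ℝ, W) 1 F r :=
     hF.eventually_one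
  have h2 : ∀ᶠ r in 𝓝 q, r ∈ (chartAt (EuclideanSpace ℝ (Fin n)) p).source :=
    (chartAt (EuclideanSpace ℝ (Fin n)) p).open_source.mem_nhds hq
  have h3 : (fun r => mvfderiv (𝓡 n) F r (coordField p u r)) =ᶠ[𝓝 q]
      fun r => fderiv ℝ (F ∘ (extChartAt (𝓡 n) p).symm) (extChartAt (𝓡 n) p r) u := by
    filter_upwards [h1, h2] with r hr hr2
    exact mvfderiv_coordField hr2 (hr.mdifferentiableAt (by simp)) u
  refine ContMDiffAt.congr_of_eventuallyEq ?_ h3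
  have h4 := ((contMDiffAt_iff_chart hq le_rfl).1 hF).fderiv_right (m := ∞) (by simp)
  have h5 := h4.clm_apply (contDiffAt_const (c := u))
  exact h5.contMDiffAt.comp q (contMDiffAt_extChartAt' hq)

/-- Mixed second derivatives along the coordinate fields of the chart at `p` commute at `p`. -/
lemma SmoothAt.coordDeriv_comm {p : M} {F : M → W} (hF : SmoothAt n F p)
    (u v : EuclideanSpace ℝ (Fin n)) :
    mvfderiv (𝓡 n) (fun r => mvfderiv (𝓡 n) F r (coordField p u r)) p v =
      mvfderiv (𝓡 n) (fun r => mvfderiv (𝓡 n) F r (coordField p v r)) p u := by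
  have hp := mem_chart_source (EuclideanSpace ℝ (Fin n)) p
  have hc := (contMDiffAt_iff_chart hp le_rfl).1 hF
  have key : ∀ u v : EuclideanSpace ℝ (Fin n),
      mvfderiv (𝓡 n) (fun r => mvfderiv (𝓡 n) F r (coordField p u r)) p v =
      fderiv ℝ (fderiv ℝ (F ∘ (extChartAt (𝓡 n) p).symm)) (extChartAt (𝓡 n) p p) v u := by
    intro u v
    rw [(hF.coordDeriv hp u).diffAt.mvfderiv_apply v]
    have h1 : ∀ᶠ r in 𝓝 p, ContMDiffAt (𝓡 n) 𝓘(ℝ, W) 1 F r :=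
       hF.eventually_one
    have h2 : ∀ᶠ z in 𝓝 (extChartAt (𝓡 n) p p), z ∈ (extChartAt (𝓡 n) p).target :=
      extChartAt_target_mem_nhds p
    have h3 : Tendsto (extChartAt (𝓡 n) p).symm (𝓝 (extChartAt (𝓡 n) p p)) (𝓝 p) := by
      have := continuousAt_extChartAt_symm (I := 𝓡 n) p
      rwa [ContinuousAt, extChartAt_to_inv] at this
    have h4 : ((fun r => mvfderiv (𝓡 n) F r (coordField p u r)) ∘ (extChartAt (𝓡 n) p).symm)
        =ᶠ[𝓝 (extChartAt (𝓡 n) p p)]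
        fun z => fderiv ℝ (F ∘ (extChartAt (𝓡 n) p).symm) z u := by
      filter_upwards [h3.eventually h1, h2] with z hz hz2
      have hz3 : (extChartAt (𝓡 n) p).symm z ∈
          (chartAt (EuclideanSpace ℝ (Fin n)) p).source := by
        simpa using (extChartAt (𝓡 n) p).map_target hz2
      have := mvfderiv_coordField hz3 (hz.mdifferentiableAt (by simp)) u
      rw [(extChartAt (𝓡 n) p).right_inv hz2] at this
      exact this
    rw [h4.fderiv_eq]
    have h5 := (hc.fderiv_right (m := 1) (by exact WithTop.coe_le_coe.2 le_top)).differentiableAt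
      (by simp)
    have h6 := fderiv_clm_apply h5 (differentiableAt_const u)
    rw [h6]
    simp
  rw [key, key]
  exact (hc.isSymmSndFDerivAt (by simp; exact WithTop.coe_le_coe.2 le_top)).eq v u

lemma coordField_injective {p q : M}
    (hq : q ∈ (chartAt (EuclideanSpace ℝ (Fin n)) p).source) {u : EuclideanSpace ℝ (Fin n)}
    (hu : coordField p u q = 0) : u = 0 := by
  have := Bundle.Trivialization.continuousLinearMapAt_symmL (R := ℝ)
    (trivializationAt (EuclideanSpace ℝ (Fin n))
    (TangentSpace (𝓡 n) : M → Type _) p) (by simpa using hq) u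
  unfold coordField at hu
  rw [hu, map_zero] at this
  exact this.symm

lemma coordField_eq_localFrame {p q : M}
    (hq : q ∈ (chartAt (EuclideanSpace ℝ (Fin n)) p).source) (a : Fin n) :
    coordField p (EuclideanSpace.basisFun (Fin n) ℝ a) q =
      (trivializationAt (EuclideanSpace ℝ (Fin n)) (TangentSpace (𝓡 n) : M → Type _) p).localFrame
        (EuclideanSpace.basisFun (Fin n) ℝ).toBasis a q := by
  rw [Bundle.Trivialization.localFrame_apply_of_mem_baseSet _ _ (by simpa using hq)]
  simp [Bundle.Trivialization.basisAt, coordField]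
  rw [Bundle.Trivialization.symmL_apply]
  simpa using hq

end Calculus
end DeSitter

end


/-! ### Inverse matrices, linear systems and vector fields -/

noncomputable section
namespace DeSitter

section Inverse

variable {ι : Type*} [Fintype ι] [DecidableEq ι]

lemma contDiff_det {X : Type*} [NormedAddCommGroup X] [NormedSpace ℝ X]
    {A : X → Matrix ι ι ℝ} (hA : ∀ i j, ContDiff ℝ ∞ fun x => A x i j) :
    ContDiff ℝ ∞ fun x => (A x).det := by
  simp only [Matrix.det_apply]
  refine ContDiff.sum fun σ _ => ContDiff.const_smul _ ?_
  exact contDiff_prod fun i _ => hA _ _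

/-- The entries of the inverse of a matrix are smooth functions of the entries of the matrix. -/
lemma contDiffAt_inv_entry {A : ι → ι → ℝ} (hA : (Matrix.of A).det ≠ 0) (i j : ι) :
    ContDiffAt ℝ ∞ (fun A : ι → ι → ℝ => (Matrix.of A)⁻¹ i j) A := by
  have h0 : ∀ k l, ContDiff ℝ ∞ fun A : ι → ι → ℝ => (Matrix.of A) k l := fun k l => by
    simp only [Matrix.of_apply]; fun_prop
  have h1 : ContDiff ℝ ∞ fun A : ι → ι → ℝ => (Matrix.of A).adjugate i j := by
    simp only [Matrix.adjugate_apply]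
    refine contDiff_det fun k l => ?_
    by_cases h : k = j
    · subst h; simp only [Matrix.updateRow_self]; exact contDiff_const
    · simp only [Matrix.updateRow_ne h]; exact h0 k l
  have h2 : ContDiffAt ℝ ∞ (fun A : ι → ι → ℝ => ((Matrix.of A).det)⁻¹) A :=
    ((contDiff_det h0).contDiffAt).inv hA
  have h3 := h2.mul h1.contDiffAt
  refine h3.congr_of_eventuallyEq (Eventually.of_forall fun B => ?_)
  simp [Matrix.inv_def]

end Inverse

section Calculus

variable {n : ℕ} {M : Type*} [TopologicalSpace M] [ChartedSpace (EuclideanSpace ℝ (Fin n)) M]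
  {W W₁ W₂ : Type*} [NormedAddCommGroup W] [NormedSpace ℝ W]
  [NormedAddCommGroup W₁] [NormedSpace ℝ W₁] [NormedAddCommGroup W₂] [NormedSpace ℝ W₂]

lemma SmoothAt.pi {ι : Type*} [Fintype ι] {F : M → ι → W} {p : M}
    (h : ∀ i, SmoothAt n (fun q => F q i) p) : SmoothAt n F p :=
  contMDiffAt_pi_space.2 h

lemma SmoothAt.comp_fun {φ : W → W₁} {F : M → W} {p : M} (hφ : ContDiffAt ℝ ∞ φ (F p))
    (hF : SmoothAt n F p) : SmoothAt n (fun q => φ (F q)) p :=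
  hφ.contMDiffAt.comp p hF

lemma SmoothAt.sum {ι : Type*} {s : Finset ι} {F : ι → M → W} {p : M}
    (h : ∀ i ∈ s, SmoothAt n (F i) p) : SmoothAt n (fun q => ∑ i ∈ s, F i q) p :=
  ContMDiffAt.sum h

lemma SmoothAt.inv_entry {ι : Type*} [Fintype ι] [DecidableEq ι] {A : M → Matrix ι ι ℝ} {p : M}
    (h : ∀ i j, SmoothAt n (fun q => A q i j) p) (hA : (A p).det ≠ 0) (i j : ι) :
    SmoothAt n (fun q => (A q)⁻¹ i j) p :=
  SmoothAt.comp_fun (φ := fun A : ι → ι → ℝ => (Matrix.of A)⁻¹ i j)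
    (contDiffAt_inv_entry (A := A p) hA i j) (SmoothAt.pi fun i => SmoothAt.pi fun j => h i j)

/-- Coefficients of a smooth vector with respect to smooth, linearly independent vectors
are smooth. -/
lemma smoothAt_of_sum_smul [FiniteDimensional ℝ W] {ι : Type*} [Fintype ι]
    {m : ι → M → W} {p : M} (hm : ∀ a, SmoothAt n (m a) p)
    (hi : LinearIndependent ℝ fun a => m a p) {w : M → W} (hw : SmoothAt n w p)
    {z : ι → M → ℝ} (hz : ∀ᶠ q in 𝓝 p, ∑ a, z a q • m a q = w q) (a : ι) :
    SmoothAt n (z a) p := by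
  classical
  obtain ⟨P, hP⟩ : ∃ P : W →ₗ[ℝ] (ι → ℝ),
      P ∘ₗ Fintype.linearCombination ℝ (fun a => m a p) = LinearMap.id := by
    apply LinearMap.exists_leftInverse_of_injective
    rw [LinearMap.ker_eq_bot']
    intro g hg
    rw [Fintype.linearCombination_apply] at hg
    exact funext (Fintype.linearIndependent_iff.1 hi g hg)
  let Pc : ι → W →L[ℝ] ℝ := fun b =>
    (LinearMap.proj b ∘ₗ P).toContinuousLinearMap
  let A : M → Matrix ι ι ℝ := fun q => Matrix.of fun b a => Pc b (m a q)
  have hA : ∀ b a, SmoothAt n (fun q => A q b a) p := fun b a =>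
    (Pc b).contMDiff.contMDiffAt.comp p (hm a)
  have hA1 : A p = 1 := by
    ext b a
    have := congrArg (fun T : (ι → ℝ) →ₗ[ℝ] (ι → ℝ) => T (Pi.single a 1) b) hP
    simp only [LinearMap.comp_apply, Fintype.linearCombination_apply, LinearMap.id_apply] at this
    simp only [A, Pc, Matrix.of_apply, Matrix.one_apply]
    rw [show ∑ i, (Pi.single a 1 : ι → ℝ) i • m i p = m a p by
      simp [Pi.single_apply, ite_smul]] at this
    change P (m a p) b = _
    rw [this, Pi.single_apply]
  have hdet : (A p).det ≠ 0 := by rw [hA1]; simp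
  have hdetn : ∀ᶠ q in 𝓝 p, (A q).det ≠ 0 := by
    have : ContinuousAt (fun q => (A q).det) p := by
      have hc : ContinuousAt A p := by
        refine continuousAt_pi.2 fun b => continuousAt_pi.2 fun a => (hA b a).continuousAt
      exact (continuous_id.matrix_det.continuousAt).comp hc
    exact this.eventually_ne hdet
  have hs : SmoothAt n (fun q => ∑ b, (A q)⁻¹ a b * Pc b (w q)) p := by
    refine SmoothAt.sum fun b _ => ?_
    exact (SmoothAt.inv_entry hA hdet a b).mul ((Pc b).contMDiff.contMDiffAt.comp p hw)
  refine hs.congr_of_eventuallyEq ?_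
  filter_upwards [hz, hdetn] with q hq hd
  have h1 : (A q).mulVec (fun a => z a q) = fun b => Pc b (w q) := by
    ext b
    rw [← hq, map_sum]
    simp [Matrix.mulVec, dotProduct, A, mul_comm]
  have h2 : (fun a => z a q) = (A q)⁻¹.mulVec (fun b => Pc b (w q)) := by
    rw [← h1, Matrix.mulVec_mulVec, Matrix.nonsing_inv_mul _ (isUnit_iff_ne_zero.2 hd),
      Matrix.one_mulVec]
  have := congrFun h2 a
  simpa [Matrix.mulVec, dotProduct] using this

lemma DiffAt.sum {ι : Type*} {s : Finset ι} {F : ι → M → W} {p : M}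
    (h : ∀ i ∈ s, DiffAt n (F i) p) : DiffAt n (fun q => ∑ i ∈ s, F i q) p := by
  classical
  induction s using Finset.induction_on with
  | empty => simpa using mdifferentiableAt_const
  | insert a s ha ih =>
    simp only [Finset.sum_insert ha]
    exact (h a (Finset.mem_insert_self _ _)).add
      (ih fun i hi => h i (Finset.mem_insert_of_mem hi))

lemma mvfderiv_finsum {ι : Type*} {s : Finset ι} {F : ι → M → W} {p : M}
    (h : ∀ i ∈ s, DiffAt n (F i) p) (v : TangentSpace (𝓡 n) p) :
    mvfderiv (𝓡 n) (fun q => ∑ i ∈ s, F i q) p v = ∑ i ∈ s, mvfderiv (𝓡 n) (F i) p v := by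
  classical
  induction s using Finset.induction_on with
  | empty =>
    simp only [Finset.sum_empty]
    exact congrArg (fun T : TangentSpace (𝓡 n) p →L[ℝ] W => T v) (mvfderiv_const (0 : W))
  | insert a s ha ih =>
    simp only [Finset.sum_insert ha]
    have h2 : DiffAt n (fun q => ∑ i ∈ s, F i q) p :=
      DiffAt.sum fun i hi => h i (Finset.mem_insert_of_mem hi)
    rw [mvfderiv_fun_add (h a (Finset.mem_insert_self _ _)) h2]
    rw [← ih fun i hi => h i (Finset.mem_insert_of_mem hi)]
    rfl

lemma DiffAt.smul {f : M → ℝ} {F : M → W} {p : M} (hf : DiffAt n f p)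
    (hF : DiffAt n F p) : DiffAt n (fun q => f q • F q) p :=
  hf.bilin (ContinuousLinearMap.lsmul ℝ ℝ) hF

lemma mvfderiv_smul_apply {f : M → ℝ} {F : M → W} {p : M} (hf : DiffAt n f p)
    (hF : DiffAt n F p) (v : TangentSpace (𝓡 n) p) :
    mvfderiv (𝓡 n) (fun q => f q • F q) p v =
      mvfderiv (𝓡 n) f p v • F p + f p • mvfderiv (𝓡 n) F p v :=
  mvfderiv_bilin (ContinuousLinearMap.lsmul ℝ ℝ) hf hF v

variable [IsManifold (𝓡 n) ∞ M]

/-- Components of a vector field in the coordinate frame of the chart at `p`. -/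
lemma exists_components (p : M) (Y : (q : M) → TangentSpace (𝓡 n) q) :
    ∃ y : Fin n → M → ℝ,
      (∀ q ∈ (chartAt (EuclideanSpace ℝ (Fin n)) p).source,
        Y q = ∑ a, y a q • coordField p (EuclideanSpace.basisFun (Fin n) ℝ a) q) ∧
      (LightlikeHypersurface.FieldDiffAt Y p → ∀ a, DiffAt n (y a) p) ∧
      (ContMDiffAt (𝓡 n) (𝓡 n).tangent ∞ (fun q => (⟨q, Y q⟩ : TangentBundle (𝓡 n) M)) p →
        ∀ a, SmoothAt n (y a) p) := by
  let e := trivializationAt (EuclideanSpace ℝ (Fin n)) (TangentSpace (𝓡 n) : M → Type _) p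
  let b := (EuclideanSpace.basisFun (Fin n) ℝ).toBasis
  have hp : p ∈ e.baseSet := by simp [e]
  refine ⟨fun a q => e.localFrameCoeff (𝓡 n) b a q (Y q), fun q hq => ?_, fun h a => ?_,
    fun h a => ?_⟩
  · have hq' : q ∈ e.baseSet := by simpa [e] using hq
    refine (Bundle.Trivialization.eq_sum_localFrameCoeff_smul (I := 𝓡 n) (b := b) (s := Y)
      hq').trans ?_
    refine Finset.sum_congr rfl fun a _ => ?_
    rw [coordField_eq_localFrame hq]
  · exact mdifferentiableAt_localFrameCoeff (e := e) b hp h a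
  · exact contMDiffAt_localFrameCoeff (e := e) b hp h a

lemma contMDiffAt_sum_coordField {p : M} {y : Fin n → M → ℝ} (hy : ∀ a, SmoothAt n (y a) p) :
    ContMDiffAt (𝓡 n) (𝓡 n).tangent ∞ (fun q => (⟨q, ∑ a, y a q •
      coordField p (EuclideanSpace.basisFun (Fin n) ℝ a) q⟩ : TangentBundle (𝓡 n) M)) p := by
  let e := trivializationAt (EuclideanSpace ℝ (Fin n)) (TangentSpace (𝓡 n) : M → Type _) p
  let b := (EuclideanSpace.basisFun (Fin n) ℝ).toBasis
  have hp : p ∈ e.baseSet := by simp [e]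
  have h1 : ∀ a ∈ Finset.univ, ContMDiffAt (𝓡 n) ((𝓡 n).prod 𝓘(ℝ, EuclideanSpace ℝ (Fin n))) ∞
      (fun q => Bundle.TotalSpace.mk' (EuclideanSpace ℝ (Fin n)) q
        (y a q • e.localFrame b a q : TangentSpace (𝓡 n) q)) p := fun a _ =>
    (hy a).smul_section (contMDiffAt_localFrame_of_mem ∞ e b a hp)
  have h2 := ContMDiffAt.sum_section h1
  refine h2.congr_of_eventuallyEq ?_
  filter_upwards [(chartAt (EuclideanSpace ℝ (Fin n)) p).open_source.mem_nhds
    (mem_chart_source _ p)] with q hq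
  congr 1
  refine Finset.sum_congr rfl fun a _ => ?_
  rw [coordField_eq_localFrame hq]

lemma fieldSmoothAt_coordField (p : M) (u : EuclideanSpace ℝ (Fin n)) :
    ContMDiffAt (𝓡 n) (𝓡 n).tangent ∞
      (fun q => (⟨q, coordField p u q⟩ : TangentBundle (𝓡 n) M)) p := by
  have := contMDiffAt_sum_coordField (p := p) (y := fun a _ => u a)
    (fun a => contMDiffAt_const)
  convert this using 3 with q
  conv_lhs => rw [← (EuclideanSpace.basisFun (Fin n) ℝ).sum_repr u]
  unfold coordField
  rw [map_sum]
  simp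

lemma fieldDiffAt_coordField (p : M) (u : EuclideanSpace ℝ (Fin n)) :
    LightlikeHypersurface.FieldDiffAt (coordField p u) p :=
  (fieldSmoothAt_coordField p u).mdifferentiableAt (by simp)

lemma lieBracketWithin_univ_of_eventuallyEq_const {E : Type*} [NormedAddCommGroup E]
    [NormedSpace ℝ E] {X Y : E → E} {x u v : E} (hX : X =ᶠ[𝓝 x] fun _ => u)
    (hY : Y =ᶠ[𝓝 x] fun _ => v) {s : Set E} (hs : s = Set.univ) :
    VectorField.lieBracketWithin ℝ X Y s x = 0 := by
  rw [hs, VectorField.lieBracketWithin_univ, hX.lieBracket_vectorField_eq hY]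
  simp [VectorField.lieBracket]

/-- Coordinate fields commute. -/
lemma mlieBracket_coordField (p : M) (u v : EuclideanSpace ℝ (Fin n)) :
    VectorField.mlieBracket (𝓡 n) (coordField p u) (coordField p v) p = 0 := by
  rw [← VectorField.mlieBracketWithin_univ, VectorField.mlieBracketWithin_apply]
  have key : ∀ u : EuclideanSpace ℝ (Fin n),
      VectorField.mpullbackWithin 𝓘(ℝ, EuclideanSpace ℝ (Fin n)) (𝓡 n)
        (extChartAt (𝓡 n) p).symm (coordField p u) (Set.range (𝓡 n))
        =ᶠ[𝓝 (extChartAt (𝓡 n) p p)] fun _ => u := by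
    intro u
    filter_upwards [extChartAt_target_mem_nhds (I := 𝓡 n) p] with z hz
    have hz3 : (extChartAt (𝓡 n) p).symm z ∈
        (chartAt (EuclideanSpace ℝ (Fin n)) p).source := by
      simpa using (extChartAt (𝓡 n) p).map_target hz
    rw [VectorField.mpullbackWithin_apply]
    unfold coordField
    rw [TangentBundle.symmL_trivializationAt hz3, (extChartAt (𝓡 n) p).right_inv hz]
    exact (isInvertible_mfderivWithin_extChartAt_symm hz).inverse_apply_self _
  have h : VectorField.lieBracketWithin ℝ
      (VectorField.mpullbackWithin 𝓘(ℝ, EuclideanSpace ℝ (Fin n)) (𝓡 n)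
        (extChartAt (𝓡 n) p).symm (coordField p u) (Set.range (𝓡 n)))
      (VectorField.mpullbackWithin 𝓘(ℝ, EuclideanSpace ℝ (Fin n)) (𝓡 n)
        (extChartAt (𝓡 n) p).symm (coordField p v) (Set.range (𝓡 n)))
      ((extChartAt (𝓡 n) p).symm ⁻¹' Set.univ ∩ Set.range (𝓡 n)) (extChartAt (𝓡 n) p p) = 0 :=
    lieBracketWithin_univ_of_eventuallyEq_const (key u) (key v) (by simp)
  exact (congrArg _ h).trans (map_zero _)

lemma mvfderiv_field_eq {p : M} {Y : (q : M) → TangentSpace (𝓡 n) q} {y : Fin n → M → ℝ}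
    (hY : ∀ q ∈ (chartAt (EuclideanSpace ℝ (Fin n)) p).source,
        Y q = ∑ a, y a q • coordField p (EuclideanSpace.basisFun (Fin n) ℝ a) q) (F : M → W) :
    (fun q => mvfderiv (𝓡 n) F q (Y q)) =ᶠ[𝓝 p] fun q => ∑ a, y a q •
      mvfderiv (𝓡 n) F q (coordField p (EuclideanSpace.basisFun (Fin n) ℝ a) q) := by
  filter_upwards [(chartAt (EuclideanSpace ℝ (Fin n)) p).open_source.mem_nhds
    (mem_chart_source _ p)] with q hq
  rw [hY q hq, map_sum]
  simp

/-- The derivative of `F` along a differentiable vector field is differentiable. -/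
lemma SmoothAt.diffAt_field {p : M} {Y : (q : M) → TangentSpace (𝓡 n) q}
    (hY : LightlikeHypersurface.FieldDiffAt Y p) {F : M → W} (hF : SmoothAt n F p) :
    DiffAt n (fun q => mvfderiv (𝓡 n) F q (Y q)) p := by
  obtain ⟨y, h1, h2, -⟩ := exists_components p Y
  refine MDifferentiableAt.congr_of_eventuallyEq ?_ (mvfderiv_field_eq h1 F)
  refine DiffAt.sum fun a _ => ?_
  exact (h2 hY a).smul (hF.coordDeriv (mem_chart_source _ p) _).diffAt

lemma SmoothAt.smoothAt_field {p : M} {Y : (q : M) → TangentSpace (𝓡 n) q}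
    (hY : ContMDiffAt (𝓡 n) (𝓡 n).tangent ∞ (fun q => (⟨q, Y q⟩ : TangentBundle (𝓡 n) M)) p)
    {F : M → W} (hF : SmoothAt n F p) :
    SmoothAt n (fun q => mvfderiv (𝓡 n) F q (Y q)) p := by
  obtain ⟨y, h1, -, h2⟩ := exists_components p Y
  refine ContMDiffAt.congr_of_eventuallyEq ?_ (mvfderiv_field_eq h1 F)
  refine SmoothAt.sum fun a _ => ?_
  exact (h2 hY a).smul (hF.coordDeriv (mem_chart_source _ p) _)

/-- A vector field is smooth as soon as the derivative along it of an immersion is. -/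
lemma fieldSmoothAt_of_mvfderiv [FiniteDimensional ℝ W] {p : M}
    {Y : (q : M) → TangentSpace (𝓡 n) q} {F : M → W} (hF : SmoothAt n F p)
    (hi : ∀ v, mvfderiv (𝓡 n) F p v = 0 → v = 0)
    (hY : SmoothAt n (fun q => mvfderiv (𝓡 n) F q (Y q)) p) :
    ContMDiffAt (𝓡 n) (𝓡 n).tangent ∞ (fun q => (⟨q, Y q⟩ : TangentBundle (𝓡 n) M)) p := by
  obtain ⟨y, h1, -, -⟩ := exists_components p Y
  have hp := mem_chart_source (EuclideanSpace ℝ (Fin n)) p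
  have hy : ∀ a, SmoothAt n (y a) p := by
    refine smoothAt_of_sum_smul (fun a => hF.coordDeriv hp (EuclideanSpace.basisFun (Fin n) ℝ a))
      ?_ hY ((mvfderiv_field_eq h1 F).mono fun q hq => hq.symm)
    rw [Fintype.linearIndependent_iff]
    intro g hg a
    have h3 : mvfderiv (𝓡 n) F p (coordField p
        (∑ a, g a • EuclideanSpace.basisFun (Fin n) ℝ a) p) = 0 := by
      rw [← hg]
      unfold coordField
      simp only [map_sum, map_smul]
    have h4 := coordField_injective hp (hi _ h3)
    have h5 := (EuclideanSpace.basisFun (Fin n) ℝ).toBasis.linearIndependent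
    rw [Fintype.linearIndependent_iff] at h5
    exact h5 g (by simpa using h4) a
  refine (contMDiffAt_sum_coordField hy).congr_of_eventuallyEq ?_
  filter_upwards [(chartAt (EuclideanSpace ℝ (Fin n)) p).open_source.mem_nhds hp] with q hq
  rw [h1 q hq]

/-- The second derivative of `F` along a differentiable field, in components. -/
lemma mvfderiv_mvfderiv_field {p : M} {Y : (q : M) → TangentSpace (𝓡 n) q}
    (hY : LightlikeHypersurface.FieldDiffAt Y p) :
    ∃ (c : Fin n → TangentSpace (𝓡 n) p → ℝ) (y : Fin n → ℝ), ∀ (F : M → W), SmoothAt n F p →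
      ∀ v, mvfderiv (𝓡 n) (fun q => mvfderiv (𝓡 n) F q (Y q)) p v =
        ∑ a, (c a v • mvfderiv (𝓡 n) F p (coordField p (EuclideanSpace.basisFun (Fin n) ℝ a) p) +
          y a • mvfderiv (𝓡 n) (fun q => mvfderiv (𝓡 n) F q
            (coordField p (EuclideanSpace.basisFun (Fin n) ℝ a) q)) p v) := by
  obtain ⟨y, h1, h2, -⟩ := exists_components p Y
  refine ⟨fun a v => mvfderiv (𝓡 n) (y a) p v, fun a => y a p, fun F hF v => ?_⟩
  have hp := mem_chart_source (EuclideanSpace ℝ (Fin n)) p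
  rw [mvfderiv_congr (mvfderiv_field_eq h1 F), mvfderiv_finsum]
  · refine Finset.sum_congr rfl fun a _ => ?_
    exact mvfderiv_smul_apply (h2 hY a) (hF.coordDeriv hp _).diffAt v
  · intro a _
    exact (h2 hY a).smul (hF.coordDeriv hp _).diffAt

/-- The coordinate vector field of the chart at `p` that extends the tangent vector `u` at `p`. -/
def tangentField (p : M) (u : TangentSpace (𝓡 n) p) (q : M) : TangentSpace (𝓡 n) q :=
  coordField p u q

lemma tangentField_self (p : M) (u : TangentSpace (𝓡 n) p) : tangentField p u p = u :=
  coordField_self p u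

lemma fieldDiffAt_tangentField (p : M) (u : TangentSpace (𝓡 n) p) :
    LightlikeHypersurface.FieldDiffAt (tangentField p u) p :=
  fieldDiffAt_coordField p u

lemma mlieBracket_tangentField (p : M) (u v : TangentSpace (𝓡 n) p) :
    VectorField.mlieBracket (𝓡 n) (tangentField p u) (tangentField p v) p = 0 :=
  mlieBracket_coordField p u v

lemma SmoothAt.tangentDeriv {p : M} {F : M → W} (hF : SmoothAt n F p)
    (u : TangentSpace (𝓡 n) p) :
    SmoothAt n (fun r => mvfderiv (𝓡 n) F r (tangentField p u r)) p :=
  hF.coordDeriv (mem_chart_source _ p) u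

/-- Mixed second derivatives along coordinate fields commute. -/
lemma SmoothAt.tangentDeriv_comm {p : M} {F : M → W} (hF : SmoothAt n F p)
    (u v : TangentSpace (𝓡 n) p) :
    mvfderiv (𝓡 n) (fun r => mvfderiv (𝓡 n) F r (tangentField p u r)) p v =
      mvfderiv (𝓡 n) (fun r => mvfderiv (𝓡 n) F r (tangentField p v r)) p u :=
  hF.coordDeriv_comm u v

/-- The coordinate basis of the tangent space. -/
def tangentBasis (p : M) : Basis (Fin n) ℝ (TangentSpace (𝓡 n) p) :=
  (EuclideanSpace.basisFun (Fin n) ℝ).toBasis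

end Calculus
end DeSitter

end


/-! ### The quadratic form and lifts of moving points -/

noncomputable section
namespace DeSitter

section Form

variable {n : ℕ}

lemma form_apply (x y : Amb n) : form n x y =
    (∑ i : Fin (n + 1), x i.castSucc * y i.castSucc) -
      x (Fin.last (n + 1)) * y (Fin.last (n + 1)) :=
  rfl

lemma form_comm (x y : Amb n) : form n x y = form n y x := by
  simp only [form_apply, mul_comm]

lemma eq_zero_of_form {x : Amb n} (h : ∀ y, form n y x = 0) : x = 0 := by
  ext i
  have := h (Pi.single i 1)
  rw [form_apply] at this
  induction i using Fin.lastCases with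
  | last => simpa [Pi.single_apply, Fin.castSucc_ne_last] using this
  | cast i => simpa [Pi.single_apply, (Fin.castSucc_ne_last i).symm] using this

lemma form_nondegenerate : (form n).Nondegenerate :=
  ⟨fun x hx => eq_zero_of_form fun y => by rw [form_comm]; exact hx y,
    fun x hx => eq_zero_of_form hx⟩

lemma form_isRefl : (form n).IsRefl := fun x y h => by rw [form_comm]; exact h

/-- Two orthogonal isotropic vectors are proportional, because the signature is `(n + 1, 1)`. -/
lemma isotropic_orthogonal {x y : Amb n} (hx : form n x x = 0) (hy : form n y y = 0)
    (hxy : form n x y = 0) (hy0 : y ≠ 0) : ∃ c : ℝ, x = c • y := by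
  rw [form_apply] at hx hy hxy
  set x0 := x (Fin.last (n + 1))
  set y0 := y (Fin.last (n + 1))
  -- `y0 • x - x0 • y` is isotropic and its last coordinate vanishes, so it is zero
  have hsq : ∑ i : Fin (n + 1), (y0 * x i.castSucc - x0 * y i.castSucc) ^ 2 = 0 := by
    have : ∀ i : Fin (n + 1), (y0 * x i.castSucc - x0 * y i.castSucc) ^ 2 =
        y0 ^ 2 * (x i.castSucc * x i.castSucc) - 2 * x0 * y0 * (x i.castSucc * y i.castSucc)
          + x0 ^ 2 * (y i.castSucc * y i.castSucc) := fun i => by ring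
    simp only [this, Finset.sum_add_distrib, Finset.sum_sub_distrib, ← Finset.mul_sum]
    linear_combination y0 ^ 2 * hx - 2 * x0 * y0 * hxy + x0 ^ 2 * hy
  -- an isotropic vector with vanishing last coordinate is zero
  have hy00 : y0 ≠ 0 := by
    intro h
    apply hy0
    have h2 : ∑ i : Fin (n + 1), y i.castSucc * y i.castSucc = 0 := by
      rw [h] at hy; linarith
    have h3 := (Finset.sum_eq_zero_iff_of_nonneg fun i _ => mul_self_nonneg _).1 h2
    ext i
    induction i using Fin.lastCases with
    | last => exact h
    | cast i => simpa using h3 i (Finset.mem_univ _)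
  have h4 := (Finset.sum_eq_zero_iff_of_nonneg fun i _ => sq_nonneg _).1 hsq
  refine ⟨x0 / y0, ?_⟩
  ext i
  induction i using Fin.lastCases with
  | last => simp only [Pi.smul_apply, smul_eq_mul]; exact (div_mul_cancel₀ x0 hy00).symm
  | cast i =>
    have h5 := h4 i (Finset.mem_univ _)
    rw [sq_eq_zero_iff] at h5
    simp only [Pi.smul_apply, smul_eq_mul]
    field_simp
    linarith

/-- The scalar product as a continuous bilinear map. -/
def formL (n : ℕ) : Amb n →L[ℝ] Amb n →L[ℝ] ℝ := (form n).toContinuousBilinearMap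

lemma formL_apply (x y : Amb n) : formL n x y = form n x y := rfl

lemma mem_orthogonal_span {y w : Amb n} : w ∈ (form n).orthogonal (ℝ ∙ y) ↔ form n y w = 0 := by
  rw [LinearMap.BilinForm.mem_orthogonal_iff]
  constructor
  · intro h
    exact h y (Submodule.mem_span_singleton_self y)
  · intro h m hm
    obtain ⟨c, rfl⟩ := Submodule.mem_span_singleton.1 hm
    change form n (c • y) w = 0
    simp [h]

lemma orthogonal_orthogonal (N : Submodule ℝ (Amb n)) :
    (form n).orthogonal ((form n).orthogonal N) = N :=
  LinearMap.BilinForm.orthogonal_orthogonal form_nondegenerate form_isRefl N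

end Form

section Smooth

variable {n : ℕ} {M : Type*} [TopologicalSpace M] [ChartedSpace (EuclideanSpace ℝ (Fin n)) M]

lemma SmoothAt.form {F G : M → Amb n} {p : M} (hF : SmoothAt n F p) (hG : SmoothAt n G p) :
    SmoothAt n (fun q => DeSitter.form n (F q) (G q)) p := hF.bilin (formL n) hG

lemma DiffAt.form {F G : M → Amb n} {p : M} (hF : DiffAt n F p) (hG : DiffAt n G p) :
    DiffAt n (fun q => DeSitter.form n (F q) (G q)) p := hF.bilin (formL n) hG

lemma mvfderiv_form {F G : M → Amb n} {p : M} (hF : DiffAt n F p) (hG : DiffAt n G p)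
    (v : TangentSpace (𝓡 n) p) :
    mvfderiv (𝓡 n) (fun q => form n (F q) (G q)) p v =
      form n (mvfderiv (𝓡 n) F p v) (G p) + form n (F p) (mvfderiv (𝓡 n) G p v) :=
  mvfderiv_bilin (formL n) hF hG v

lemma mvfderiv_eq_zero_of_eventually_const {W : Type*} [NormedAddCommGroup W] [NormedSpace ℝ W]
    {F : M → W} {p : M} {c : W} (h : ∀ᶠ q in 𝓝 p, F q = c) (v : TangentSpace (𝓡 n) p) :
    mvfderiv (𝓡 n) F p v = 0 := by
  rw [mvfderiv_congr (G := fun _ => c) h, mvfderiv_const]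
  rfl

/-- Differentiating a scalar product that is constant near `p`. -/
lemma form_mvfderiv_of_const {F G : M → Amb n} {p : M} {c : ℝ} (hF : DiffAt n F p)
    (hG : DiffAt n G p) (h : ∀ᶠ q in 𝓝 p, form n (F q) (G q) = c)
    (v : TangentSpace (𝓡 n) p) :
    form n (mvfderiv (𝓡 n) F p v) (G p) = - form n (F p) (mvfderiv (𝓡 n) G p v) := by
  have h1 := mvfderiv_form hF hG v
  rw [mvfderiv_eq_zero_of_eventually_const h v] at h1
  linarith

lemma IsLift.smoothAt {P : M → Submodule ℝ (Amb n)} {p : M} {f : M → Amb n} (h : IsLift P p f) :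
    SmoothAt n f p := h.self_of_nhds.1

lemma IsLift.ne_zero {P : M → Submodule ℝ (Amb n)} {p : M} {f : M → Amb n} (h : IsLift P p f) :
    f p ≠ 0 := h.self_of_nhds.2.1

lemma IsLift.eq {P : M → Submodule ℝ (Amb n)} {p : M} {f : M → Amb n} (h : IsLift P p f) :
    P p = ℝ ∙ f p := h.self_of_nhds.2.2

lemma IsLift.eventually {P : M → Submodule ℝ (Amb n)} {p : M} {f : M → Amb n}
    (h : IsLift P p f) : ∀ᶠ q in 𝓝 p, IsLift P q f := eventually_eventually_nhds.2 h

lemma IsLift.congr {P P' : M → Submodule ℝ (Amb n)} {p : M} {f : M → Amb n}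
    (h : IsLift P p f) (hP : ∀ᶠ q in 𝓝 p, P' q = P q) : IsLift P' p f := by
  filter_upwards [h, hP] with q hq hq'
  rw [hq']; exact hq

/-- The Euclidean scalar product of homogeneous coordinate vectors. -/
def euc (n : ℕ) : Amb n →L[ℝ] Amb n →L[ℝ] ℝ :=
  (dotProductBilin ℝ ℝ : Amb n →ₗ[ℝ] Amb n →ₗ[ℝ] ℝ).toContinuousBilinearMap

lemma euc_apply (x y : Amb n) : euc n x y = x ⬝ᵥ y := rfl

/-- Two lifts of a moving point differ by a smooth nonvanishing factor. -/
lemma IsLift.exists_factor {P : M → Submodule ℝ (Amb n)} {p : M} {f f' : M → Amb n}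
    (h : IsLift P p f) (h' : IsLift P p f') :
    ∃ μ : M → ℝ, SmoothAt n μ p ∧ μ p ≠ 0 ∧ f' =ᶠ[𝓝 p] fun q => μ q • f q := by
  have hev : f' =ᶠ[𝓝 p] fun q => (euc n (f' q) (f q) / euc n (f q) (f q)) • f q := by
    filter_upwards [h, h'] with q hq hq'
    have h1 : f' q ∈ ℝ ∙ f q := by
      rw [← hq.2.2, hq'.2.2]; exact Submodule.mem_span_singleton_self _
    obtain ⟨c, hc⟩ := Submodule.mem_span_singleton.1 h1
    have h2 : f q ⬝ᵥ f q ≠ 0 := by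
      rw [Ne, dotProduct_self_eq_zero]; exact hq.2.1
    rw [← hc]
    simp only [euc_apply, smul_dotProduct, smul_eq_mul]
    rw [mul_div_cancel_right₀ _ h2]
  refine ⟨_, ?_, ?_, hev⟩
  · refine (h'.smoothAt.bilin (euc n) h.smoothAt).div₀ (h.smoothAt.bilin (euc n) h.smoothAt) ?_
    rw [euc_apply, Ne, dotProduct_self_eq_zero]; exact h.ne_zero
  · intro h0
    have := hev.self_of_nhds
    simp only [h0, zero_smul] at this
    exact h'.ne_zero this

lemma IsLift.mvfderiv_factor {p : M} {f f' : M → Amb n} {μ : M → ℝ}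
    (hf : SmoothAt n f p) (hμ : SmoothAt n μ p) (he : f' =ᶠ[𝓝 p] fun q => μ q • f q)
    (v : TangentSpace (𝓡 n) p) :
    mvfderiv (𝓡 n) f' p v = mvfderiv (𝓡 n) μ p v • f p + μ p • mvfderiv (𝓡 n) f p v := by
  rw [mvfderiv_congr he]
  exact mvfderiv_smul_apply hμ.diffAt hf.diffAt v

/-- The projective tangent subspace, computed with one lift. -/
lemma IsLift.projTangent_eq {P : M → Submodule ℝ (Amb n)} {p : M} {f : M → Amb n}
    (h : IsLift P p f) :
    projTangent P p = (ℝ ∙ f p) ⊔ LinearMap.range (mvfderiv (𝓡 n) f p).toLinearMap := by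
  refine le_antisymm (iSup₂_le fun f' h' => ?_) (le_iSup₂_of_le f h le_rfl)
  obtain ⟨μ, hμ, -, he⟩ := h.exists_factor h'
  refine sup_le ?_ ?_
  · rw [← h'.eq, h.eq]; exact le_sup_left
  · rintro _ ⟨v, rfl⟩
    change mvfderiv (𝓡 n) f' p v ∈ _
    rw [IsLift.mvfderiv_factor h.smoothAt hμ he]
    exact add_mem (Submodule.mem_sup_left (Submodule.smul_mem _ _
      (Submodule.mem_span_singleton_self _)))
      (Submodule.mem_sup_right (Submodule.smul_mem _ _ ⟨v, rfl⟩))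

/-- The directions along which a moving point stays in a subspace through it, computed with one
lift: the choice of the lift changes the derivative by a multiple of the point itself. -/
lemma IsLift.directionsIn_eq {P : M → Submodule ℝ (Amb n)} {p : M} {f : M → Amb n}
    (h : IsLift P p f) {S : Submodule ℝ (Amb n)} (hS : P p ≤ S) :
    directionsIn P S p = S.comap (mvfderiv (𝓡 n) f p).toLinearMap := by
  refine le_antisymm (iInf₂_le f h) (le_iInf₂ fun f' h' => ?_)
  obtain ⟨μ, hμ, -, he⟩ := h.exists_factor h'
  intro v hv
  change mvfderiv (𝓡 n) f' p v ∈ S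
  rw [IsLift.mvfderiv_factor h.smoothAt hμ he]
  have hf : f p ∈ S := hS (by rw [h.eq]; exact Submodule.mem_span_singleton_self _)
  exact add_mem (Submodule.smul_mem _ _ hf) (Submodule.smul_mem _ _ hv)

end Smooth
end DeSitter

end


/-! ### Adapted frames and the first-order equations -/

noncomputable section
namespace DeSitter
namespace LightlikeHypersurface

variable {n : ℕ} {M : Type*} [TopologicalSpace M] [ChartedSpace (EuclideanSpace ℝ (Fin n)) M]
  (U : LightlikeHypersurface n M)

lemma exists_tangency (p : M) : ∃ y : Amb n, y ≠ 0 ∧ form n y y = 0 ∧ U.tangency p = ℝ ∙ y := by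
  obtain ⟨y, hy0, hy, h⟩ := U.lightlike p
  refine ⟨y, hy0, hy, ?_⟩
  unfold tangency tangentHyperplane
  change (form n).orthogonal (projTangent (fun q => (U.point q).submodule) p) = _
  rw [h, orthogonal_orthogonal]

lemma tangentHyperplane_eq (p : M) :
    U.tangentHyperplane p = (form n).orthogonal (U.tangency p) := by
  unfold tangency; rw [orthogonal_orthogonal]

variable {U}

lemma form_tangency_self {p : M} {a : Amb n} (ha : a ∈ U.tangency p) : form n a a = 0 := by
  obtain ⟨y, -, hy, h⟩ := U.exists_tangency p
  rw [h] at ha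
  obtain ⟨c, rfl⟩ := Submodule.mem_span_singleton.1 ha
  simp [hy]

lemma tangency_eq_span {p : M} {a : Amb n} (ha : a ∈ U.tangency p) (h0 : a ≠ 0) :
    U.tangency p = ℝ ∙ a := by
  obtain ⟨y, -, -, h⟩ := U.exists_tangency p
  rw [h] at ha ⊢
  obtain ⟨c, rfl⟩ := Submodule.mem_span_singleton.1 ha
  have hc : c ≠ 0 := by rintro rfl; simp at h0
  exact (Submodule.span_singleton_smul_eq (isUnit_iff_ne_zero.2 hc) y).symm

lemma mem_tangentHyperplane_iff {p : M} {a w : Amb n} (ha : a ∈ U.tangency p) (h0 : a ≠ 0) :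
    w ∈ U.tangentHyperplane p ↔ form n a w = 0 := by
  rw [U.tangentHyperplane_eq, tangency_eq_span ha h0, mem_orthogonal_span]

lemma pt_lift (U : LightlikeHypersurface n M) (p : M) : ∃ f, IsLift U.pt p f := U.smooth p

lemma form_lift_pos {p : M} {f : M → Amb n} (hf : IsLift U.pt p f) : 0 < form n (f p) (f p) :=
  U.exterior p (f p) (by
    have := hf.eq
    unfold pt at this
    rw [this]; exact Submodule.mem_span_singleton_self _) hf.ne_zero

lemma lift_mem_tangentHyperplane {p : M} {f : M → Amb n} (hf : IsLift U.pt p f) :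
    f p ∈ U.tangentHyperplane p := by
  unfold tangentHyperplane
  rw [hf.projTangent_eq]
  exact Submodule.mem_sup_left (Submodule.mem_span_singleton_self _)

lemma mvfderiv_lift_mem_tangentHyperplane {p : M} {f : M → Amb n} (hf : IsLift U.pt p f)
    (v : TangentSpace (𝓡 n) p) : mvfderiv (𝓡 n) f p v ∈ U.tangentHyperplane p := by
  unfold tangentHyperplane
  rw [hf.projTangent_eq]
  exact Submodule.mem_sup_right ⟨v, rfl⟩

/-- The hypersurface is immersed: a lift of the moving point and its derivatives along independent
directions are independent. -/
lemma eq_zero_of_mvfderiv_mem {p : M} {f : M → Amb n} (hf : IsLift U.pt p f)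
    {v : TangentSpace (𝓡 n) p} {c : ℝ} (h : mvfderiv (𝓡 n) f p v = c • f p) : v = 0 := by
  have hr := U.regular p
  change finrank ℝ (projTangent U.pt p) = n + 1 at hr
  rw [hf.projTangent_eq] at hr
  let T : (TangentSpace (𝓡 n) p) × ℝ →ₗ[ℝ] Amb n :=
    (mvfderiv (𝓡 n) f p).toLinearMap.coprod (LinearMap.toSpanSingleton ℝ _ (f p))
  have hrange : LinearMap.range T =
      (ℝ ∙ f p) ⊔ LinearMap.range (mvfderiv (𝓡 n) f p).toLinearMap := by
    rw [LinearMap.range_coprod, LinearMap.range_toSpanSingleton, sup_comm]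
  have : FiniteDimensional ℝ (TangentSpace (𝓡 n) p) :=
    inferInstanceAs (FiniteDimensional ℝ (EuclideanSpace ℝ (Fin n)))
  have hd : finrank ℝ (TangentSpace (𝓡 n) p) = n := by
    change finrank ℝ (EuclideanSpace ℝ (Fin n)) = n
    simp
  have hk := LinearMap.finrank_range_add_finrank_ker T
  rw [hrange, hr, Module.finrank_prod, hd, Module.finrank_self] at hk
  have hk0 : finrank ℝ (LinearMap.ker T) = 0 := by omega
  have hker : LinearMap.ker T = ⊥ := Submodule.finrank_eq_zero.1 hk0
  have hmem : (v, -c) ∈ LinearMap.ker T := by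
    rw [LinearMap.mem_ker]
    change mvfderiv (𝓡 n) f p v + (-c) • f p = 0
    rw [h]; simp
  rw [hker, Submodule.mem_bot] at hmem
  exact congrArg Prod.fst hmem

namespace Frame

variable {O : Set M} (𝔄 : U.Frame O) {p : M}

lemma smoothAt_A0 (hp : p ∈ O) : SmoothAt n 𝔄.A0 p :=
  (𝔄.smooth_A0 p hp).contMDiffAt (𝔄.isOpen.mem_nhds hp)

lemma smoothAt_A (hp : p ∈ O) (i) : SmoothAt n (𝔄.A i) p :=
  (𝔄.smooth_A i p hp).contMDiffAt (𝔄.isOpen.mem_nhds hp)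

lemma smoothAt_An (hp : p ∈ O) : SmoothAt n 𝔄.An p :=
  (𝔄.smooth_An p hp).contMDiffAt (𝔄.isOpen.mem_nhds hp)

lemma smoothAt_Ainf (hp : p ∈ O) : SmoothAt n 𝔄.Ainf p :=
  (𝔄.smooth_Ainf p hp).contMDiffAt (𝔄.isOpen.mem_nhds hp)

lemma eventually_mem (𝔄 : U.Frame O) (hp : p ∈ O) : ∀ᶠ q in 𝓝 p, q ∈ O := 𝔄.isOpen.mem_nhds hp

lemma A0_ne (hp : p ∈ O) : 𝔄.A0 p ≠ 0 := by
  intro h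
  have := 𝔄.gram_0_inf p hp
  simp [h] at this

lemma An_ne (hp : p ∈ O) : 𝔄.An p ≠ 0 := by
  intro h
  have := 𝔄.gram_n_n p hp
  simp [h] at this

lemma tangency_eq (hp : p ∈ O) : U.tangency p = ℝ ∙ 𝔄.A0 p :=
  tangency_eq_span (𝔄.A0_mem p hp) (𝔄.A0_ne hp)

lemma isLift_A0 (hp : p ∈ O) : IsLift U.tangency p 𝔄.A0 := by
  filter_upwards [𝔄.eventually_mem hp] with q hq
  exact ⟨𝔄.smoothAt_A0 hq, 𝔄.A0_ne hq, 𝔄.tangency_eq hq⟩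

lemma mem_tangentHyperplane_iff (hp : p ∈ O) {w : Amb n} :
    w ∈ U.tangentHyperplane p ↔ form n (𝔄.A0 p) w = 0 :=
  LightlikeHypersurface.mem_tangentHyperplane_iff (𝔄.A0_mem p hp) (𝔄.A0_ne hp)

/-- A vector orthogonal to all vertices of the frame vanishes. -/
lemma eq_zero_of_orthogonal (hn : 2 ≤ n) (hp : p ∈ O) {w : Amb n} (h0 : form n w (𝔄.A0 p) = 0)
    (hA : ∀ i, form n w (𝔄.A i p) = 0) (h1 : form n w (𝔄.An p) = 0)
    (h2 : form n w (𝔄.Ainf p) = 0) : w = 0 := by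
  let b : Fin (n - 1) ⊕ Fin 3 → Amb n :=
    Sum.elim (fun i => 𝔄.A i p) ![𝔄.A0 p, 𝔄.An p, 𝔄.Ainf p]
  have hb : LinearIndependent ℝ b := by
    rw [Fintype.linearIndependent_iff]
    intro c hc
    simp only [Fintype.sum_sum_type, b, Sum.elim_inl, Sum.elim_inr, Fin.sum_univ_three,
      Matrix.cons_val_zero, Matrix.cons_val_one, Matrix.cons_val] at hc
    have e0 := congrArg (fun x => form n (𝔄.A0 p) x) hc
    have e1 := congrArg (fun x => form n (𝔄.An p) x) hc
    have e2 := congrArg (fun x => form n (𝔄.Ainf p) x) hc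
    have s1 : ∀ i, form n (𝔄.An p) (𝔄.A i p) = 0 := fun i => by
      rw [form_comm]; exact 𝔄.gram_i_n p hp i
    have s2 : ∀ i, form n (𝔄.Ainf p) (𝔄.A i p) = 0 := fun i => by
      rw [form_comm]; exact 𝔄.gram_i_inf p hp i
    have s3 : form n (𝔄.An p) (𝔄.A0 p) = 0 := by rw [form_comm]; exact 𝔄.gram_0_n p hp
    have s4 : form n (𝔄.Ainf p) (𝔄.A0 p) = -1 := by rw [form_comm]; exact 𝔄.gram_0_inf p hp
    have s5 : form n (𝔄.Ainf p) (𝔄.An p) = 0 := by rw [form_comm]; exact 𝔄.gram_n_inf p hp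
    simp only [map_add, map_sum, map_smul, smul_eq_mul, map_zero, 𝔄.gram_0_i p hp,
      𝔄.gram_0_0 p hp, 𝔄.gram_0_n p hp, 𝔄.gram_0_inf p hp, mul_zero, Finset.sum_const_zero,
      zero_add, mul_neg, mul_one, neg_eq_zero, s1, s2, s3, s4, s5, 𝔄.gram_n_n p hp,
      𝔄.gram_n_inf p hp, 𝔄.gram_inf_inf p hp, add_zero] at e0 e1 e2
    rw [e0, e1, e2] at hc
    simp only [zero_smul, add_zero] at hc
    have hi := Fintype.linearIndependent_iff.1 (𝔄.indep p hp) _ hc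
    rintro (i | i)
    · exact hi i
    · fin_cases i
      · exact e2
      · exact e1
      · exact e0
  have hcard : Fintype.card (Fin (n - 1) ⊕ Fin 3) = finrank ℝ (Amb n) := by
    simp; omega
  have hspan := hb.span_eq_top_of_card_eq_finrank' hcard
  refine eq_zero_of_form fun y => ?_
  have hy : y ∈ Submodule.span ℝ (Set.range b) := by rw [hspan]; trivial
  induction hy using Submodule.span_induction with
  | mem x hx =>
    obtain ⟨i, rfl⟩ := hx
    rw [form_comm]
    rcases i with i | i
    · exact hA i
    · fin_cases i
      · exact h0
      · exact h1
      · exact h2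
  | zero => simp
  | add x y _ _ hx hy => simp [hx, hy]
  | smul c x _ hx => simp [hx]

lemma g_apply (i j) : 𝔄.g p i j = form n (𝔄.A i p) (𝔄.A j p) := rfl

lemma g_symm (i j) : 𝔄.g p i j = 𝔄.g p j i := form_comm _ _

lemma g_transpose : (𝔄.g p).transpose = 𝔄.g p := by
  ext i j; exact 𝔄.g_symm j i

lemma det_g_ne_zero (hn : 2 ≤ n) (hp : p ∈ O) : (𝔄.g p).det ≠ 0 := by
  intro h
  obtain ⟨c, hc0, hc⟩ := Matrix.exists_vecMul_eq_zero_iff.2 h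
  apply hc0
  have hw : ∑ i, c i • 𝔄.A i p = 0 := by
    refine 𝔄.eq_zero_of_orthogonal hn hp ?_ ?_ ?_ ?_
    · rw [form_comm]; simp [𝔄.gram_0_i p hp]
    · intro j
      have := congrFun hc j
      simpa [Matrix.vecMul, dotProduct, g] using this
    · simp [𝔄.gram_i_n p hp]
    · simp [𝔄.gram_i_inf p hp]
  exact funext (Fintype.linearIndependent_iff.1 (𝔄.indep p hp) c hw)

lemma isUnit_det_g (hn : 2 ≤ n) (hp : p ∈ O) : IsUnit (𝔄.g p).det :=
  isUnit_iff_ne_zero.2 (𝔄.det_g_ne_zero hn hp)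

lemma ginv_symm (i j) : (𝔄.g p)⁻¹ i j = (𝔄.g p)⁻¹ j i := by
  have : ((𝔄.g p)⁻¹).transpose = (𝔄.g p)⁻¹ := by
    rw [Matrix.transpose_nonsing_inv, g_transpose]
  exact congrFun (congrFun this j) i

lemma ginv_mul_g (hn : 2 ≤ n) (hp : p ∈ O) (i j) :
    ∑ k, (𝔄.g p)⁻¹ i k * 𝔄.g p k j = if i = j then 1 else 0 := by
  have := Matrix.nonsing_inv_mul _ (𝔄.isUnit_det_g hn hp)
  rw [← Matrix.one_apply, ← this, Matrix.mul_apply]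

lemma coord0_add (w w' : Amb n) : 𝔄.coord0 p (w + w') = 𝔄.coord0 p w + 𝔄.coord0 p w' := by
  simp [coord0]; ring

lemma coord0_smul (c : ℝ) (w : Amb n) : 𝔄.coord0 p (c • w) = c * 𝔄.coord0 p w := by
  simp [coord0]

lemma coord_add (i) (w w' : Amb n) : 𝔄.coord p i (w + w') = 𝔄.coord p i w + 𝔄.coord p i w' := by
  simp [coord, mul_add, Finset.sum_add_distrib]

lemma coord_smul (i) (c : ℝ) (w : Amb n) : 𝔄.coord p i (c • w) = c * 𝔄.coord p i w := by
  simp [coord, Finset.mul_sum, mul_left_comm]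

lemma coord0_sum {ι : Type*} (s : Finset ι) (w : ι → Amb n) :
    𝔄.coord0 p (∑ k ∈ s, w k) = ∑ k ∈ s, 𝔄.coord0 p (w k) := by
  simp [coord0]

lemma coord_sum {ι : Type*} (i) (s : Finset ι) (w : ι → Amb n) :
    𝔄.coord p i (∑ k ∈ s, w k) = ∑ k ∈ s, 𝔄.coord p i (w k) := by
  simp only [coord, map_sum, LinearMap.sum_apply, Finset.mul_sum]
  rw [Finset.sum_comm]

lemma coord0_A0 (hp : p ∈ O) : 𝔄.coord0 p (𝔄.A0 p) = 1 := by
  simp [coord0, 𝔄.gram_0_inf p hp]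

lemma coord0_A (hp : p ∈ O) (i) : 𝔄.coord0 p (𝔄.A i p) = 0 := by
  simp [coord0, 𝔄.gram_i_inf p hp]

lemma coord_A0 (hp : p ∈ O) (i) : 𝔄.coord p i (𝔄.A0 p) = 0 := by
  simp [coord, 𝔄.gram_0_i p hp]

lemma coord_A (hn : 2 ≤ n) (hp : p ∈ O) (i k) :
    𝔄.coord p i (𝔄.A k p) = if i = k then 1 else 0 := by
  rw [← 𝔄.ginv_mul_g hn hp i k]
  unfold coord
  refine Finset.sum_congr rfl fun j _ => ?_
  rw [𝔄.g_symm j k, 𝔄.g_apply]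

lemma sum_coord_g (hn : 2 ≤ n) (hp : p ∈ O) (w : Amb n) (j) :
    ∑ i, 𝔄.coord p i w * 𝔄.g p i j = form n w (𝔄.A j p) := by
  simp only [coord, Finset.sum_mul]
  rw [Finset.sum_comm]
  have : ∀ k, ∑ i, (𝔄.g p)⁻¹ i k * form n w (𝔄.A k p) * 𝔄.g p i j =
      (if k = j then 1 else 0) * form n w (𝔄.A k p) := fun k => by
    rw [← 𝔄.ginv_mul_g hn hp k j, Finset.sum_mul]
    refine Finset.sum_congr rfl fun i _ => ?_
    rw [𝔄.ginv_symm i k]; ring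
  simp [this]

/-- The expansion of a vector in the frame. -/
lemma expand (hn : 2 ≤ n) (hp : p ∈ O) (w : Amb n) :
    w = 𝔄.coord0 p w • 𝔄.A0 p + ∑ i, 𝔄.coord p i w • 𝔄.A i p + form n w (𝔄.An p) • 𝔄.An p
      + (-form n w (𝔄.A0 p)) • 𝔄.Ainf p := by
  rw [← sub_eq_zero]
  have s3 : form n (𝔄.An p) (𝔄.A0 p) = 0 := by rw [form_comm]; exact 𝔄.gram_0_n p hp
  have s4 : form n (𝔄.Ainf p) (𝔄.A0 p) = -1 := by rw [form_comm]; exact 𝔄.gram_0_inf p hp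
  have s5 : form n (𝔄.Ainf p) (𝔄.An p) = 0 := by rw [form_comm]; exact 𝔄.gram_n_inf p hp
  have s6 : ∀ i, form n (𝔄.A i p) (𝔄.A0 p) = 0 := fun i => by
    rw [form_comm]; exact 𝔄.gram_0_i p hp i
  have s1 : ∀ i, form n (𝔄.An p) (𝔄.A i p) = 0 := fun i => by
    rw [form_comm]; exact 𝔄.gram_i_n p hp i
  have s2 : ∀ i, form n (𝔄.Ainf p) (𝔄.A i p) = 0 := fun i => by
    rw [form_comm]; exact 𝔄.gram_i_inf p hp i
  refine 𝔄.eq_zero_of_orthogonal hn hp ?_ ?_ ?_ ?_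
  · simp [𝔄.gram_0_0 p hp, s3, s4, s6]
  · intro j
    simp only [map_sub, map_add, map_sum, map_smul, LinearMap.sub_apply, LinearMap.add_apply,
      LinearMap.sum_apply, LinearMap.smul_apply, smul_eq_mul, 𝔄.gram_0_i p hp, s1, s2]
    rw [← 𝔄.sum_coord_g hn hp w j]
    simp [g_apply]
  · simp [𝔄.gram_0_n p hp, 𝔄.gram_i_n p hp, 𝔄.gram_n_n p hp, s5]
  · simp [𝔄.gram_0_inf p hp, 𝔄.gram_i_inf p hp, 𝔄.gram_n_inf p hp, 𝔄.gram_inf_inf p hp, coord0]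

lemma expand_tangent (hn : 2 ≤ n) (hp : p ∈ O) {w : Amb n} (h0 : form n w (𝔄.A0 p) = 0)
    (h1 : form n w (𝔄.An p) = 0) :
    w = 𝔄.coord0 p w • 𝔄.A0 p + ∑ i, 𝔄.coord p i w • 𝔄.A i p := by
  have := 𝔄.expand hn hp w
  rw [h0, h1] at this
  simpa using this

/-- A lift of the point `x` in terms of the generator. -/
lemma exists_lift_eq (hp : p ∈ O) {f : M → Amb n} (hf : IsLift U.pt p f) :
    f p = form n (f p) (𝔄.An p) • 𝔄.An p + 𝔄.coord0 p (f p) • 𝔄.A0 p ∧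
      form n (f p) (𝔄.An p) ≠ 0 := by
  have hmem : f p ∈ Submodule.span ℝ {𝔄.An p, 𝔄.A0 p} :=
    𝔄.pt_le p hp (by rw [hf.eq]; exact Submodule.mem_span_singleton_self _)
  obtain ⟨α, β, h⟩ := Submodule.mem_span_pair.1 hmem
  have s3 : form n (𝔄.An p) (𝔄.A0 p) = 0 := by rw [form_comm]; exact 𝔄.gram_0_n p hp
  have hα : form n (f p) (𝔄.An p) = α := by
    rw [← h]; simp [𝔄.gram_n_n p hp, 𝔄.gram_0_n p hp]
  have hβ : 𝔄.coord0 p (f p) = β := by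
    rw [← h, coord0]; simp [𝔄.gram_n_inf p hp, 𝔄.gram_0_inf p hp]
  rw [hα, hβ]
  refine ⟨h.symm, ?_⟩
  rintro rfl
  have hpos := form_lift_pos hf
  rw [← h] at hpos
  simp [𝔄.gram_0_0 p hp] at hpos

/-- The generator is the line `A₀ ∧ A_n`. -/
lemma generator_eq (hp : p ∈ O) : U.generator p = Submodule.span ℝ {𝔄.An p, 𝔄.A0 p} := by
  obtain ⟨f, hf⟩ := U.pt_lift p
  obtain ⟨h, hα⟩ := 𝔄.exists_lift_eq hp hf
  unfold generator
  refine le_antisymm (sup_le (𝔄.pt_le p hp) ?_) ?_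
  · rw [𝔄.tangency_eq hp]
    exact Submodule.span_mono (by simp)
  · rw [Submodule.span_le]
    have hA0 : 𝔄.A0 p ∈ U.pt p ⊔ U.tangency p := Submodule.mem_sup_right (𝔄.A0_mem p hp)
    have hfm : f p ∈ U.pt p ⊔ U.tangency p := Submodule.mem_sup_left (by
      rw [hf.eq]; exact Submodule.mem_span_singleton_self _)
    have hAn : 𝔄.An p = (form n (f p) (𝔄.An p))⁻¹ • (f p - 𝔄.coord0 p (f p) • 𝔄.A0 p) := by
      rw [eq_inv_smul_iff₀ hα, eq_sub_iff_add_eq, ← h]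
    rintro x (rfl | rfl)
    · rw [hAn]
      exact Submodule.smul_mem _ _ (sub_mem hfm (Submodule.smul_mem _ _ hA0))
    · exact hA0

lemma dA0_A0 (hp : p ∈ O) (v : TangentSpace (𝓡 n) p) :
    form n (mvfderiv (𝓡 n) 𝔄.A0 p v) (𝔄.A0 p) = 0 := by
  have h := (𝔄.smoothAt_A0 hp).diffAt
  have := form_mvfderiv_of_const h h ((𝔄.eventually_mem hp).mono fun q hq => 𝔄.gram_0_0 q hq) v
  rw [form_comm (𝔄.A0 p)] at this
  linarith

/-- `dA₀` has no component along `A_n`: the point `A₀` is polar both to the point `x` and to its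
derivatives, so that the derivative of `(A₀, x) = 0` leaves `(dA₀, x) = 0`. -/
lemma dA0_An (hp : p ∈ O) (v : TangentSpace (𝓡 n) p) :
    form n (mvfderiv (𝓡 n) 𝔄.A0 p v) (𝔄.An p) = 0 := by
  obtain ⟨f, hf⟩ := U.pt_lift p
  have h0 : ∀ᶠ q in 𝓝 p, form n (𝔄.A0 q) (f q) = 0 := by
    filter_upwards [𝔄.eventually_mem hp, hf.eventually] with q hq hfq
    exact (𝔄.mem_tangentHyperplane_iff hq).1 (lift_mem_tangentHyperplane hfq)
  have h1 := form_mvfderiv_of_const (𝔄.smoothAt_A0 hp).diffAt hf.smoothAt.diffAt h0 v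
  rw [(𝔄.mem_tangentHyperplane_iff hp).1 (mvfderiv_lift_mem_tangentHyperplane hf v),
    neg_zero] at h1
  obtain ⟨h, hα⟩ := 𝔄.exists_lift_eq hp hf
  rw [h] at h1
  simp only [map_add, map_smul, smul_eq_mul, 𝔄.dA0_A0 hp v, mul_zero, add_zero] at h1
  exact (mul_eq_zero.1 h1).resolve_left hα

lemma dAn_A0 (hp : p ∈ O) (v : TangentSpace (𝓡 n) p) :
    form n (mvfderiv (𝓡 n) 𝔄.An p v) (𝔄.A0 p) = 0 := by
  have := form_mvfderiv_of_const (𝔄.smoothAt_A0 hp).diffAt (𝔄.smoothAt_An hp).diffAt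
    ((𝔄.eventually_mem hp).mono fun q hq => 𝔄.gram_0_n q hq) v
  rw [𝔄.dA0_An hp v, form_comm (𝔄.A0 p)] at this
  linarith

lemma dAn_An (hp : p ∈ O) (v : TangentSpace (𝓡 n) p) :
    form n (mvfderiv (𝓡 n) 𝔄.An p v) (𝔄.An p) = 0 := by
  have h := (𝔄.smoothAt_An hp).diffAt
  have := form_mvfderiv_of_const h h ((𝔄.eventually_mem hp).mono fun q hq => 𝔄.gram_n_n q hq) v
  rw [form_comm (𝔄.An p)] at this
  linarith

/-- `dA₀ = ω_0^0 A₀ + ω_0^i A_i`. -/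
lemma dA0_eq (hn : 2 ≤ n) (hp : p ∈ O) (v : TangentSpace (𝓡 n) p) :
    mvfderiv (𝓡 n) 𝔄.A0 p v = 𝔄.w00 p v • 𝔄.A0 p + ∑ i, 𝔄.w0i p i v • 𝔄.A i p :=
  𝔄.expand_tangent hn hp (𝔄.dA0_A0 hp v) (𝔄.dA0_An hp v)

/-- `dA_n = ω_n^0 A₀ + ω_n^i A_i`. -/
lemma dAn_eq (hn : 2 ≤ n) (hp : p ∈ O) (v : TangentSpace (𝓡 n) p) :
    mvfderiv (𝓡 n) 𝔄.An p v = 𝔄.wn0 p v • 𝔄.A0 p + ∑ i, 𝔄.wni p i v • 𝔄.A i p :=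
  𝔄.expand_tangent hn hp (𝔄.dAn_A0 hp v) (𝔄.dAn_An hp v)

/-- `ω_i^n = -(dA_n, A_i)`. -/
lemma win_eq (hp : p ∈ O) (i) (v : TangentSpace (𝓡 n) p) :
    𝔄.win p i v = - form n (mvfderiv (𝓡 n) 𝔄.An p v) (𝔄.A i p) := by
  have := form_mvfderiv_of_const (𝔄.smoothAt_A hp i).diffAt (𝔄.smoothAt_An hp).diffAt
    ((𝔄.eventually_mem hp).mono fun q hq => 𝔄.gram_i_n q hq i) v
  rw [form_comm (𝔄.A i p)] at this
  exact this

/-- The component of `dA_i` along `A_{n+1}` is `-(dA_i, A₀) = (dA₀, A_i) = g_{ik} ω_0^k`. -/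
lemma dA_A0 (hp : p ∈ O) (i) (v : TangentSpace (𝓡 n) p) :
    form n (mvfderiv (𝓡 n) (𝔄.A i) p v) (𝔄.A0 p) =
      - form n (mvfderiv (𝓡 n) 𝔄.A0 p v) (𝔄.A i p) := by
  have := form_mvfderiv_of_const (𝔄.smoothAt_A0 hp).diffAt (𝔄.smoothAt_A hp i).diffAt
    ((𝔄.eventually_mem hp).mono fun q hq => 𝔄.gram_0_i q hq i) v
  rw [form_comm (𝔄.A0 p)] at this
  linarith

lemma span_tangent_finrank_le (hn : 2 ≤ n) :
    finrank ℝ ((ℝ ∙ 𝔄.A0 p) ⊔ Submodule.span ℝ (Set.range fun i => 𝔄.A i p) :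
      Submodule ℝ (Amb n)) ≤ n := by
  have h1 := Submodule.finrank_add_le_finrank_add_finrank (ℝ ∙ 𝔄.A0 p)
    (Submodule.span ℝ (Set.range fun i => 𝔄.A i p))
  have h2 : finrank ℝ (ℝ ∙ 𝔄.A0 p) ≤ 1 := by
    have := finrank_span_le_card (R := ℝ) ({𝔄.A0 p} : Set (Amb n))
    simpa using this
  have h3 : finrank ℝ (Submodule.span ℝ (Set.range fun i => 𝔄.A i p)) ≤ n - 1 := by
    have := finrank_range_le_card (R := ℝ) (fun i => 𝔄.A i p)
    simpa [Set.finrank] using this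
  omega

/-- When `V` has maximal dimension, its tangent subspace is `A₀ ∧ A₁ ∧ … ∧ A_{n-1}`. -/
lemma tangentV_eq (hn : 2 ≤ n) (hp : p ∈ O) (hV : finrank ℝ (U.tangentV p) = n) :
    U.tangentV p = (ℝ ∙ 𝔄.A0 p) ⊔ Submodule.span ℝ (Set.range fun i => 𝔄.A i p) := by
  apply Submodule.eq_of_le_of_finrank_le
  · unfold tangentV
    rw [(𝔄.isLift_A0 hp).projTangent_eq]
    refine sup_le le_sup_left ?_
    rintro _ ⟨v, rfl⟩
    change mvfderiv (𝓡 n) 𝔄.A0 p v ∈ _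
    rw [𝔄.dA0_eq hn hp v]
    exact add_mem (Submodule.mem_sup_left (Submodule.smul_mem _ _
      (Submodule.mem_span_singleton_self _)))
      (Submodule.mem_sup_right (sum_mem fun i _ => Submodule.smul_mem _ _
        (Submodule.subset_span ⟨i, rfl⟩)))
  · rw [hV]; exact 𝔄.span_tangent_finrank_le hn

/-- When `V` has maximal dimension, the forms `ω_0^i` are independent. -/
lemma exists_w0i_eq (hn : 2 ≤ n) (hp : p ∈ O) (hV : finrank ℝ (U.tangentV p) = n)
    (c : Fin (n - 1) → ℝ) : ∃ v, ∀ i, 𝔄.w0i p i v = c i := by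
  have hmem : ∑ i, c i • 𝔄.A i p ∈ U.tangentV p := by
    rw [𝔄.tangentV_eq hn hp hV]
    exact Submodule.mem_sup_right (sum_mem fun i _ => Submodule.smul_mem _ _
        (Submodule.subset_span ⟨i, rfl⟩))
  unfold tangentV at hmem
  rw [(𝔄.isLift_A0 hp).projTangent_eq] at hmem
  obtain ⟨y, hy, z, ⟨v, rfl⟩, h⟩ := Submodule.mem_sup.1 hmem
  obtain ⟨s, rfl⟩ := Submodule.mem_span_singleton.1 hy
  refine ⟨v, fun i => ?_⟩
  have := congrArg (𝔄.coord p i) h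
  rw [coord_add, coord_smul, 𝔄.coord_A0 hp, coord_sum] at this
  simp only [coord_smul, 𝔄.coord_A hn hp] at this
  simpa [w0i] using this

end Frame
end LightlikeHypersurface
end DeSitter

end


/-! ### Integrability conditions: the expansions of `ω_i^n` and of `∇λ_{ij}` -/

noncomputable section
namespace DeSitter
namespace LightlikeHypersurface

variable {n : ℕ} {M : Type*} [TopologicalSpace M] [ChartedSpace (EuclideanSpace ℝ (Fin n)) M]
  {U : LightlikeHypersurface n M}

namespace Frame

variable {O : Set M} (𝔄 : U.Frame O) {p : M}

/-- The coordinate on `A_i` as a linear form. -/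
def coordL (p : M) (i : Fin (n - 1)) : Amb n →ₗ[ℝ] ℝ where
  toFun := 𝔄.coord p i
  map_add' := 𝔄.coord_add i
  map_smul' c w := 𝔄.coord_smul i c w

lemma w0i_eq (i) (v : TangentSpace (𝓡 n) p) :
    𝔄.w0i p i v = (𝔄.coordL p i ∘ₗ (mvfderiv (𝓡 n) 𝔄.A0 p).toLinearMap) v := rfl

lemma form_dA0_A (hn : 2 ≤ n) (hp : p ∈ O) (k) (v : TangentSpace (𝓡 n) p) :
    form n (mvfderiv (𝓡 n) 𝔄.A0 p v) (𝔄.A k p) = ∑ i, 𝔄.w0i p i v * 𝔄.g p i k :=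
  (𝔄.sum_coord_g hn hp _ k).symm

lemma form_dA_A (hn : 2 ≤ n) (hp : p ∈ O) (i k) (v : TangentSpace (𝓡 n) p) :
    form n (mvfderiv (𝓡 n) (𝔄.A i) p v) (𝔄.A k p) = ∑ l, 𝔄.wij p i l v * 𝔄.g p l k :=
  (𝔄.sum_coord_g hn hp _ k).symm

/-- `(dA₀(u), dA_n(v)) = -ω_0^i(u) ω_i^n(v)`. -/
lemma form_dA0_dAn (hn : 2 ≤ n) (hp : p ∈ O) (u v : TangentSpace (𝓡 n) p) :
    form n (mvfderiv (𝓡 n) 𝔄.A0 p u) (mvfderiv (𝓡 n) 𝔄.An p v) =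
      - ∑ i, 𝔄.w0i p i u * 𝔄.win p i v := by
  rw [𝔄.dA0_eq hn hp u]
  have h0 : form n (𝔄.A0 p) (mvfderiv (𝓡 n) 𝔄.An p v) = 0 := by
    rw [form_comm]; exact 𝔄.dAn_A0 hp v
  simp only [map_add, map_smul, LinearMap.add_apply, LinearMap.smul_apply, h0, smul_eq_mul,
    mul_zero, zero_add, map_sum, LinearMap.sum_apply, 𝔄.win_eq hp, mul_neg,
    Finset.sum_neg_distrib, neg_neg]
  refine Finset.sum_congr rfl fun i _ => ?_
  rw [form_comm (𝔄.A i p)]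

lemma smoothAt_g (hp : p ∈ O) (i j) : SmoothAt n (fun q => 𝔄.g q i j) p :=
  (𝔄.smoothAt_A hp i).form (𝔄.smoothAt_A hp j)

lemma smoothAt_ginv (hn : 2 ≤ n) (hp : p ∈ O) (i j) :
    SmoothAt n (fun q => (𝔄.g q)⁻¹ i j) p :=
  SmoothAt.inv_entry (fun i j => 𝔄.smoothAt_g hp i j) (𝔄.det_g_ne_zero hn hp) i j

lemma smoothAt_coord (hn : 2 ≤ n) (hp : p ∈ O) {w : M → Amb n} (hw : SmoothAt n w p) (i) :
    SmoothAt n (fun q => 𝔄.coord q i (w q)) p :=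
  SmoothAt.sum fun j _ => (𝔄.smoothAt_ginv hn hp i j).mul (hw.form (𝔄.smoothAt_A hp j))

lemma smoothAt_coord0 (hp : p ∈ O) {w : M → Amb n} (hw : SmoothAt n w p) :
    SmoothAt n (fun q => 𝔄.coord0 q (w q)) p :=
  (hw.form (𝔄.smoothAt_Ainf hp)).neg

/-- Vectors dual to the forms `ω_0^i`. -/
lemma exists_dual (hn : 2 ≤ n) (hp : p ∈ O) (hV : finrank ℝ (U.tangentV p) = n) :
    ∃ e : Fin (n - 1) → TangentSpace (𝓡 n) p, ∀ i j, 𝔄.w0i p i (e j) = if i = j then 1 else 0 :=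
  ⟨fun j => (𝔄.exists_w0i_eq hn hp hV fun i => if i = j then 1 else 0).choose,
    fun i j => (𝔄.exists_w0i_eq hn hp hV fun i => if i = j then 1 else 0).choose_spec i⟩

/-- The coefficients chosen in `coeffs` do expand the form `α`, as soon as an expansion exists. -/
lemma coeffs_spec {α : TangentSpace (𝓡 n) p → ℝ}
    (h : ∃ c : Fin (n - 1) → ℝ, ∀ v, α v = ∑ j, c j * 𝔄.w0i p j v) (v) :
    α v = ∑ j, 𝔄.coeffs p α j * 𝔄.w0i p j v := by
  unfold coeffs
  rw [dif_pos h]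
  exact h.choose_spec v

variable [IsManifold (𝓡 n) ∞ M]

lemma smoothAt_w0i (hn : 2 ≤ n) (hp : p ∈ O) (i) (u : TangentSpace (𝓡 n) p) :
    SmoothAt n (fun q => 𝔄.w0i q i (tangentField p u q)) p :=
  𝔄.smoothAt_coord hn hp ((𝔄.smoothAt_A0 hp).tangentDeriv u) i

/-- The coefficients of a smooth 1-form with respect to the forms `ω_0^j` are smooth. -/
lemma smoothAt_coeffs (hn : 2 ≤ n) (hp : p ∈ O) (hV : finrank ℝ (U.tangentV p) = n)
    {α : (q : M) → TangentSpace (𝓡 n) q → ℝ}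
    (hα : ∀ u, SmoothAt n (fun q => α q (tangentField p u q)) p)
    (h : ∀ᶠ q in 𝓝 p, ∃ c : Fin (n - 1) → ℝ, ∀ v, α q v = ∑ j, c j * 𝔄.w0i q j v) (j) :
    SmoothAt n (fun q => 𝔄.coeffs q (α q) j) p := by
  let B : Basis (Fin n) ℝ (TangentSpace (𝓡 n) p) := tangentBasis p
  refine smoothAt_of_sum_smul (z := fun j q => 𝔄.coeffs q (α q) j)
    (m := fun j q b => 𝔄.w0i q j (tangentField p (B b) q))
    (w := fun q b => α q (tangentField p (B b) q)) (fun j => SmoothAt.pi fun b =>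
      𝔄.smoothAt_w0i hn hp j (B b)) ?_ (SmoothAt.pi fun b => hα (B b)) ?_ j
  · rw [Fintype.linearIndependent_iff]
    intro c hc k
    obtain ⟨e, he⟩ := 𝔄.exists_dual hn hp hV
    have hk : ∑ b, (B.repr (e k) b) • tangentField p (B b) p = e k := by
      simp only [tangentField_self]
      exact B.sum_repr (e k)
    have h1 : ∑ j, c j * 𝔄.w0i p j (e k) = 0 := by
      have : ∀ j, 𝔄.w0i p j (e k) = ∑ b, B.repr (e k) b * 𝔄.w0i p j (tangentField p (B b) p) := by
        intro j
        conv_lhs => rw [← hk, w0i_eq, map_sum]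
        simp only [map_smul, smul_eq_mul]
        rfl
      simp only [this, Finset.mul_sum]
      rw [Finset.sum_comm]
      refine Finset.sum_eq_zero fun b _ => ?_
      have h2 := congrFun hc b
      simp only [Finset.sum_apply, Pi.smul_apply, smul_eq_mul, Pi.zero_apply] at h2
      simp only [mul_left_comm _ (B.repr (e k) b)]
      rw [← Finset.mul_sum, h2, mul_zero]
    simpa [he] using h1
  · filter_upwards [h] with q hq
    ext b
    simp only [Finset.sum_apply, Pi.smul_apply, smul_eq_mul]
    exact (𝔄.coeffs_spec hq _).symm

/-- The integrability condition `ω_0^i ∧ ω_i^n = 0`, in a symmetric form. -/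
lemma form_dA0_dAn_symm (hp : p ∈ O) (u v : TangentSpace (𝓡 n) p) :
    form n (mvfderiv (𝓡 n) 𝔄.A0 p u) (mvfderiv (𝓡 n) 𝔄.An p v) =
      form n (mvfderiv (𝓡 n) 𝔄.A0 p v) (mvfderiv (𝓡 n) 𝔄.An p u) := by
  have key : ∀ u v : TangentSpace (𝓡 n) p,
      form n (mvfderiv (𝓡 n) 𝔄.A0 p u) (mvfderiv (𝓡 n) 𝔄.An p v) =
      - form n (mvfderiv (𝓡 n) (fun q => mvfderiv (𝓡 n) 𝔄.A0 q (tangentField p u q)) p v)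
        (𝔄.An p) := by
    intro u v
    have h1 := form_mvfderiv_of_const ((𝔄.smoothAt_A0 hp).tangentDeriv u).diffAt
      (𝔄.smoothAt_An hp).diffAt ((𝔄.eventually_mem hp).mono fun q hq => 𝔄.dA0_An hq _) v
    rw [h1, tangentField_self, neg_neg]
  rw [key u v, (𝔄.smoothAt_A0 hp).tangentDeriv_comm, ← key v u]

lemma sum_w0i_win_symm (hn : 2 ≤ n) (hp : p ∈ O) (u v : TangentSpace (𝓡 n) p) :
    ∑ i, 𝔄.w0i p i u * 𝔄.win p i v = ∑ i, 𝔄.w0i p i v * 𝔄.win p i u := by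
  have := 𝔄.form_dA0_dAn_symm hp u v
  rw [𝔄.form_dA0_dAn hn hp, 𝔄.form_dA0_dAn hn hp] at this
  linarith

/-- By the lemma of Cartan, `ω_0^i ∧ ω_i^n = 0` and the independence of the `ω_0^i` give the
expansion of `ω_i^n`. -/
lemma exists_win (hn : 2 ≤ n) (hp : p ∈ O) (hV : finrank ℝ (U.tangentV p) = n) (i) :
    ∃ c : Fin (n - 1) → ℝ, ∀ v, 𝔄.win p i v = ∑ j, c j * 𝔄.w0i p j v := by
  obtain ⟨e, he⟩ := 𝔄.exists_dual hn hp hV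
  refine ⟨fun j => 𝔄.win p j (e i), fun v => ?_⟩
  have := 𝔄.sum_w0i_win_symm hn hp (e i) v
  simp only [he, ite_mul, one_mul, zero_mul, Finset.sum_ite_eq', Finset.mem_univ, if_true] at this
  rw [this]
  exact Finset.sum_congr rfl fun j _ => mul_comm _ _

lemma win_spec (hn : 2 ≤ n) (hp : p ∈ O) (hV : finrank ℝ (U.tangentV p) = n) (i)
    (v : TangentSpace (𝓡 n) p) : 𝔄.win p i v = ∑ j, 𝔄.lam p i j * 𝔄.w0i p j v :=
  𝔄.coeffs_spec (𝔄.exists_win hn hp hV i) v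

lemma lam_symm (hn : 2 ≤ n) (hp : p ∈ O) (hV : finrank ℝ (U.tangentV p) = n) (i j) :
    𝔄.lam p i j = 𝔄.lam p j i := by
  obtain ⟨e, he⟩ := 𝔄.exists_dual hn hp hV
  have h := 𝔄.sum_w0i_win_symm hn hp (e i) (e j)
  simpa [he, 𝔄.win_spec hn hp hV] using h

lemma smoothAt_win (hp : p ∈ O) (i) (u : TangentSpace (𝓡 n) p) :
    SmoothAt n (fun q => 𝔄.win q i (tangentField p u q)) p :=
  ((𝔄.smoothAt_A hp i).tangentDeriv u).form (𝔄.smoothAt_An hp)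

lemma smoothAt_lam (hn : 2 ≤ n) (hV : ∀ q ∈ O, finrank ℝ (U.tangentV q) = n) (hp : p ∈ O) (i j) :
    SmoothAt n (fun q => 𝔄.lam q i j) p :=
  𝔄.smoothAt_coeffs hn hp (hV p hp) (α := fun q => 𝔄.win q i) (𝔄.smoothAt_win hp i)
    ((𝔄.eventually_mem hp).mono fun q hq => 𝔄.exists_win hn hq (hV q hq) i) j

lemma smoothAt_lamMean (hn : 2 ≤ n) (hV : ∀ q ∈ O, finrank ℝ (U.tangentV q) = n) (hp : p ∈ O) :
    SmoothAt n (fun q => 𝔄.lamMean q) p :=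
  contMDiffAt_const.mul (SmoothAt.sum fun i _ => SmoothAt.sum fun j _ =>
    (𝔄.smoothAt_lam hn hV hp i j).mul (𝔄.smoothAt_ginv hn hp i j))

lemma smoothAt_C (hn : 2 ≤ n) (hV : ∀ q ∈ O, finrank ℝ (U.tangentV q) = n) (hp : p ∈ O) :
    SmoothAt n 𝔄.C p :=
  (𝔄.smoothAt_An hp).add ((𝔄.smoothAt_lamMean hn hV hp).smul (𝔄.smoothAt_A0 hp))

/-- The structure equation `dω_0^j = …`, evaluated on two coordinate fields. -/
lemma d_w0i (hn : 2 ≤ n) (hp : p ∈ O) (j) (u v : TangentSpace (𝓡 n) p) :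
    mvfderiv (𝓡 n) (fun q => 𝔄.w0i q j (tangentField p u q)) p v
      + 𝔄.w00 p u * 𝔄.w0i p j v + ∑ k, 𝔄.w0i p k u * 𝔄.wij p k j v =
    mvfderiv (𝓡 n) (fun q => 𝔄.w0i q j (tangentField p v q)) p u
      + 𝔄.w00 p v * 𝔄.w0i p j u + ∑ k, 𝔄.w0i p k v * 𝔄.wij p k j u := by
  have key : ∀ u v : TangentSpace (𝓡 n) p,
      𝔄.coord p j (mvfderiv (𝓡 n) (fun q => mvfderiv (𝓡 n) 𝔄.A0 q (tangentField p u q)) p v) =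
      mvfderiv (𝓡 n) (fun q => 𝔄.w0i q j (tangentField p u q)) p v
      + 𝔄.w00 p u * 𝔄.w0i p j v + ∑ k, 𝔄.w0i p k u * 𝔄.wij p k j v := by
    intro u v
    have hD := (𝔄.smoothAt_A0 hp).tangentDeriv u
    have hev : (fun q => mvfderiv (𝓡 n) 𝔄.A0 q (tangentField p u q)) =ᶠ[𝓝 p]
        fun q => 𝔄.w00 q (tangentField p u q) • 𝔄.A0 q +
          ∑ i, 𝔄.w0i q i (tangentField p u q) • 𝔄.A i q :=
      (𝔄.eventually_mem hp).mono fun q hq => 𝔄.dA0_eq hn hq _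
    have h00 : DiffAt n (fun q => 𝔄.w00 q (tangentField p u q)) p :=
      (𝔄.smoothAt_coord0 hp hD).diffAt
    have h0i : ∀ i, DiffAt n (fun q => 𝔄.w0i q i (tangentField p u q)) p := fun i =>
      (𝔄.smoothAt_w0i hn hp i u).diffAt
    have hA0 := (𝔄.smoothAt_A0 hp).diffAt
    have hA := fun i => (𝔄.smoothAt_A hp i).diffAt
    rw [mvfderiv_congr hev, mvfderiv_fun_add (DiffAt.smul h00 hA0)
      (DiffAt.sum fun i _ => DiffAt.smul (h0i i) (hA i))]
    change 𝔄.coord p j (mvfderiv (𝓡 n) _ p v + mvfderiv (𝓡 n) _ p v) = _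
    rw [mvfderiv_smul_apply h00 hA0, mvfderiv_finsum fun i _ => DiffAt.smul (h0i i) (hA i)]
    simp only [mvfderiv_smul_apply (h0i _) (hA _)]
    simp only [coord_add, coord_sum, coord_smul, 𝔄.coord_A0 hp, 𝔄.coord_A hn hp,
      tangentField_self, Finset.sum_add_distrib]
    simp only [mul_ite, mul_one, mul_zero, Finset.sum_ite_eq, Finset.mem_univ, if_true, zero_add]
    change 𝔄.w00 p u * 𝔄.w0i p j v + (_ + ∑ k, 𝔄.w0i p k u * 𝔄.wij p k j v) = _
    ring
  rw [← key u v, ← key v u, (𝔄.smoothAt_A0 hp).tangentDeriv_comm]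

/-- The scalar product `(dA_i, dA_n)`, which is the contribution of the vertices other than `A_n` to
the structure equation of `ω_i^n`. -/
lemma form_dA_dAn (hn : 2 ≤ n) (hp : p ∈ O) (hV : finrank ℝ (U.tangentV p) = n) (i)
    (u v : TangentSpace (𝓡 n) p) :
    form n (mvfderiv (𝓡 n) (𝔄.A i) p u) (mvfderiv (𝓡 n) 𝔄.An p v) =
      - (𝔄.wn0 p v * ∑ k, 𝔄.g p i k * 𝔄.w0i p k u)
        - ∑ k, ∑ l, 𝔄.wij p i k u * (𝔄.lam p k l * 𝔄.w0i p l v) := by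
  conv_lhs => rw [𝔄.dAn_eq hn hp v]
  simp only [map_add, map_smul, map_sum, smul_eq_mul, 𝔄.dA_A0 hp, 𝔄.form_dA0_A hn hp]
  have h1 : ∑ x, 𝔄.wni p x v * form n (mvfderiv (𝓡 n) (𝔄.A i) p u) (𝔄.A x p) =
      - ∑ k, ∑ l, 𝔄.wij p i k u * (𝔄.lam p k l * 𝔄.w0i p l v) := by
    simp only [𝔄.form_dA_A hn hp, Finset.mul_sum]
    rw [Finset.sum_comm, ← Finset.sum_neg_distrib]
    refine Finset.sum_congr rfl fun k _ => ?_
    rw [← Finset.mul_sum, ← 𝔄.win_spec hn hp hV, 𝔄.win_eq hp, ← 𝔄.sum_coord_g hn hp,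
      mul_neg, neg_neg, Finset.mul_sum]
    refine Finset.sum_congr rfl fun x _ => ?_
    rw [𝔄.g_symm k x]
    change 𝔄.wni p x v * _ = _ * (𝔄.wni p x v * _)
    ring
  rw [h1]
  have h2 : ∑ k, 𝔄.w0i p k u * 𝔄.g p k i = ∑ k, 𝔄.g p i k * 𝔄.w0i p k u :=
    Finset.sum_congr rfl fun k _ => by rw [𝔄.g_symm k i, mul_comm]
  rw [h2]; ring

/-- The integrability condition `(∇λ_{ij} + λ_{ij} ω_0^0 + g_{ij} ω_n^0) ∧ ω_0^j = 0`. -/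
lemma dlam_symm (hn : 2 ≤ n) (hV : ∀ q ∈ O, finrank ℝ (U.tangentV q) = n) (hp : p ∈ O) (i)
    (u v : TangentSpace (𝓡 n) p) :
    ∑ j, 𝔄.dlam p i j v * 𝔄.w0i p j u = ∑ j, 𝔄.dlam p i j u * 𝔄.w0i p j v := by
  have key : ∀ u v : TangentSpace (𝓡 n) p,
      form n (mvfderiv (𝓡 n) (fun q => mvfderiv (𝓡 n) (𝔄.A i) q (tangentField p u q)) p v)
        (𝔄.An p) + form n (mvfderiv (𝓡 n) (𝔄.A i) p u) (mvfderiv (𝓡 n) 𝔄.An p v) =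
      ∑ j, (mvfderiv (𝓡 n) (fun q => 𝔄.lam q i j) p v * 𝔄.w0i p j u + 𝔄.lam p i j *
        mvfderiv (𝓡 n) (fun q => 𝔄.w0i q j (tangentField p u q)) p v) := by
    intro u v
    have hD := (𝔄.smoothAt_A hp i).tangentDeriv u
    have h1 := mvfderiv_form hD.diffAt (𝔄.smoothAt_An hp).diffAt v
    rw [tangentField_self] at h1
    rw [← h1]
    have hev : (fun q => form n (mvfderiv (𝓡 n) (𝔄.A i) q (tangentField p u q)) (𝔄.An q))
        =ᶠ[𝓝 p] fun q => ∑ j, 𝔄.lam q i j • 𝔄.w0i q j (tangentField p u q) :=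
      (𝔄.eventually_mem hp).mono fun q hq => 𝔄.win_spec hn hq (hV q hq) i _
    have hl := fun j => (𝔄.smoothAt_lam hn hV hp i j).diffAt
    have hw := fun j => (𝔄.smoothAt_w0i hn hp j u).diffAt
    rw [mvfderiv_congr hev, mvfderiv_finsum fun j _ => DiffAt.smul (hl j) (hw j)]
    refine Finset.sum_congr rfl fun j _ => ?_
    rw [mvfderiv_smul_apply (hl j) (hw j), tangentField_self, smul_eq_mul, smul_eq_mul]
  -- the mixed second derivatives of `A_i` in the two equalities are the same
  have h1 := key u v
  have h2 := key v u
  rw [(𝔄.smoothAt_A hp i).tangentDeriv_comm v u] at h2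
  have h3 := 𝔄.form_dA_dAn hn hp (hV p hp) i u v
  have h4 := 𝔄.form_dA_dAn hn hp (hV p hp) i v u
  -- the structure equation of `ω_0^j`, contracted with `λ_{ij}`
  have h5 : ∑ j, 𝔄.lam p i j * mvfderiv (𝓡 n) (fun q => 𝔄.w0i q j (tangentField p u q)) p v
      + 𝔄.w00 p u * ∑ j, 𝔄.lam p i j * 𝔄.w0i p j v
      + ∑ j, ∑ k, 𝔄.lam p i j * (𝔄.w0i p k u * 𝔄.wij p k j v) =
      ∑ j, 𝔄.lam p i j * mvfderiv (𝓡 n) (fun q => 𝔄.w0i q j (tangentField p v q)) p u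
      + 𝔄.w00 p v * ∑ j, 𝔄.lam p i j * 𝔄.w0i p j u
      + ∑ j, ∑ k, 𝔄.lam p i j * (𝔄.w0i p k v * 𝔄.wij p k j u) := by
    simp only [Finset.mul_sum, ← Finset.sum_add_distrib]
    refine Finset.sum_congr rfl fun j _ => ?_
    have := 𝔄.d_w0i hn hp j u v
    simp only [← Finset.mul_sum]
    linear_combination 𝔄.lam p i j * this
  have h6 : ∀ u v : TangentSpace (𝓡 n) p, ∑ j, 𝔄.dlam p i j v * 𝔄.w0i p j u =
      ∑ j, mvfderiv (𝓡 n) (fun q => 𝔄.lam q i j) p v * 𝔄.w0i p j u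
      - ∑ j, ∑ k, 𝔄.lam p i j * (𝔄.w0i p k u * 𝔄.wij p k j v)
      - ∑ k, ∑ l, 𝔄.wij p i k v * (𝔄.lam p k l * 𝔄.w0i p l u)
      + 𝔄.w00 p v * ∑ j, 𝔄.lam p i j * 𝔄.w0i p j u
      + 𝔄.wn0 p v * ∑ k, 𝔄.g p i k * 𝔄.w0i p k u := by
    intro u v
    rw [Finset.sum_comm (f := fun j k => 𝔄.lam p i j * (𝔄.w0i p k u * 𝔄.wij p k j v)),
      Finset.sum_comm (f := fun k l => 𝔄.wij p i k v * (𝔄.lam p k l * 𝔄.w0i p l u))]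
    simp only [Finset.mul_sum, ← Finset.sum_add_distrib, ← Finset.sum_sub_distrib]
    refine Finset.sum_congr rfl fun j _ => ?_
    unfold dlam
    have e1 : ∑ k, 𝔄.lam p i k * (𝔄.w0i p j u * 𝔄.wij p j k v) =
        (∑ k, 𝔄.lam p i k * 𝔄.wij p j k v) * 𝔄.w0i p j u := by
      rw [Finset.sum_mul]; exact Finset.sum_congr rfl fun k _ => by ring
    have e2 : ∑ k, 𝔄.wij p i k v * (𝔄.lam p k j * 𝔄.w0i p j u) =
        (∑ k, 𝔄.lam p k j * 𝔄.wij p i k v) * 𝔄.w0i p j u := by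
      rw [Finset.sum_mul]; exact Finset.sum_congr rfl fun k _ => by ring
    rw [e1, e2]
    ring
  rw [Finset.sum_add_distrib] at h1 h2
  rw [h6 u v, h6 v u]
  linarith

lemma exists_dlam (hn : 2 ≤ n) (hV : ∀ q ∈ O, finrank ℝ (U.tangentV q) = n) (hp : p ∈ O) (i j) :
    ∃ c : Fin (n - 1) → ℝ, ∀ v, 𝔄.dlam p i j v = ∑ k, c k * 𝔄.w0i p k v := by
  obtain ⟨e, he⟩ := 𝔄.exists_dual hn hp (hV p hp)
  refine ⟨fun k => 𝔄.dlam p i k (e j), fun v => ?_⟩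
  rw [← 𝔄.dlam_symm hn hV hp]
  simp [he]

lemma expansions (hn : 2 ≤ n) (hV : ∀ q ∈ O, finrank ℝ (U.tangentV q) = n) (hp : p ∈ O) :
    𝔄.Expansions p :=
  ⟨𝔄.win_spec hn hp (hV p hp), 𝔄.lam_symm hn hp (hV p hp),
    fun i j => 𝔄.coeffs_spec (𝔄.exists_dlam hn hV hp i j)⟩

end Frame
end LightlikeHypersurface
end DeSitter

end


/-! ### The point `C`, the subspace `ζ` and their independence of the frame -/

noncomputable section
namespace DeSitter
namespace LightlikeHypersurface

variable {n : ℕ} {M : Type*} [TopologicalSpace M] [ChartedSpace (EuclideanSpace ℝ (Fin n)) M]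
  {U : LightlikeHypersurface n M}

section Matrices

variable {ι : Type*} [Fintype ι] [DecidableEq ι]

/-- The contribution of `g^{ij}` to the differential of a trace `g^{ij} λ_{ij}`, where
`dg = Ω g + g Ωᵀ`: the rotation terms are those that cancel the terms with `Ω` in `∇λ_{ij}`. -/
lemma trace_mul_deriv_inv {G Gi L Ω dGi : Matrix ι ι ℝ} (h1 : Gi * G = 1) (h2 : G * Gi = 1)
    (hd : dGi * G + Gi * (Ω * G + G * Ω.transpose) = 0) :
    (L * dGi).trace = - (Gi * (L * Ω.transpose + Ω * L)).trace := by
  have h3 : dGi = - (Gi * Ω) - Ω.transpose * Gi := by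
    have : dGi * (G * Gi) + Gi * Ω * (G * Gi) + (Gi * G) * Ω.transpose * Gi = 0 := by
      calc _ = (dGi * G + Gi * (Ω * G + G * Ω.transpose)) * Gi := by noncomm_ring
        _ = 0 := by rw [hd, zero_mul]
    rw [h1, h2, mul_one, mul_one, one_mul] at this
    rw [eq_sub_iff_add_eq, eq_neg_iff_add_eq_zero, ← this]
    abel
  rw [h3, mul_add, Matrix.trace_add, Matrix.mul_sub, Matrix.mul_neg, Matrix.trace_sub,
    Matrix.trace_neg, ← Matrix.mul_assoc L Ω.transpose Gi,
    Matrix.trace_mul_comm (L * Ω.transpose) Gi, ← Matrix.mul_assoc L Gi Ω,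
    Matrix.mul_assoc, Matrix.trace_mul_comm L (Gi * Ω), Matrix.mul_assoc]
  ring

lemma sum_mul_eq_trace {A B : Matrix ι ι ℝ} (hA : ∀ i j, A i j = A j i) :
    ∑ i, ∑ j, A i j * B i j = (A * B).trace := by
  simp only [Matrix.trace, Matrix.diag, Matrix.mul_apply]
  rw [Finset.sum_comm]
  refine Finset.sum_congr rfl fun i _ => Finset.sum_congr rfl fun j _ => ?_
  rw [hA]

end Matrices

namespace Frame

variable {O : Set M} (𝔄 : U.Frame O) {p : M}

/-- The same frame over a smaller open set. -/
def restrict {O' : Set M} (hO' : IsOpen O') (h : O' ⊆ O) : U.Frame O' where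
  A0 := 𝔄.A0
  A := 𝔄.A
  An := 𝔄.An
  Ainf := 𝔄.Ainf
  isOpen := hO'
  smooth_A0 := 𝔄.smooth_A0.mono h
  smooth_A i := (𝔄.smooth_A i).mono h
  smooth_An := 𝔄.smooth_An.mono h
  smooth_Ainf := 𝔄.smooth_Ainf.mono h
  gram_0_0 p hp := 𝔄.gram_0_0 p (h hp)
  gram_0_i p hp := 𝔄.gram_0_i p (h hp)
  gram_0_n p hp := 𝔄.gram_0_n p (h hp)
  gram_0_inf p hp := 𝔄.gram_0_inf p (h hp)
  gram_i_n p hp := 𝔄.gram_i_n p (h hp)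
  gram_i_inf p hp := 𝔄.gram_i_inf p (h hp)
  gram_n_n p hp := 𝔄.gram_n_n p (h hp)
  gram_n_inf p hp := 𝔄.gram_n_inf p (h hp)
  gram_inf_inf p hp := 𝔄.gram_inf_inf p (h hp)
  indep p hp := 𝔄.indep p (h hp)
  A0_mem p hp := 𝔄.A0_mem p (h hp)
  pt_le p hp := 𝔄.pt_le p (h hp)

lemma card_cast (hn : 2 ≤ n) : (Fintype.card (Fin (n - 1)) : ℝ) = (n : ℝ) - 1 := by
  rw [Fintype.card_fin, Nat.cast_sub (by omega)]; simp

lemma sub_one_ne (hn : 2 ≤ n) : (n : ℝ) - 1 ≠ 0 := by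
  have : (2 : ℝ) ≤ n := by exact_mod_cast hn
  linarith

/-- The mean `λ` computed with arbitrary tangent vectors: it only depends on the scalar products
of the derivatives of `A₀` and `A_n`. -/
lemma lamMean_eq_trace [IsManifold (𝓡 n) ∞ M] (hn : 2 ≤ n) (hp : p ∈ O)
    (hV : finrank ℝ (U.tangentV p) = n)
    (e : Fin (n - 1) → TangentSpace (𝓡 n) p) {H K : Matrix (Fin (n - 1)) (Fin (n - 1)) ℝ}
    (hH : ∀ i j, H i j = form n (mvfderiv (𝓡 n) 𝔄.A0 p (e i)) (mvfderiv (𝓡 n) 𝔄.A0 p (e j)))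
    (hK : ∀ i j, K i j = form n (mvfderiv (𝓡 n) 𝔄.A0 p (e i)) (mvfderiv (𝓡 n) 𝔄.An p (e j)))
    (hdet : H.det ≠ 0) : 𝔄.lamMean p = -(1 / ((n : ℝ) - 1) * (H⁻¹ * K).trace) := by
  let N : Matrix (Fin (n - 1)) (Fin (n - 1)) ℝ := Matrix.of fun i j => 𝔄.w0i p j (e i)
  let L : Matrix (Fin (n - 1)) (Fin (n - 1)) ℝ := Matrix.of fun i j => 𝔄.lam p i j
  -- `H` and `-K` are `g` and `λ` read in the vectors `e i`, so that `H⁻¹ K` is conjugate to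
  -- `-g⁻¹ λ`
  have hHN : H = N * 𝔄.g p * N.transpose := by
    ext i j
    rw [hH, 𝔄.dA0_eq hn hp (e j)]
    have h0 := 𝔄.dA0_A0 hp (e i)
    simp only [map_add, map_smul, map_sum, h0, smul_eq_mul, mul_zero, zero_add,
      𝔄.form_dA0_A hn hp, Matrix.mul_apply, Matrix.transpose_apply, N, Matrix.of_apply]
    exact Finset.sum_congr rfl fun k _ => mul_comm _ _
  have hKN : K = -(N * L * N.transpose) := by
    ext i j
    rw [hK, 𝔄.form_dA0_dAn hn hp]
    simp only [𝔄.win_spec hn hp hV, Matrix.neg_apply, Matrix.mul_apply, Matrix.transpose_apply,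
      N, L, Matrix.of_apply, Finset.mul_sum, Finset.sum_mul]
    rw [Finset.sum_comm]
    simp only [mul_assoc]
  have hN : IsUnit N.det := by
    rw [isUnit_iff_ne_zero]
    intro h0
    apply hdet
    rw [hHN, Matrix.det_mul, Matrix.det_mul, h0]; simp
  have hNt : IsUnit N.transpose.det := by rwa [Matrix.det_transpose]
  have h1 : (H⁻¹ * K).trace = - ((𝔄.g p)⁻¹ * L).trace := by
    have : H⁻¹ * K = - ((N.transpose)⁻¹ * ((𝔄.g p)⁻¹ * L * N.transpose)) := by
      rw [hKN, hHN, Matrix.mul_inv_rev, Matrix.mul_inv_rev, mul_neg]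
      congr 1
      calc _ = (N.transpose)⁻¹ * ((𝔄.g p)⁻¹ * ((N⁻¹ * N) * L * N.transpose)) := by noncomm_ring
        _ = _ := by rw [Matrix.nonsing_inv_mul _ hN, Matrix.one_mul, ← Matrix.mul_assoc _ L]
    rw [this, Matrix.trace_neg, Matrix.trace_mul_comm, Matrix.mul_assoc,
      Matrix.mul_nonsing_inv _ hNt, Matrix.mul_one]
  rw [h1, ← sum_mul_eq_trace (fun i j => 𝔄.ginv_symm i j), lamMean]
  simp only [mul_neg, neg_neg]
  congr 1
  exact Finset.sum_congr rfl fun i _ => Finset.sum_congr rfl fun j _ => mul_comm _ _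

lemma sum_ginv_g (hn : 2 ≤ n) (hp : p ∈ O) :
    ∑ i, ∑ j, (𝔄.g p)⁻¹ i j * 𝔄.g p i j = (n : ℝ) - 1 := by
  rw [sum_mul_eq_trace fun i j => 𝔄.ginv_symm i j, Matrix.nonsing_inv_mul _ (𝔄.isUnit_det_g hn hp),
    Matrix.trace_one, card_cast hn]

/-- `dg_{ij} = ω_i^l g_{lj} + g_{il} ω_j^l`. -/
lemma dg_eq (hn : 2 ≤ n) (hp : p ∈ O) (i j) (v : TangentSpace (𝓡 n) p) :
    mvfderiv (𝓡 n) (fun q => 𝔄.g q i j) p v =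
      ∑ l, 𝔄.wij p i l v * 𝔄.g p l j + ∑ l, 𝔄.g p i l * 𝔄.wij p j l v := by
  have h := mvfderiv_form (𝔄.smoothAt_A hp i).diffAt (𝔄.smoothAt_A hp j).diffAt v
  rw [𝔄.form_dA_A hn hp, form_comm, 𝔄.form_dA_A hn hp] at h
  refine h.trans ?_
  congr 1
  exact Finset.sum_congr rfl fun l _ => by rw [𝔄.g_symm l i, mul_comm]

/-- The trace of the expansion of `∇λ_{ij}`: `dλ + λ ω_0^0 + ω_n^0 = λ_k ω_0^k`. -/
lemma dlamMean_eq [IsManifold (𝓡 n) ∞ M] (hn : 2 ≤ n)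
    (hV : ∀ q ∈ O, finrank ℝ (U.tangentV q) = n) (hp : p ∈ O) (v : TangentSpace (𝓡 n) p) :
    mvfderiv (𝓡 n) 𝔄.lamMean p v + 𝔄.lamMean p * 𝔄.w00 p v + 𝔄.wn0 p v =
      ∑ k, 𝔄.lamVec p k * 𝔄.w0i p k v := by
  have hl := fun i j => (𝔄.smoothAt_lam hn hV hp i j).diffAt
  have hg := fun i j => (𝔄.smoothAt_g hp i j).diffAt
  have hgi := fun i j => (𝔄.smoothAt_ginv hn hp i j).diffAt
  let G := 𝔄.g p
  let Gi := (𝔄.g p)⁻¹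
  let L : Matrix (Fin (n - 1)) (Fin (n - 1)) ℝ := Matrix.of fun i j => 𝔄.lam p i j
  let Ω : Matrix (Fin (n - 1)) (Fin (n - 1)) ℝ := Matrix.of fun i j => 𝔄.wij p i j v
  let dL : Matrix (Fin (n - 1)) (Fin (n - 1)) ℝ :=
    Matrix.of fun i j => mvfderiv (𝓡 n) (fun q => 𝔄.lam q i j) p v
  let dGi : Matrix (Fin (n - 1)) (Fin (n - 1)) ℝ :=
    Matrix.of fun i j => mvfderiv (𝓡 n) (fun q => (𝔄.g q)⁻¹ i j) p v
  have h1 : Gi * G = 1 := Matrix.nonsing_inv_mul _ (𝔄.isUnit_det_g hn hp)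
  have h2 : G * Gi = 1 := Matrix.mul_nonsing_inv _ (𝔄.isUnit_det_g hn hp)
  have hLs : ∀ i j, L i j = L j i := 𝔄.lam_symm hn hp (hV p hp)
  have hGs : ∀ i j, Gi i j = Gi j i := fun i j => 𝔄.ginv_symm i j
  have hd : dGi * G + Gi * (Ω * G + G * Ω.transpose) = 0 := by
    ext i j
    have hc : ∀ᶠ q in 𝓝 p, ∑ k, (𝔄.g q)⁻¹ i k • 𝔄.g q k j = if i = j then 1 else 0 :=
      (𝔄.eventually_mem hp).mono fun q hq => 𝔄.ginv_mul_g hn hq i j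
    have h0 := mvfderiv_eq_zero_of_eventually_const hc v
    rw [mvfderiv_finsum fun k _ => DiffAt.smul (hgi i k) (hg k j)] at h0
    simp only [mvfderiv_smul_apply (hgi i _) (hg _ j)] at h0
    simp only [Finset.sum_add_distrib, smul_eq_mul, 𝔄.dg_eq hn hp] at h0
    simpa only [Matrix.add_apply, Matrix.mul_apply, Matrix.zero_apply, Matrix.transpose_apply,
      dGi, G, Gi, Ω, Matrix.of_apply] using h0
  have hT := trace_mul_deriv_inv (L := L) h1 h2 hd
  have e1 : mvfderiv (𝓡 n) 𝔄.lamMean p v =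
      1 / ((n : ℝ) - 1) * ((Gi * dL).trace + (L * dGi).trace) := by
    have hs : DiffAt n (fun q => ∑ i, ∑ j, 𝔄.lam q i j • (𝔄.g q)⁻¹ i j) p :=
      DiffAt.sum fun i _ => DiffAt.sum fun j _ => DiffAt.smul (hl i j) (hgi i j)
    have e2 : mvfderiv (𝓡 n) 𝔄.lamMean p v = 1 / ((n : ℝ) - 1) *
        mvfderiv (𝓡 n) (fun q => ∑ i, ∑ j, 𝔄.lam q i j • (𝔄.g q)⁻¹ i j) p v :=
      mvfderiv_clm (ContinuousLinearMap.mul ℝ ℝ (1 / ((n : ℝ) - 1))) hs v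
    rw [e2, mvfderiv_finsum fun i _ => DiffAt.sum fun j _ => DiffAt.smul (hl i j) (hgi i j)]
    have e5 : ∀ i, mvfderiv (𝓡 n) (fun q => ∑ j, 𝔄.lam q i j • (𝔄.g q)⁻¹ i j) p v =
        ∑ j, (dL i j * Gi i j + L i j * dGi i j) := fun i => by
      rw [mvfderiv_finsum fun j _ => DiffAt.smul (hl i j) (hgi i j)]
      exact Finset.sum_congr rfl fun j _ => mvfderiv_smul_apply (hl i j) (hgi i j) v
    simp only [e5, Finset.sum_add_distrib]
    rw [← sum_mul_eq_trace hGs, ← sum_mul_eq_trace hLs]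
    congr 2
    exact Finset.sum_congr rfl fun i _ => Finset.sum_congr rfl fun j _ => mul_comm _ _
  have e3 : ∑ k, 𝔄.lamVec p k * 𝔄.w0i p k v =
      1 / ((n : ℝ) - 1) * ∑ i, ∑ j, Gi i j * 𝔄.dlam p i j v := by
    have := (𝔄.expansions hn hV hp).2.2
    simp only [this, lamVec, Finset.mul_sum, Finset.sum_mul]
    rw [Finset.sum_comm]
    refine Finset.sum_congr rfl fun i _ => ?_
    rw [Finset.sum_comm]
    refine Finset.sum_congr rfl fun j _ => Finset.sum_congr rfl fun k _ => ?_
    simp only [Gi]; ring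
  have e4 : ∑ i, ∑ j, Gi i j * 𝔄.dlam p i j v = (Gi * dL).trace
      - (Gi * (L * Ω.transpose + Ω * L)).trace + ((n : ℝ) - 1) * (𝔄.lamMean p * 𝔄.w00 p v)
      + ((n : ℝ) - 1) * 𝔄.wn0 p v := by
    have hm : ((n : ℝ) - 1) * 𝔄.lamMean p = ∑ i, ∑ j, Gi i j * 𝔄.lam p i j := by
      rw [lamMean, ← mul_assoc, mul_one_div_cancel (sub_one_ne hn), one_mul]
      exact Finset.sum_congr rfl fun i _ => Finset.sum_congr rfl fun j _ => mul_comm _ _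
    rw [← sum_mul_eq_trace hGs, ← sum_mul_eq_trace hGs, ← mul_assoc, hm, ← 𝔄.sum_ginv_g hn hp]
    simp only [Finset.sum_mul, ← Finset.sum_add_distrib, ← Finset.sum_sub_distrib]
    refine Finset.sum_congr rfl fun i _ => Finset.sum_congr rfl fun j _ => ?_
    unfold dlam
    simp only [Matrix.add_apply, Matrix.mul_apply, Matrix.transpose_apply, L, Ω, dL,
      Matrix.of_apply, Gi]
    have : ∑ k, 𝔄.wij p i k v * 𝔄.lam p k j = ∑ k, 𝔄.lam p k j * 𝔄.wij p i k v :=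
      Finset.sum_congr rfl fun k _ => mul_comm _ _
    rw [this]
    ring
  rw [e1, e3, e4, hT]
  have := sub_one_ne hn
  field_simp
  ring

/-- `dC = ω_0^k C_k`. -/
lemma dC_eq [IsManifold (𝓡 n) ∞ M] (hn : 2 ≤ n)
    (hV : ∀ q ∈ O, finrank ℝ (U.tangentV q) = n) (hp : p ∈ O) (v : TangentSpace (𝓡 n) p) :
    mvfderiv (𝓡 n) 𝔄.C p v = ∑ k, 𝔄.w0i p k v • 𝔄.Ci p k := by
  have hl := (𝔄.smoothAt_lamMean hn hV hp).diffAt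
  have h0 := (𝔄.smoothAt_A0 hp).diffAt
  have hC : mvfderiv (𝓡 n) 𝔄.C p v = mvfderiv (𝓡 n) 𝔄.An p v +
      (mvfderiv (𝓡 n) 𝔄.lamMean p v • 𝔄.A0 p + 𝔄.lamMean p • mvfderiv (𝓡 n) 𝔄.A0 p v) := by
    rw [← mvfderiv_smul_apply hl h0]
    have := mvfderiv_fun_add (𝔄.smoothAt_An hp).diffAt (DiffAt.smul hl h0)
    exact congrArg (fun T : TangentSpace (𝓡 n) p →L[ℝ] Amb n => T v) this
  have hj : ∀ j, 𝔄.wni p j v + 𝔄.lamMean p * 𝔄.w0i p j v =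
      - ∑ k, 𝔄.w0i p k v * 𝔄.affinor p j k := by
    intro j
    have e1 : 𝔄.wni p j v = - ∑ k, ∑ l, (𝔄.g p)⁻¹ j k * (𝔄.lam p k l * 𝔄.w0i p l v) := by
      rw [← Finset.sum_neg_distrib]
      unfold wni coord
      refine Finset.sum_congr rfl fun k _ => ?_
      rw [← Finset.mul_sum, ← 𝔄.win_spec hn hp (hV p hp), 𝔄.win_eq hp, mul_neg, neg_neg]
    have e2 : ∀ l, 𝔄.affinor p j l = ∑ k, (𝔄.g p)⁻¹ j k * 𝔄.lam p k l
        - 𝔄.lamMean p * (if j = l then 1 else 0) := by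
      intro l
      rw [← 𝔄.ginv_mul_g hn hp j l, affinor, Matrix.mul_apply, Finset.mul_sum,
        ← Finset.sum_sub_distrib]
      refine Finset.sum_congr rfl fun k _ => ?_
      simp only [a, Matrix.of_apply]; ring
    simp only [e2, mul_sub, Finset.sum_sub_distrib, mul_ite, mul_one, mul_zero,
      Finset.sum_ite_eq, Finset.mem_univ, if_true, e1, Finset.mul_sum]
    rw [Finset.sum_comm]
    have : ∀ x y, 𝔄.w0i p y v * ((𝔄.g p)⁻¹ j x * 𝔄.lam p x y) =
      (𝔄.g p)⁻¹ j x * (𝔄.lam p x y * 𝔄.w0i p y v) := fun x y => by ring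
    simp only [this]
    ring
  have h00 := 𝔄.dlamMean_eq hn hV hp v
  rw [hC, 𝔄.dAn_eq hn hp, 𝔄.dA0_eq hn hp]
  simp only [Ci, smul_sub, Finset.sum_sub_distrib, Finset.smul_sum, smul_smul, smul_add]
  rw [Finset.sum_comm (f := fun k j => (𝔄.w0i p k v * 𝔄.affinor p j k) • 𝔄.A j p)]
  simp only [← Finset.sum_smul]
  have e5 : ∀ j, (∑ k, 𝔄.w0i p k v * 𝔄.affinor p j k) =
      -(𝔄.wni p j v + 𝔄.lamMean p * 𝔄.w0i p j v) := fun j => by rw [hj, neg_neg]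
  have e6 : ∑ k, 𝔄.w0i p k v * 𝔄.lamVec p k = ∑ k, 𝔄.lamVec p k * 𝔄.w0i p k v :=
    Finset.sum_congr rfl fun k _ => mul_comm _ _
  simp only [e5, e6, ← h00, neg_smul, add_smul, Finset.sum_neg_distrib, Finset.sum_add_distrib]
  module

lemma range_dC [IsManifold (𝓡 n) ∞ M] (hn : 2 ≤ n)
    (hV : ∀ q ∈ O, finrank ℝ (U.tangentV q) = n) (hp : p ∈ O) :
    LinearMap.range (mvfderiv (𝓡 n) 𝔄.C p).toLinearMap =
      Submodule.span ℝ (Set.range (𝔄.Ci p)) := by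
  apply le_antisymm
  · rintro _ ⟨v, rfl⟩
    change mvfderiv (𝓡 n) 𝔄.C p v ∈ _
    rw [𝔄.dC_eq hn hV hp]
    exact sum_mem fun k _ => Submodule.smul_mem _ _ (Submodule.subset_span ⟨k, rfl⟩)
  · rw [Submodule.span_le]
    rintro _ ⟨k, rfl⟩
    obtain ⟨e, he⟩ := 𝔄.exists_dual hn hp (hV p hp)
    refine ⟨e k, ?_⟩
    change mvfderiv (𝓡 n) 𝔄.C p (e k) = _
    rw [𝔄.dC_eq hn hV hp]
    simp [he]

lemma form_C_C (hp : p ∈ O) : form n (𝔄.C p) (𝔄.C p) = 1 := by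
  have s3 : form n (𝔄.An p) (𝔄.A0 p) = 0 := by rw [form_comm]; exact 𝔄.gram_0_n p hp
  simp [C, 𝔄.gram_n_n p hp, 𝔄.gram_0_0 p hp, 𝔄.gram_0_n p hp, s3]

lemma form_C_An (hp : p ∈ O) : form n (𝔄.C p) (𝔄.An p) = 1 := by
  simp [C, 𝔄.gram_n_n p hp, 𝔄.gram_0_n p hp]

lemma form_Ci_An (hp : p ∈ O) (i) : form n (𝔄.Ci p i) (𝔄.An p) = 0 := by
  simp [Ci, 𝔄.gram_0_n p hp, 𝔄.gram_i_n p hp]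

/-- Up to sign, the affinor `a_i^j` is the matrix of the `A`-components of the points `C_i`. -/
lemma coord_Ci (hn : 2 ≤ n) (hp : p ∈ O) (j k) : 𝔄.coord p j (𝔄.Ci p k) = - 𝔄.affinor p j k := by
  have h := 𝔄.coord_A hn hp j
  rw [Ci, sub_eq_add_neg, ← neg_one_smul ℝ (∑ j, _), coord_add, coord_smul, coord_smul,
    𝔄.coord_A0 hp, coord_sum]
  simp [coord_smul, h]

lemma det_affinor (hn : 2 ≤ n) (hp : p ∈ O) : (𝔄.affinor p).det ≠ 0 ↔ (𝔄.a p).det ≠ 0 := by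
  have h : ((𝔄.g p)⁻¹).det ≠ 0 := by
    rw [Matrix.det_nonsing_inv, Ring.inverse_eq_inv']
    exact inv_ne_zero (𝔄.det_g_ne_zero hn hp)
  rw [affinor, Matrix.det_mul, mul_ne_zero_iff]
  exact ⟨fun x => x.2, fun x => ⟨h, x⟩⟩

lemma linearIndependent_Ci (hn : 2 ≤ n) (hp : p ∈ O) (ha : (𝔄.a p).det ≠ 0) :
    LinearIndependent ℝ (𝔄.Ci p) := by
  rw [Fintype.linearIndependent_iff]
  intro c hc
  have h1 : (𝔄.affinor p).mulVec c = 0 := by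
    ext j
    have := congrArg (𝔄.coordL p j) hc
    simp only [map_sum, map_smul, map_zero] at this
    change ∑ k, c k • 𝔄.coord p j (𝔄.Ci p k) = 0 at this
    simp only [𝔄.coord_Ci hn hp, smul_eq_mul, mul_neg, Finset.sum_neg_distrib,
      neg_eq_zero] at this
    simp only [Matrix.mulVec, dotProduct, Pi.zero_apply]
    rw [← this]
    exact Finset.sum_congr rfl fun k _ => mul_comm _ _
  by_contra hne
  push Not at hne
  obtain ⟨i, hi⟩ := hne
  exact (𝔄.det_affinor hn hp).2 ha (Matrix.exists_mulVec_eq_zero_iff.1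
    ⟨c, fun h => hi (congrFun h i), h1⟩)

/-- Nondegeneracy of `a_{ij}` in terms of the moving points `A₀` and `C` only. -/
lemma det_a_ne_zero_iff [IsManifold (𝓡 n) ∞ M] (hn : 2 ≤ n)
    (hV : ∀ q ∈ O, finrank ℝ (U.tangentV q) = n) (hp : p ∈ O) :
    (𝔄.a p).det ≠ 0 ↔ ∀ v, mvfderiv (𝓡 n) 𝔄.C p v ∈ U.tangency p →
      mvfderiv (𝓡 n) 𝔄.A0 p v ∈ U.tangency p := by
  have hco : ∀ v j, 𝔄.coord p j (mvfderiv (𝓡 n) 𝔄.C p v) =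
      - (𝔄.affinor p).mulVec (fun k => 𝔄.w0i p k v) j := by
    intro v j
    rw [𝔄.dC_eq hn hV hp, coord_sum]
    simp only [coord_smul, 𝔄.coord_Ci hn hp, Matrix.mulVec, dotProduct, mul_neg,
      Finset.sum_neg_distrib, neg_inj]
    exact Finset.sum_congr rfl fun k _ => mul_comm _ _
  have hw : ∀ v, mvfderiv (𝓡 n) 𝔄.A0 p v ∈ U.tangency p ↔ ∀ k, 𝔄.w0i p k v = 0 := by
    intro v
    rw [𝔄.tangency_eq hp]
    constructor
    · intro h k
      obtain ⟨c, hc⟩ := Submodule.mem_span_singleton.1 h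
      rw [w0i, ← hc, coord_smul, 𝔄.coord_A0 hp, mul_zero]
    · intro h
      rw [𝔄.dA0_eq hn hp]
      simp only [h, zero_smul, Finset.sum_const_zero, add_zero]
      exact Submodule.smul_mem _ _ (Submodule.mem_span_singleton_self _)
  rw [← 𝔄.det_affinor hn hp]
  constructor
  · intro h v hv
    rw [hw]
    rw [𝔄.tangency_eq hp] at hv
    obtain ⟨c, hc⟩ := Submodule.mem_span_singleton.1 hv
    have h1 : (𝔄.affinor p).mulVec (fun k => 𝔄.w0i p k v) = 0 := by
      ext j
      have := hco v j
      rw [← hc, coord_smul, 𝔄.coord_A0 hp, mul_zero] at this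
      simpa using this.symm
    by_contra hne
    push Not at hne
    obtain ⟨i, hi⟩ := hne
    exact h (Matrix.exists_mulVec_eq_zero_iff.1 ⟨_, fun h => hi (congrFun h i), h1⟩)
  · intro h h0
    obtain ⟨x, hx, hx0⟩ := Matrix.exists_mulVec_eq_zero_iff.2 h0
    obtain ⟨v, hv⟩ := 𝔄.exists_w0i_eq hn hp (hV p hp) x
    apply hx
    have h2 := (hw v).1 (h v ?_)
    · ext k; rw [← hv, h2]; rfl
    · have hv' : (fun k => 𝔄.w0i p k v) = x := funext hv
      rw [𝔄.dC_eq hn hV hp, 𝔄.tangency_eq hp]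
      simp only [Ci, smul_sub, Finset.sum_sub_distrib, Finset.smul_sum, smul_smul]
      rw [Finset.sum_comm (f := fun k j => (𝔄.w0i p k v * 𝔄.affinor p j k) • 𝔄.A j p)]
      simp only [← Finset.sum_smul]
      have h3 : ∀ j, ∑ k, 𝔄.w0i p k v * 𝔄.affinor p j k = 0 := by
        intro j
        have := congrFun hx0 j
        rw [← hv'] at this
        simp only [Matrix.mulVec, dotProduct, Pi.zero_apply] at this
        rw [← this]
        exact Finset.sum_congr rfl fun k _ => mul_comm _ _
      simp only [h3, zero_smul, Finset.sum_const_zero, sub_zero]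
      exact Submodule.smul_mem _ _ (Submodule.mem_span_singleton_self _)

section Change

variable {O' : Set M} (𝔅 : U.Frame O')

/-- Two frames have proportional points `A₀`. -/
lemma A0_change (hp : p ∈ O) (hp' : p ∈ O') :
    𝔅.A0 p = 𝔄.coord0 p (𝔅.A0 p) • 𝔄.A0 p ∧ 𝔄.coord0 p (𝔅.A0 p) ≠ 0 := by
  have h := 𝔅.A0_mem p hp'
  rw [𝔄.tangency_eq hp] at h
  obtain ⟨c, hc⟩ := Submodule.mem_span_singleton.1 h
  have : 𝔄.coord0 p (𝔅.A0 p) = c := by rw [← hc, coord0_smul, 𝔄.coord0_A0 hp, mul_one]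
  rw [this]
  refine ⟨hc.symm, ?_⟩
  rintro rfl
  rw [zero_smul] at hc
  exact 𝔅.A0_ne hp' hc.symm

/-- The points `A_n` of two frames are related by `A_n′ = ± A_n + t A₀`. -/
lemma An_change (hp : p ∈ O) (hp' : p ∈ O') :
    𝔅.An p = form n (𝔅.An p) (𝔄.An p) • 𝔄.An p + 𝔄.coord0 p (𝔅.An p) • 𝔄.A0 p ∧
      form n (𝔅.An p) (𝔄.An p) * form n (𝔅.An p) (𝔄.An p) = 1 := by
  have hmem : 𝔅.An p ∈ Submodule.span ℝ {𝔄.An p, 𝔄.A0 p} := by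
    rw [← 𝔄.generator_eq hp, 𝔅.generator_eq hp']
    exact Submodule.subset_span (by simp)
  obtain ⟨α, β, h⟩ := Submodule.mem_span_pair.1 hmem
  have s3 : form n (𝔄.An p) (𝔄.A0 p) = 0 := by rw [form_comm]; exact 𝔄.gram_0_n p hp
  have hα : form n (𝔅.An p) (𝔄.An p) = α := by
    rw [← h]; simp [𝔄.gram_n_n p hp, 𝔄.gram_0_n p hp]
  have hβ : 𝔄.coord0 p (𝔅.An p) = β := by
    rw [← h, coord0]; simp [𝔄.gram_n_inf p hp, 𝔄.gram_0_inf p hp]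
  rw [hα, hβ]
  refine ⟨h.symm, ?_⟩
  have := 𝔅.gram_n_n p hp'
  rw [← h] at this
  simpa [𝔄.gram_n_n p hp, 𝔄.gram_0_n p hp, s3, 𝔄.gram_0_0 p hp] using this

/-- Modulo `A₀`, the differentials of the points `A₀` of two frames are proportional. -/
lemma dA0_change (hp : p ∈ O) (hp' : p ∈ O') (v : TangentSpace (𝓡 n) p) :
    ∃ c : ℝ, mvfderiv (𝓡 n) 𝔅.A0 p v =
      c • 𝔄.A0 p + 𝔄.coord0 p (𝔅.A0 p) • mvfderiv (𝓡 n) 𝔄.A0 p v := by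
  have hev : 𝔅.A0 =ᶠ[𝓝 p] fun q => 𝔄.coord0 q (𝔅.A0 q) • 𝔄.A0 q := by
    filter_upwards [𝔄.eventually_mem hp, 𝔅.eventually_mem hp'] with q hq hq'
    exact (𝔄.A0_change 𝔅 hq hq').1
  have hs := (𝔄.smoothAt_coord0 hp (𝔅.smoothAt_A0 hp')).diffAt
  refine ⟨mvfderiv (𝓡 n) (fun q => 𝔄.coord0 q (𝔅.A0 q)) p v, ?_⟩
  rw [mvfderiv_congr hev]
  exact mvfderiv_smul_apply hs (𝔄.smoothAt_A0 hp).diffAt v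

/-- The derivatives of `A₀` along vectors dual to the forms `ω_0^i` have the Gram matrix `g`. -/
lemma gram_dual (hn : 2 ≤ n) (hp : p ∈ O) {e : Fin (n - 1) → TangentSpace (𝓡 n) p}
    (he : ∀ i j, 𝔄.w0i p i (e j) = if i = j then 1 else 0) :
    (Matrix.of fun i j => form n (mvfderiv (𝓡 n) 𝔄.A0 p (e i)) (mvfderiv (𝓡 n) 𝔄.A0 p (e j))) =
      𝔄.g p := by
  ext i j
  rw [Matrix.of_apply, 𝔄.dA0_eq hn hp (e i), 𝔄.dA0_eq hn hp (e j)]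
  have s6 : ∀ i, form n (𝔄.A i p) (𝔄.A0 p) = 0 := fun i => by
    rw [form_comm]; exact 𝔄.gram_0_i p hp i
  simp [he, 𝔄.gram_0_0 p hp, 𝔄.gram_0_i p hp, s6, g_apply]

/-- The unit point `C` of the generator does not depend on the frame, up to sign. -/
lemma C_change [IsManifold (𝓡 n) ∞ M] (hn : 2 ≤ n) (hp : p ∈ O) (hp' : p ∈ O')
    (hV : finrank ℝ (U.tangentV p) = n) :
    𝔅.C p = form n (𝔅.An p) (𝔄.An p) • 𝔄.C p := by
  set α := 𝔄.coord0 p (𝔅.A0 p) with hα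
  set ε := form n (𝔅.An p) (𝔄.An p) with hε
  set t := 𝔄.coord0 p (𝔅.An p) with ht
  obtain ⟨hA0, hα0⟩ := 𝔄.A0_change 𝔅 hp hp'
  obtain ⟨hAn, -⟩ := 𝔄.An_change 𝔅 hp hp'
  rw [← hα] at hA0 hα0
  rw [← hε, ← ht] at hAn
  obtain ⟨e, he⟩ := 𝔄.exists_dual hn hp hV
  let H : Matrix (Fin (n - 1)) (Fin (n - 1)) ℝ := Matrix.of fun i j =>
    form n (mvfderiv (𝓡 n) 𝔄.A0 p (e i)) (mvfderiv (𝓡 n) 𝔄.A0 p (e j))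
  let K : Matrix (Fin (n - 1)) (Fin (n - 1)) ℝ := Matrix.of fun i j =>
    form n (mvfderiv (𝓡 n) 𝔄.A0 p (e i)) (mvfderiv (𝓡 n) 𝔄.An p (e j))
  have hH : H = 𝔄.g p := 𝔄.gram_dual hn hp he
  have hHd : H.det ≠ 0 := by rw [hH]; exact 𝔄.det_g_ne_zero hn hp
  have s3 : form n (𝔄.An p) (𝔄.A0 p) = 0 := by rw [form_comm]; exact 𝔄.gram_0_n p hp
  have hd0 : ∀ u v, form n (mvfderiv (𝓡 n) 𝔅.A0 p u) (mvfderiv (𝓡 n) 𝔅.A0 p v) =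
      α ^ 2 * form n (mvfderiv (𝓡 n) 𝔄.A0 p u) (mvfderiv (𝓡 n) 𝔄.A0 p v) := by
    intro u v
    obtain ⟨c, hc⟩ := 𝔄.dA0_change 𝔅 hp hp' u
    obtain ⟨c', hc'⟩ := 𝔄.dA0_change 𝔅 hp hp' v
    have h1 := 𝔄.dA0_A0 hp u
    have h2 : form n (𝔄.A0 p) (mvfderiv (𝓡 n) 𝔄.A0 p v) = 0 := by
      rw [form_comm]; exact 𝔄.dA0_A0 hp v
    rw [hc, hc', ← hα]
    simp [h1, h2, 𝔄.gram_0_0 p hp]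
    ring
  have hdn : ∀ u v, form n (mvfderiv (𝓡 n) 𝔅.A0 p u) (mvfderiv (𝓡 n) 𝔅.An p v) =
      α * (ε * form n (mvfderiv (𝓡 n) 𝔄.A0 p u) (mvfderiv (𝓡 n) 𝔄.An p v) +
        t * form n (mvfderiv (𝓡 n) 𝔄.A0 p u) (mvfderiv (𝓡 n) 𝔄.A0 p v)) := by
    intro u v
    obtain ⟨c, hc⟩ := 𝔄.dA0_change 𝔅 hp hp' u
    have hev : 𝔅.An =ᶠ[𝓝 p] fun q => form n (𝔅.An q) (𝔄.An q) • 𝔄.An q +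
        𝔄.coord0 q (𝔅.An q) • 𝔄.A0 q := by
      filter_upwards [𝔄.eventually_mem hp, 𝔅.eventually_mem hp'] with q hq hq'
      exact (𝔄.An_change 𝔅 hq hq').1
    have hs1 := ((𝔅.smoothAt_An hp').form (𝔄.smoothAt_An hp)).diffAt
    have hs2 := (𝔄.smoothAt_coord0 hp (𝔅.smoothAt_An hp')).diffAt
    have hAn' := (𝔄.smoothAt_An hp).diffAt
    have hA0' := (𝔄.smoothAt_A0 hp).diffAt
    have hd : mvfderiv (𝓡 n) 𝔅.An p v =
        (mvfderiv (𝓡 n) (fun q => form n (𝔅.An q) (𝔄.An q)) p v • 𝔄.An p +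
          ε • mvfderiv (𝓡 n) 𝔄.An p v) +
        (mvfderiv (𝓡 n) (fun q => 𝔄.coord0 q (𝔅.An q)) p v • 𝔄.A0 p +
          t • mvfderiv (𝓡 n) 𝔄.A0 p v) := by
      rw [mvfderiv_congr hev, mvfderiv_fun_add (DiffAt.smul hs1 hAn') (DiffAt.smul hs2 hA0')]
      rw [hε, ht, ← mvfderiv_smul_apply hs1 hAn', ← mvfderiv_smul_apply hs2 hA0']
      rfl
    have h1 := 𝔄.dA0_A0 hp u
    have h2 : form n (𝔄.A0 p) (mvfderiv (𝓡 n) 𝔄.A0 p v) = 0 := by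
      rw [form_comm]; exact 𝔄.dA0_A0 hp v
    have h3 := 𝔄.dA0_An hp u
    have h4 : form n (𝔄.A0 p) (mvfderiv (𝓡 n) 𝔄.An p v) = 0 := by
      rw [form_comm]; exact 𝔄.dAn_A0 hp v
    rw [hc, hd, ← hα]
    simp [h1, h2, h3, h4, 𝔄.gram_0_0 p hp, 𝔄.gram_0_n p hp]
  have hα2 : α ^ 2 ≠ 0 := pow_ne_zero 2 hα0
  have h1 := 𝔄.lamMean_eq_trace hn hp hV e (H := H) (K := K) (fun i j => rfl) (fun i j => rfl) hHd
  have h2 := 𝔅.lamMean_eq_trace hn hp' hV e (H := α ^ 2 • H) (K := α • (ε • K + t • H))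
    (fun i j => (hd0 _ _).symm) (fun i j => (hdn _ _).symm) (by
      rw [Matrix.det_smul]; exact mul_ne_zero (pow_ne_zero _ hα2) hHd)
  have h3 : (α ^ 2 • H)⁻¹ = (α ^ 2)⁻¹ • H⁻¹ := by
    apply Matrix.inv_eq_right_inv
    rw [Matrix.smul_mul, Matrix.mul_smul, smul_smul, mul_inv_cancel₀ hα2, one_smul,
      Matrix.mul_nonsing_inv _ (isUnit_iff_ne_zero.2 hHd)]
  have h4 : ((α ^ 2 • H)⁻¹ * α • (ε • K + t • H)).trace =
      α⁻¹ * (ε * (H⁻¹ * K).trace + t * ((n : ℝ) - 1)) := by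
    rw [h3, Matrix.smul_mul, Matrix.mul_smul, Matrix.mul_add, Matrix.mul_smul, Matrix.mul_smul,
      Matrix.nonsing_inv_mul _ (isUnit_iff_ne_zero.2 hHd)]
    simp only [Matrix.trace_smul, Matrix.trace_add, Matrix.trace_one, card_cast hn, smul_eq_mul]
    field_simp
  -- the shift `t` of `A_n` along the generator is absorbed by `λ`
  have h5 : 𝔅.lamMean p * α = ε * 𝔄.lamMean p - t := by
    rw [h2, h4, h1]
    have := sub_one_ne hn
    field_simp
    ring
  rw [C, C, hA0, hAn, smul_smul, h5]
  module

/-- The differentials of `C` in two frames agree, up to sign. -/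
lemma dC_change [IsManifold (𝓡 n) ∞ M] (hn : 2 ≤ n) (hp : p ∈ O) (hp' : p ∈ O')
    (hV : ∀ q ∈ O, finrank ℝ (U.tangentV q) = n) (v : TangentSpace (𝓡 n) p) :
    mvfderiv (𝓡 n) 𝔅.C p v = form n (𝔅.An p) (𝔄.An p) • mvfderiv (𝓡 n) 𝔄.C p v := by
  have hev : 𝔅.C =ᶠ[𝓝 p] fun q => form n (𝔅.An q) (𝔄.An q) • 𝔄.C q := by
    filter_upwards [𝔄.eventually_mem hp, 𝔅.eventually_mem hp'] with q hq hq'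
    exact 𝔄.C_change 𝔅 hn hq hq' (hV q hq)
  have hs := ((𝔅.smoothAt_An hp').form (𝔄.smoothAt_An hp)).diffAt
  rw [mvfderiv_congr hev, mvfderiv_smul_apply hs (𝔄.smoothAt_C hn hV hp).diffAt]
  have hc : ∀ᶠ q in 𝓝 p, form n (𝔅.An q) (𝔄.An q) • form n (𝔅.An q) (𝔄.An q) = 1 := by
    filter_upwards [𝔄.eventually_mem hp, 𝔅.eventually_mem hp'] with q hq hq'
    exact (𝔄.An_change 𝔅 hq hq').2
  have h0 := mvfderiv_eq_zero_of_eventually_const hc v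
  rw [mvfderiv_smul_apply hs hs] at h0
  have hne : form n (𝔅.An p) (𝔄.An p) ≠ 0 := by
    intro h
    have := (𝔄.An_change 𝔅 hp hp').2
    rw [h] at this; simp at this
  have h1 : mvfderiv (𝓡 n) (fun q => form n (𝔅.An q) (𝔄.An q)) p v = 0 := by
    simp only [smul_eq_mul] at h0
    have : 2 * (form n (𝔅.An p) (𝔄.An p) *
        mvfderiv (𝓡 n) (fun q => form n (𝔅.An q) (𝔄.An q)) p v) = 0 := by linarith
    simpa [hne] using this
  rw [h1, zero_smul, zero_add]

lemma form_An_An_ne (hp : p ∈ O) (hp' : p ∈ O') : form n (𝔅.An p) (𝔄.An p) ≠ 0 := by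
  intro h
  have := (𝔄.An_change 𝔅 hp hp').2
  rw [h] at this; simp at this

/-- Nondegeneracy of `a_{ij}` does not depend on the frame. -/
lemma det_a_change [IsManifold (𝓡 n) ∞ M] (hn : 2 ≤ n) (hp : p ∈ O) (hp' : p ∈ O')
    (hV : ∀ q ∈ O, finrank ℝ (U.tangentV q) = n) (hV' : ∀ q ∈ O', finrank ℝ (U.tangentV q) = n)
    (ha : (𝔄.a p).det ≠ 0) : (𝔅.a p).det ≠ 0 := by
  rw [det_a_ne_zero_iff _ hn hV' hp']
  rw [det_a_ne_zero_iff _ hn hV hp] at ha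
  intro v hv
  rw [𝔄.dC_change 𝔅 hn hp hp' hV] at hv
  have h1 := ha v ((Submodule.smul_mem_iff _ (𝔄.form_An_An_ne 𝔅 hp hp')).1 hv)
  obtain ⟨c, hc⟩ := 𝔄.dA0_change 𝔅 hp hp' v
  rw [hc]
  exact add_mem (Submodule.smul_mem _ _ (𝔄.A0_mem p hp)) (Submodule.smul_mem _ _ h1)

end Change

variable [IsManifold (𝓡 n) ∞ M]

/-- `C` spans the pole, in every frame. -/
lemma pole_eq (hn : 2 ≤ n) (hp : p ∈ O) (hV : finrank ℝ (U.tangentV p) = n) :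
    U.pole p = Submodule.span ℝ {𝔄.C p} := by
  apply le_antisymm
  · refine iSup_le fun O' => iSup_le fun 𝔅 => iSup_le fun hp' => ?_
    rw [𝔄.C_change 𝔅 hn hp hp' hV]
    exact Submodule.span_singleton_smul_le _ _ _
  · exact le_iSup_of_le O (le_iSup_of_le 𝔄 (le_iSup_of_le hp le_rfl))

/-- The normalizing subspace is the image of the differential of `C`. -/
lemma zeta_eq_range (hn : 2 ≤ n) (hV : ∀ q ∈ O, finrank ℝ (U.tangentV q) = n) (hp : p ∈ O) :
    U.zeta p = LinearMap.range (mvfderiv (𝓡 n) 𝔄.C p).toLinearMap := by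
  apply le_antisymm
  · refine iSup_le fun O' => iSup_le fun 𝔅 => iSup_le fun hp' => ?_
    let 𝔅' := 𝔅.restrict (𝔄.isOpen.inter 𝔅.isOpen) Set.inter_subset_right
    have h1 := 𝔅'.range_dC hn (fun q hq => hV q hq.1) ⟨hp, hp'⟩
    change Submodule.span ℝ (Set.range (𝔅'.Ci p)) ≤ _
    rw [← h1]
    rintro _ ⟨v, rfl⟩
    change mvfderiv (𝓡 n) 𝔅.C p v ∈ _
    rw [𝔄.dC_change 𝔅 hn hp hp' hV]
    exact Submodule.smul_mem _ _ ⟨v, rfl⟩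
  · rw [𝔄.range_dC hn hV hp]
    exact le_iSup_of_le O (le_iSup_of_le 𝔄 (le_iSup_of_le hp le_rfl))

lemma zeta_eq (hn : 2 ≤ n) (hV : ∀ q ∈ O, finrank ℝ (U.tangentV q) = n) (hp : p ∈ O) :
    U.zeta p = Submodule.span ℝ (Set.range (𝔄.Ci p)) := by
  rw [𝔄.zeta_eq_range hn hV hp, 𝔄.range_dC hn hV hp]

lemma isLift_C (hn : 2 ≤ n) (hV : ∀ q ∈ O, finrank ℝ (U.tangentV q) = n) (hp : p ∈ O) :
    IsLift U.pole p 𝔄.C := by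
  filter_upwards [𝔄.eventually_mem hp] with q hq
  refine ⟨𝔄.smoothAt_C hn hV hq, ?_, 𝔄.pole_eq hn hq (hV q hq)⟩
  intro h
  have := 𝔄.form_C_C hq
  rw [h] at this; simp at this

lemma tangentW_eq (hn : 2 ≤ n) (hV : ∀ q ∈ O, finrank ℝ (U.tangentV q) = n) (hp : p ∈ O) :
    U.tangentW p =
      Submodule.span ℝ {𝔄.C p} ⊔ Submodule.span ℝ (Set.range (𝔄.Ci p)) := by
  unfold tangentW
  rw [(𝔄.isLift_C hn hV hp).projTangent_eq, 𝔄.range_dC hn hV hp]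

lemma Ci_mem_tangentV (hn : 2 ≤ n) (hV : finrank ℝ (U.tangentV p) = n) (hp : p ∈ O) (i) :
    𝔄.Ci p i ∈ U.tangentV p := by
  rw [𝔄.tangentV_eq hn hp hV]
  exact sub_mem (Submodule.mem_sup_left (Submodule.smul_mem _ _
      (Submodule.mem_span_singleton_self _)))
      (Submodule.mem_sup_right (sum_mem fun i _ => Submodule.smul_mem _ _
        (Submodule.subset_span ⟨i, rfl⟩)))

lemma form_An_of_mem_span_Ci (hp : p ∈ O) {w : Amb n}
    (hw : w ∈ Submodule.span ℝ (Set.range (𝔄.Ci p))) : form n w (𝔄.An p) = 0 := by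
  induction hw using Submodule.span_induction with
  | mem x hx => obtain ⟨i, rfl⟩ := hx; exact 𝔄.form_Ci_An hp i
  | zero => simp
  | add x y _ _ hx hy => simp [hx, hy]
  | smul c x _ hx => simp [hx]

lemma finrank_span_Ci (hn : 2 ≤ n) (hp : p ∈ O) (ha : (𝔄.a p).det ≠ 0) :
    finrank ℝ (Submodule.span ℝ (Set.range (𝔄.Ci p))) = n - 1 := by
  rw [finrank_span_eq_card (𝔄.linearIndependent_Ci hn hp ha), Fintype.card_fin]

lemma finrank_tangentW (hn : 2 ≤ n) (hV : ∀ q ∈ O, finrank ℝ (U.tangentV q) = n) (hp : p ∈ O)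
    (ha : (𝔄.a p).det ≠ 0) : finrank ℝ (U.tangentW p) = n := by
  rw [𝔄.tangentW_eq hn hV hp]
  have hC0 : 𝔄.C p ≠ 0 := (𝔄.isLift_C hn hV hp).ne_zero
  have h1 := Submodule.finrank_sup_add_finrank_inf_eq (Submodule.span ℝ {𝔄.C p})
    (Submodule.span ℝ (Set.range (𝔄.Ci p)))
  have h2 : Submodule.span ℝ {𝔄.C p} ⊓ Submodule.span ℝ (Set.range (𝔄.Ci p)) = ⊥ := by
    rw [eq_bot_iff]
    rintro w ⟨hw1, hw2⟩
    obtain ⟨c, rfl⟩ := Submodule.mem_span_singleton.1 hw1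
    have := 𝔄.form_An_of_mem_span_Ci hp hw2
    rw [map_smul, LinearMap.smul_apply, 𝔄.form_C_An hp, smul_eq_mul, mul_one] at this
    rw [this]; simp
  rw [h2, finrank_bot, finrank_span_singleton hC0, 𝔄.finrank_span_Ci hn hp ha] at h1
  omega

lemma zeta_eq_inf {O : Set M} {p : M} (𝔄 : U.Frame O) (hn : 2 ≤ n)
    (hV : ∀ q ∈ O, finrank ℝ (U.tangentV q) = n) (hp : p ∈ O) :
    U.zeta p = U.tangentV p ⊓ U.tangentW p := by
  rw [𝔄.zeta_eq hn hV hp, 𝔄.tangentW_eq hn hV hp]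
  apply le_antisymm
  · refine le_inf ?_ le_sup_right
    rw [Submodule.span_le]
    rintro _ ⟨i, rfl⟩
    exact 𝔄.Ci_mem_tangentV hn (hV p hp) hp i
  · rintro w ⟨hw1, hw2⟩
    obtain ⟨y, hy, z, hz, rfl⟩ := Submodule.mem_sup.1 hw2
    obtain ⟨c, rfl⟩ := Submodule.mem_span_singleton.1 hy
    -- `T_{A₀}(V)` and `ζ` are orthogonal to `A_n`, while `(C, A_n) = 1`
    have h0 : form n (c • 𝔄.C p + z) (𝔄.An p) = 0 := by
      rw [SetLike.mem_coe, 𝔄.tangentV_eq hn hp (hV p hp)] at hw1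
      obtain ⟨y', hy', z', hz', h⟩ := Submodule.mem_sup.1 hw1
      obtain ⟨c', rfl⟩ := Submodule.mem_span_singleton.1 hy'
      rw [← h]
      have : form n z' (𝔄.An p) = 0 := by
        clear h
        induction hz' using Submodule.span_induction with
        | mem x hx => obtain ⟨i, rfl⟩ := hx; exact 𝔄.gram_i_n p hp i
        | zero => simp
        | add x y _ _ hx hy => simp [hx, hy]
        | smul c x _ hx => simp [hx]
      simp [this, 𝔄.gram_0_n p hp]
    rw [map_add, map_smul, LinearMap.add_apply, LinearMap.smul_apply, 𝔄.form_C_An hp,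
      𝔄.form_An_of_mem_span_Ci hp hz, smul_eq_mul, mul_one, add_zero] at h0
    rw [h0, zero_smul, zero_add]
    exact hz

end Frame
end LightlikeHypersurface
end DeSitter

end


/-! ### Construction of adapted and reduced frames -/

noncomputable section
namespace DeSitter
namespace LightlikeHypersurface

variable {n : ℕ} {M : Type*} [TopologicalSpace M] [ChartedSpace (EuclideanSpace ℝ (Fin n)) M]
  {U : LightlikeHypersurface n M}

lemma linearIndependent_of_det_gram {ι : Type*} [Fintype ι] [DecidableEq ι] {B : ι → Amb n}
    (h : (Matrix.of fun i j => form n (B i) (B j)).det ≠ 0) : LinearIndependent ℝ B := by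
  rw [Fintype.linearIndependent_iff]
  intro c hc
  have h1 : (Matrix.of fun i j => form n (B i) (B j)).mulVec c = 0 := by
    ext i
    have := congrArg (form n (B i)) hc
    simp only [map_sum, map_smul, map_zero, smul_eq_mul] at this
    simp only [Matrix.mulVec, dotProduct, Matrix.of_apply, Pi.zero_apply]
    rw [← this]
    exact Finset.sum_congr rfl fun k _ => mul_comm _ _
  by_contra hne
  push Not at hne
  obtain ⟨i, hi⟩ := hne
  exact h (Matrix.exists_mulVec_eq_zero_iff.1 ⟨c, fun h => hi (congrFun h i), h1⟩)

/-- An adapted frame is determined by its vertices `A₀`, `A_i`, `A_n`, and these may be chosen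
freely, subject to the relations between them; the vertex `A_{n+1}` is found by orthogonalizing a
constant vector and correcting it along `A₀`. -/
lemma exists_frame {p : M} {a b : M → Amb n} {B : Fin (n - 1) → M → Amb n}
    (hs : ∀ᶠ q in 𝓝 p, SmoothAt n a q ∧ SmoothAt n b q ∧ ∀ i, SmoothAt n (B i) q)
    (ha : ∀ᶠ q in 𝓝 p, a q ∈ U.tangency q ∧ a q ≠ 0)
    (hg : ∀ᶠ q in 𝓝 p, form n (a q) (b q) = 0 ∧ form n (b q) (b q) = 1 ∧
      ∀ i, form n (a q) (B i q) = 0 ∧ form n (B i q) (b q) = 0)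
    (hx : ∀ᶠ q in 𝓝 p, U.pt q ≤ Submodule.span ℝ {b q, a q})
    (hB : (Matrix.of fun i j => form n (B i p) (B j p)).det ≠ 0) :
    ∃ (O : Set M) (𝔄 : U.Frame O), p ∈ O ∧ 𝔄.A0 = a ∧ 𝔄.A = B ∧ 𝔄.An = b := by
  obtain ⟨c, hc⟩ : ∃ c, form n (a p) c ≠ 0 := by
    by_contra! h
    exact ha.self_of_nhds.2 (eq_zero_of_form fun y => by rw [form_comm]; exact h y)
  let G : M → Matrix (Fin (n - 1)) (Fin (n - 1)) ℝ := fun q =>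
    Matrix.of fun i j => form n (B i q) (B j q)
  have hcE : ∀ᶠ q in 𝓝 p, form n (a q) c ≠ 0 := by
    have h1 : SmoothAt n (fun q => form n (a q) c) p :=
      hs.self_of_nhds.1.form contMDiffAt_const
    exact h1.continuousAt.eventually_ne hc
  have hGE : ∀ᶠ q in 𝓝 p, (G q).det ≠ 0 := by
    have h1 : ContinuousAt (fun q => (G q).det) p := by
      have h2 : ContinuousAt G p := by
        refine continuousAt_pi.2 fun i => continuousAt_pi.2 fun j => ?_
        exact ((hs.self_of_nhds.2.2 i).form (hs.self_of_nhds.2.2 j)).continuousAt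
      exact (continuous_id.matrix_det.continuousAt).comp h2
    exact h1.eventually_ne hB
  obtain ⟨O, hO, hOo, hpO⟩ := eventually_nhds_iff.1
    (hs.and (ha.and (hg.and (hx.and (hcE.and hGE)))))
  -- `c0` is normalized by `(a, c0) = -1`, `c1` is also orthogonal to `b` and the `B i`, and `c2` is
  -- also isotropic
  let c0 : M → Amb n := fun q => (-(form n (a q) c)⁻¹) • c
  let c1 : M → Amb n := fun q => c0 q - form n (c0 q) (b q) • b q -
    ∑ i, ∑ j, ((G q)⁻¹ i j * form n (c0 q) (B j q)) • B i q
  let c2 : M → Amb n := fun q => c1 q + (1 / 2 * form n (c1 q) (c1 q)) • a q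
  have haa : ∀ q ∈ O, form n (a q) (a q) = 0 := fun q hq => form_tangency_self (hO q hq).2.1.1
  have hGs : ∀ q i j, G q i j = G q j i := fun q i j => form_comm _ _
  have h10 : ∀ q ∈ O, form n (a q) (c1 q) = -1 := by
    intro q hq
    obtain ⟨-, -, ⟨h1, h2, h3⟩, -, h4, -⟩ := hO q hq
    simp [c1, c0, h1, fun i => (h3 i).1, h4]
  have h1b : ∀ q ∈ O, form n (b q) (c1 q) = 0 := by
    intro q hq
    obtain ⟨-, -, ⟨h1, h2, h3⟩, -, h4, -⟩ := hO q hq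
    have h5 : ∀ i, form n (b q) (B i q) = 0 := fun i => by rw [form_comm]; exact (h3 i).2
    simp [c1, h2, h5, form_comm (b q) (c0 q)]
  have h1B : ∀ q ∈ O, ∀ k, form n (B k q) (c1 q) = 0 := by
    intro q hq k
    obtain ⟨-, -, ⟨h1, h2, h3⟩, -, h4, h5⟩ := hO q hq
    have h6 : ∑ i, ∑ j, (G q)⁻¹ i j * form n (c0 q) (B j q) * form n (B k q) (B i q) =
        form n (c0 q) (B k q) := by
      rw [Finset.sum_comm]
      have h7 : ∀ j, ∑ i, G q k i * (G q)⁻¹ i j = if k = j then 1 else 0 := fun j => by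
        rw [← Matrix.mul_apply, Matrix.mul_nonsing_inv _ (isUnit_iff_ne_zero.2 h5),
          Matrix.one_apply]
      calc _ = ∑ j, (∑ i, G q k i * (G q)⁻¹ i j) * form n (c0 q) (B j q) := by
            refine Finset.sum_congr rfl fun j _ => ?_
            rw [Finset.sum_mul]
            refine Finset.sum_congr rfl fun i _ => ?_
            simp only [G, Matrix.of_apply]; ring
        _ = _ := by simp [h7]
    simp [c1, (h3 k).2, h6, form_comm (B k q) (c0 q)]
  have hsm : ∀ q ∈ O, SmoothAt n c1 q := by
    intro q hq
    obtain ⟨⟨s1, s2, s3⟩, -, -, -, h4, h5⟩ := hO q hq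
    have t0 : SmoothAt n c0 q :=
      (((s1.form contMDiffAt_const).inv₀ h4).neg).smul contMDiffAt_const
    have t1 : ∀ i j, SmoothAt n (fun q => (G q)⁻¹ i j) q :=
      SmoothAt.inv_entry (fun i j => (s3 i).form (s3 j)) h5
    exact (t0.sub ((t0.form s2).smul s2)).sub (SmoothAt.sum fun i _ => SmoothAt.sum fun j _ =>
      ((t1 i j).mul (t0.form (s3 j))).smul (s3 i))
  refine ⟨O, {
    A0 := a
    A := B
    An := b
    Ainf := c2
    isOpen := hOo
    smooth_A0 := fun q hq => (hO q hq).1.1.contMDiffWithinAt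
    smooth_A := fun i q hq => ((hO q hq).1.2.2 i).contMDiffWithinAt
    smooth_An := fun q hq => (hO q hq).1.2.1.contMDiffWithinAt
    smooth_Ainf := fun q hq => ContMDiffAt.contMDiffWithinAt ((hsm q hq).add
      ((contMDiffAt_const.mul ((hsm q hq).form (hsm q hq))).smul (hO q hq).1.1))
    gram_0_0 := haa
    gram_0_i := fun q hq i => ((hO q hq).2.2.1.2.2 i).1
    gram_0_n := fun q hq => (hO q hq).2.2.1.1
    gram_0_inf := fun q hq => by simp [c2, h10 q hq, haa q hq]
    gram_i_n := fun q hq i => ((hO q hq).2.2.1.2.2 i).2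
    gram_i_inf := fun q hq i => by
      have h1 := ((hO q hq).2.2.1.2.2 i).1
      rw [form_comm] at h1
      simp [c2, h1B q hq i, h1]
    gram_n_n := fun q hq => (hO q hq).2.2.1.2.1
    gram_n_inf := fun q hq => by
      have h1 := (hO q hq).2.2.1.1
      rw [form_comm] at h1
      simp [c2, h1b q hq, h1]
    gram_inf_inf := fun q hq => by
      have h1 := h10 q hq
      have h2 : form n (c1 q) (a q) = -1 := by rw [form_comm]; exact h1
      simp [c2, h1, h2, haa q hq]
      ring
    indep := fun q hq => linearIndependent_of_det_gram (hO q hq).2.2.2.2.2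
    A0_mem := fun q hq => (hO q hq).2.1.1
    pt_le := fun q hq => (hO q hq).2.2.2.1 }, hpO, rfl, rfl, rfl⟩

/-- A lift of the point `x` can be normalized to be a unit vector. -/
lemma isLift_normalize {p : M} {f : M → Amb n} (hf : IsLift U.pt p f) :
    IsLift U.pt p (fun q => (√(form n (f q) (f q)))⁻¹ • f q) ∧ ∀ᶠ q in 𝓝 p,
      form n ((√(form n (f q) (f q)))⁻¹ • f q) ((√(form n (f q) (f q)))⁻¹ • f q) = 1 := by
  refine ⟨?_, ?_⟩
  · filter_upwards [hf.eventually] with q hq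
    have hpos := form_lift_pos hq
    have hne : √(form n (f q) (f q)) ≠ 0 := (Real.sqrt_pos.2 hpos).ne'
    have hs : SmoothAt n (fun q => √(form n (f q) (f q))) q :=
      SmoothAt.comp_fun (φ := Real.sqrt) (Real.contDiffAt_sqrt hpos.ne')
        (hq.smoothAt.form hq.smoothAt)
    refine ⟨(hs.inv₀ hne).smul hq.smoothAt, smul_ne_zero (inv_ne_zero hne) hq.ne_zero, ?_⟩
    rw [hq.eq, Submodule.span_singleton_smul_eq (isUnit_iff_ne_zero.2 (inv_ne_zero hne))]
  · filter_upwards [hf.eventually] with q hq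
    have hpos := form_lift_pos hq
    simp only [map_smul, LinearMap.smul_apply, smul_eq_mul]
    rw [← mul_assoc, ← mul_inv, Real.mul_self_sqrt hpos.le, inv_mul_cancel₀ hpos.ne']

lemma exists_unit_lift (U : LightlikeHypersurface n M) (p : M) :
    ∃ f, IsLift U.pt p f ∧ ∀ᶠ q in 𝓝 p, form n (f q) (f q) = 1 :=
  ⟨_, isLift_normalize (U.pt_lift p).choose_spec⟩

namespace Frame

variable {O : Set M} (𝔄 : U.Frame O) {p : M}

/-- The frame with the same `A₀` and `A_i` in which `A_n` is a given unit lift of `x`. -/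
lemma exists_frame_unit_lift (hn : 2 ≤ n) (hp : p ∈ O) {a f : M → Amb n}
    (ha : IsLift U.tangency p a) (hf : IsLift U.pt p f) (h1 : ∀ᶠ q in 𝓝 p, form n (f q) (f q) = 1) :
    ∃ (O' : Set M) (𝔅 : U.Frame O'), p ∈ O' ∧ 𝔅.A0 = a ∧ 𝔅.A = 𝔄.A ∧ 𝔅.An = f := by
  have hmem := 𝔄.eventually_mem hp
  refine exists_frame ?_ ?_ ?_ ?_ (𝔄.det_g_ne_zero hn hp)
  · filter_upwards [hmem, ha.eventually, hf.eventually] with q hq hqa hqf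
    exact ⟨hqa.smoothAt, hqf.smoothAt, fun i => 𝔄.smoothAt_A hq i⟩
  · filter_upwards [ha.eventually] with q hqa
    exact ⟨by rw [hqa.eq]; exact Submodule.mem_span_singleton_self _, hqa.ne_zero⟩
  · filter_upwards [hmem, ha.eventually, hf.eventually, h1] with q hq hqa hqf hq1
    have e1 : a q ∈ U.tangency q := by rw [hqa.eq]; exact Submodule.mem_span_singleton_self _
    rw [𝔄.tangency_eq hq] at e1
    obtain ⟨c, hc⟩ := Submodule.mem_span_singleton.1 e1
    obtain ⟨e2, -⟩ := 𝔄.exists_lift_eq hq hqf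
    have s3 : form n (𝔄.An q) (𝔄.A0 q) = 0 := by rw [form_comm]; exact 𝔄.gram_0_n q hq
    have s6 : ∀ i, form n (𝔄.A i q) (𝔄.A0 q) = 0 := fun i => by
      rw [form_comm]; exact 𝔄.gram_0_i q hq i
    refine ⟨?_, hq1, fun i => ⟨?_, ?_⟩⟩
    · rw [e2, ← hc]; simp [𝔄.gram_0_n q hq, 𝔄.gram_0_0 q hq]
    · rw [← hc]; simp [𝔄.gram_0_i q hq]
    · rw [e2]; simp [𝔄.gram_i_n q hq, s6]
  · filter_upwards [hf.eventually] with q hqf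
    rw [hqf.eq]
    exact Submodule.span_mono (by simp)

/-- The Gram matrix of the points `C_i` is `aᵀ g a`, with the affinor `a`. -/
lemma det_gram_Ci (hn : 2 ≤ n) (hp : p ∈ O) (ha : (𝔄.a p).det ≠ 0) :
    (Matrix.of fun i j => form n (𝔄.Ci p i) (𝔄.Ci p j)).det ≠ 0 := by
  have h : (Matrix.of fun i j => form n (𝔄.Ci p i) (𝔄.Ci p j)) =
      (𝔄.affinor p).transpose * 𝔄.g p * 𝔄.affinor p := by
    ext i j
    have h1 : ∀ i j, form n (𝔄.Ci p i) (𝔄.Ci p j) = form n (∑ k, 𝔄.affinor p k i • 𝔄.A k p)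
        (∑ k, 𝔄.affinor p k j • 𝔄.A k p) := fun i j => by
      have z1 : ∀ i, form n (𝔄.A0 p) (∑ k, 𝔄.affinor p k i • 𝔄.A k p) = 0 := fun i => by
        simp [𝔄.gram_0_i p hp]
      have z2 : form n (∑ k, 𝔄.affinor p k i • 𝔄.A k p) (𝔄.A0 p) = 0 := by
        rw [form_comm]; exact z1 i
      simp only [Ci, map_sub, LinearMap.sub_apply, map_smul, LinearMap.smul_apply, z1, z2,
        𝔄.gram_0_0 p hp, smul_eq_mul, mul_zero, sub_zero, zero_sub, neg_neg]
    rw [Matrix.of_apply, h1]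
    simp only [map_sum, LinearMap.sum_apply, map_smul, LinearMap.smul_apply, smul_eq_mul,
      Matrix.mul_apply, Matrix.transpose_apply, g_apply, Finset.mul_sum, Finset.sum_mul]
    refine Finset.sum_congr rfl fun k _ => Finset.sum_congr rfl fun l _ => ?_
    ring
  rw [h, Matrix.det_mul, Matrix.det_mul, Matrix.det_transpose]
  have h1 := (𝔄.det_affinor hn hp).2 ha
  exact mul_ne_zero (mul_ne_zero h1 (𝔄.det_g_ne_zero hn hp)) h1

variable [IsManifold (𝓡 n) ∞ M]

/-- Reduced frames exist where the tensor `a` is nondegenerate, and their vertex `A_n` may be any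
unit lift of `x`. The vertices `A_i` are derivatives of `C` along constant fields in a chart. -/
lemma exists_reduced (hn : 2 ≤ n) (hV : ∀ q ∈ O, finrank ℝ (U.tangentV q) = n) (hp : p ∈ O)
    (ha : ∀ q ∈ O, (𝔄.a q).det ≠ 0) {f : M → Amb n} (hf : IsLift U.pt p f)
    (hf1 : ∀ᶠ q in 𝓝 p, form n (f q) (f q) = 1) :
    ∃ (O' : Set M) (𝔅 : U.Frame O'), p ∈ O' ∧ 𝔅.An = f ∧ 𝔅.Reduced U.zeta := by
  obtain ⟨e, he⟩ := 𝔄.exists_dual hn hp (hV p hp)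
  -- at `p` these are the points `C_i`; they lie in `ζ` everywhere because `dC` takes values there
  let B : Fin (n - 1) → M → Amb n := fun i q => mvfderiv (𝓡 n) 𝔄.C q (tangentField p (e i) q)
  have hBp : ∀ i, B i p = 𝔄.Ci p i := by
    intro i
    simp only [B, tangentField_self]
    rw [𝔄.dC_eq hn hV hp]
    simp [he]
  have hB : (Matrix.of fun i j => form n (B i p) (B j p)).det ≠ 0 := by
    simp only [hBp]
    exact 𝔄.det_gram_Ci hn hp (ha p hp)
  have hBz : ∀ q ∈ O, ∀ i, B i q ∈ U.zeta q := by
    intro q hq i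
    rw [𝔄.zeta_eq_range hn hV hq]
    exact ⟨_, rfl⟩
  have hz : ∀ q ∈ O, ∀ w ∈ U.zeta q, form n (𝔄.A0 q) w = 0 ∧ form n w (𝔄.An q) = 0 := by
    intro q hq w hw
    rw [𝔄.zeta_eq hn hV hq] at hw
    refine ⟨?_, 𝔄.form_An_of_mem_span_Ci hq hw⟩
    have h1 : Submodule.span ℝ (Set.range (𝔄.Ci q)) ≤ LinearMap.ker (form n (𝔄.A0 q)) := by
      rw [Submodule.span_le]
      rintro _ ⟨i, rfl⟩
      simp [Ci, 𝔄.gram_0_0 q hq, 𝔄.gram_0_i q hq]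
    exact h1 hw
  have hsB : ∀ᶠ q in 𝓝 p, ∀ i, SmoothAt n (B i) q := by
    filter_upwards [𝔄.eventually_mem hp, (chartAt (EuclideanSpace ℝ (Fin n)) p).open_source.mem_nhds
      (mem_chart_source _ p)] with q hq hqs i
    exact (𝔄.smoothAt_C hn hV hq).coordDeriv hqs (e i)
  obtain ⟨O', 𝔅, hp', h0, hA, hAn⟩ :=
    exists_frame (U := U) (a := 𝔄.A0) (b := f) (B := B) (p := p) (by
    filter_upwards [𝔄.eventually_mem hp, hf.eventually, hsB] with q hq hqf hqB
    exact ⟨𝔄.smoothAt_A0 hq, hqf.smoothAt, hqB⟩) (by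
    filter_upwards [𝔄.eventually_mem hp] with q hq
    exact ⟨𝔄.A0_mem q hq, 𝔄.A0_ne hq⟩) (by
    filter_upwards [𝔄.eventually_mem hp, hf.eventually, hf1] with q hq hqf hq1
    obtain ⟨e2, -⟩ := 𝔄.exists_lift_eq hq hqf
    refine ⟨?_, hq1, fun i => ⟨(hz q hq _ (hBz q hq i)).1, ?_⟩⟩
    · rw [e2]; simp [𝔄.gram_0_n q hq, 𝔄.gram_0_0 q hq]
    · have h1 := (hz q hq _ (hBz q hq i)).1
      rw [form_comm] at h1
      rw [e2]; simp [(hz q hq _ (hBz q hq i)).2, h1]) (by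
    filter_upwards [hf.eventually] with q hqf
    rw [hqf.eq]
    exact Submodule.span_mono (by simp)) hB
  have hev : ∀ᶠ q in 𝓝 p, q ∈ O ∧ q ∈ O' ∧ IsLift U.pt q f :=
    (𝔄.eventually_mem hp).and ((𝔅.eventually_mem hp').and hf.eventually)
  obtain ⟨O₁, hO₁, hO₁o, hpO₁⟩ := eventually_nhds_iff.1 hev
  refine ⟨O₁, 𝔅.restrict hO₁o fun q hq => (hO₁ q hq).2.1, hpO₁, hAn, ?_, ?_⟩
  · intro q hq
    change U.pt q = ℝ ∙ 𝔅.An q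
    rw [hAn]
    exact (hO₁ q hq).2.2.eq
  · intro q hq
    obtain ⟨hqO, hqO', -⟩ := hO₁ q hq
    change U.zeta q = Submodule.span ℝ (Set.range fun i => 𝔅.A i q)
    symm
    apply Submodule.eq_of_le_of_finrank_eq
    · rw [Submodule.span_le]
      rintro _ ⟨i, rfl⟩
      rw [hA]
      exact hBz q hqO i
    · rw [finrank_span_eq_card (𝔅.indep q hqO'), 𝔄.zeta_eq hn hV hqO,
        𝔄.finrank_span_Ci hn hqO (ha q hqO), Fintype.card_fin]

end Frame
end LightlikeHypersurface
end DeSitter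

end


/-! ### Constancy along the generators and the normalization -/

noncomputable section
namespace DeSitter

/-- If the derivatives of linearly independent vectors, depending on a parameter, stay in their
span, then this span is locally constant. -/
lemma eventually_span_eq {W : Type*} [NormedAddCommGroup W] [NormedSpace ℝ W]
    [FiniteDimensional ℝ W] {ι : Type*} [Fintype ι] [DecidableEq ι] {K : ι → ℝ → W} {t₀ : ℝ}
    (hK : ∀ᶠ s in 𝓝 t₀, ∀ i, DifferentiableAt ℝ (K i) s)
    (hi : LinearIndependent ℝ fun i => K i t₀)
    (hd : ∀ᶠ s in 𝓝 t₀, ∀ i, deriv (K i) s ∈ Submodule.span ℝ (Set.range fun j => K j s)) :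
    ∀ᶠ s in 𝓝 t₀, Submodule.span ℝ (Set.range fun j => K j s) =
      Submodule.span ℝ (Set.range fun j => K j t₀) := by
  obtain ⟨g, hg⟩ := (Fintype.linearCombination ℝ fun i => K i t₀).exists_leftInverse_of_injective
    (LinearMap.ker_eq_bot.2 hi.fintypeLinearCombination_injective)
  let L : W →L[ℝ] (ι → ℝ) := LinearMap.toContinuousLinearMap g
  have hL : ∀ i, L (K i t₀) = Pi.single i 1 := by
    intro i
    have := LinearMap.congr_fun hg (Pi.single i 1)
    simp only [LinearMap.comp_apply, Fintype.linearCombination_apply_single, one_smul,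
      LinearMap.id_apply] at this
    exact this
  let P : ℝ → Matrix ι ι ℝ := fun s => Matrix.of fun i j => L (K i s) j
  have hPd : ∀ᶠ s in 𝓝 t₀, ∀ i j, DifferentiableAt ℝ (fun s => P s i j) s := by
    filter_upwards [hK] with s hs i j
    exact (((ContinuousLinearMap.proj j : (ι → ℝ) →L[ℝ] ℝ).comp L).differentiableAt).comp s (hs i)
  have hP0 : P t₀ = 1 := by
    ext i j
    simp only [P, Matrix.of_apply, hL, Matrix.one_apply, Pi.single_apply, eq_comm]
  have hPE : ∀ᶠ s in 𝓝 t₀, (P s).det ≠ 0 := by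
    have h1 : ContinuousAt (fun s => (P s).det) t₀ := by
      have h2 : ContinuousAt P t₀ := continuousAt_pi.2 fun i => continuousAt_pi.2 fun j =>
        (hPd.self_of_nhds i j).continuousAt
      exact (continuous_id.matrix_det.continuousAt).comp h2
    exact h1.eventually_ne (by rw [hP0]; simp)
  obtain ⟨ε, hε, hE⟩ := Metric.eventually_nhds_iff_ball.1 (hK.and (hd.and (hPd.and hPE)))
  -- the basis of the moving span that is dual to the coordinates `L`
  let N : ι → ℝ → W := fun i s => ∑ j, (P s)⁻¹ i j • K j s
  have hinv : ∀ s ∈ Metric.ball t₀ ε, ∀ i j,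
      DifferentiableAt ℝ (fun s => (P s)⁻¹ i j) s := by
    intro s hs i j
    obtain ⟨-, -, h3, h4⟩ := hE s hs
    have h5 : DifferentiableAt ℝ (fun A : ι → ι → ℝ => (Matrix.of A)⁻¹ i j) (P s) :=
      (contDiffAt_inv_entry (A := P s) h4 i j).differentiableAt (by simp)
    have h6 : DifferentiableAt ℝ (fun s => (P s : ι → ι → ℝ)) s :=
      differentiableAt_pi.2 fun i => differentiableAt_pi.2 fun j => h3 i j
    exact h5.comp s h6
  have hLN : ∀ s ∈ Metric.ball t₀ ε, ∀ i, L (N i s) = Pi.single i 1 := by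
    intro s hs i
    ext k
    have h1 := congrFun (congrFun (Matrix.nonsing_inv_mul (P s)
      (isUnit_iff_ne_zero.2 (hE s hs).2.2.2)) i) k
    rw [Matrix.mul_apply, Matrix.one_apply] at h1
    simp only [N, map_sum, map_smul, Finset.sum_apply, Pi.smul_apply, smul_eq_mul,
      Pi.single_apply]
    simp only [P, Matrix.of_apply] at h1 ⊢
    rw [h1]
    simp [eq_comm]
  have hspan : ∀ s ∈ Metric.ball t₀ ε, Submodule.span ℝ (Set.range fun j => K j s) =
      Submodule.span ℝ (Set.range fun j => N j s) := by
    intro s hs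
    apply le_antisymm
    · rw [Submodule.span_le]
      rintro _ ⟨i, rfl⟩
      have : K i s = ∑ j, P s i j • N j s := by
        simp only [N, Finset.smul_sum, smul_smul]
        rw [Finset.sum_comm]
        simp only [← Finset.sum_smul, ← Matrix.mul_apply]
        rw [Matrix.mul_nonsing_inv (P s) (isUnit_iff_ne_zero.2 (hE s hs).2.2.2)]
        simp [Matrix.one_apply]
      simp only [this]
      exact sum_mem fun j _ => Submodule.smul_mem _ _ (Submodule.subset_span ⟨j, rfl⟩)
    · rw [Submodule.span_le]
      rintro _ ⟨i, rfl⟩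
      exact sum_mem fun j _ => Submodule.smul_mem _ _ (Submodule.subset_span ⟨j, rfl⟩)
  have hNd : ∀ s ∈ Metric.ball t₀ ε, ∀ i, DifferentiableAt ℝ (N i) s := fun s hs i =>
    DifferentiableAt.fun_sum fun j _ => (hinv s hs i j).smul ((hE s hs).1 j)
  have hN' : ∀ s ∈ Metric.ball t₀ ε, ∀ i, deriv (N i) s = 0 := by
    intro s hs i
    have h1 : deriv (N i) s ∈ Submodule.span ℝ (Set.range fun j => N j s) := by
      rw [← hspan s hs]
      have h2 : deriv (N i) s = ∑ j, ((P s)⁻¹ i j • deriv (K j) s +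
          deriv (fun s => (P s)⁻¹ i j) s • K j s) := by
        have h3 : deriv (N i) s = ∑ j, deriv (fun s => (P s)⁻¹ i j • K j s) s :=
          deriv_fun_sum fun j _ => DifferentiableAt.fun_smul (hinv s hs i j) ((hE s hs).1 j)
        rw [h3]
        exact Finset.sum_congr rfl fun j _ => deriv_fun_smul (hinv s hs i j) ((hE s hs).1 j)
      rw [h2]
      exact sum_mem fun j _ => add_mem (Submodule.smul_mem _ _ ((hE s hs).2.1 j))
        (Submodule.smul_mem _ _ (Submodule.subset_span ⟨j, rfl⟩))
    obtain ⟨c, hc⟩ := (Submodule.mem_span_range_iff_exists_fun ℝ).1 h1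
    have h3 : L (deriv (N i) s) = 0 := by
      have h4 := (L.hasFDerivAt.comp_hasDerivAt s (hNd s hs i).hasDerivAt).deriv
      rw [← h4]
      have h5 : (L ∘ N i) =ᶠ[𝓝 s] fun _ => Pi.single i 1 := by
        filter_upwards [Metric.isOpen_ball.mem_nhds hs] with r hr
        exact hLN r hr i
      rw [h5.deriv_eq, deriv_const]
    rw [← hc, map_sum] at h3
    simp only [map_smul, hLN s hs] at h3
    have h6 : ∀ k, c k = 0 := by
      intro k
      have := congrFun h3 k
      simpa [Finset.sum_apply, Pi.single_apply] using this
    rw [← hc]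
    simp [h6]
  have hconst : ∀ s ∈ Metric.ball t₀ ε, ∀ i, N i s = N i t₀ := fun s hs i =>
    Metric.isOpen_ball.is_const_of_deriv_eq_zero (convex_ball t₀ ε).isPreconnected
      (fun r hr => (hNd r hr i).differentiableWithinAt) (fun r hr => hN' r hr i) hs
      (Metric.mem_ball_self hε)
  filter_upwards [Metric.ball_mem_nhds t₀ hε] with s hs
  rw [hspan s hs, hspan t₀ (Metric.mem_ball_self hε)]
  simp only [hconst s hs]

/-- The chain rule along a curve. -/
lemma hasDerivAt_curve {n : ℕ} {M : Type*} [TopologicalSpace M]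
    [ChartedSpace (EuclideanSpace ℝ (Fin n)) M] {W : Type*} [NormedAddCommGroup W]
    [NormedSpace ℝ W] {F : M → W} {γ : ℝ → M} {s : ℝ} (hF : DiffAt n F (γ s))
    (hγ : MDifferentiableAt 𝓘(ℝ, ℝ) (𝓡 n) γ s) :
    HasDerivAt (fun t => F (γ t))
      (mvfderiv (𝓡 n) F (γ s) (mfderiv 𝓘(ℝ, ℝ) (𝓡 n) γ s (1 : ℝ))) s := by
  have h1 := hF.hasMFDerivAt.comp s hγ.hasMFDerivAt
  let D : ℝ →L[ℝ] W := (mfderiv (𝓡 n) 𝓘(ℝ, W) F (γ s)).comp (mfderiv 𝓘(ℝ, ℝ) (𝓡 n) γ s)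
  have h2 : HasMFDerivAt 𝓘(ℝ, ℝ) 𝓘(ℝ, W) (fun t => F (γ t)) s D := h1
  have h3 : HasFDerivAt (fun t => F (γ t)) D s := hasMFDerivAt_iff_hasFDerivAt.1 h2
  exact h3.hasDerivAt

namespace LightlikeHypersurface

variable {n : ℕ} {M : Type*} [TopologicalSpace M] [ChartedSpace (EuclideanSpace ℝ (Fin n)) M]
  {U : LightlikeHypersurface n M}

namespace Frame

variable {O : Set M} (𝔄 : U.Frame O) {p : M}

lemma isLift_An (hp : p ∈ O) (hx : ∀ q ∈ O, U.pt q = ℝ ∙ 𝔄.An q) : IsLift U.pt p 𝔄.An := by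
  filter_upwards [𝔄.eventually_mem hp] with q hq
  exact ⟨𝔄.smoothAt_An hq, 𝔄.An_ne hq, hx q hq⟩

lemma eq_zero_of_dAn (hp : p ∈ O) (hx : ∀ q ∈ O, U.pt q = ℝ ∙ 𝔄.An q) {v : TangentSpace (𝓡 n) p}
    (hv : mvfderiv (𝓡 n) 𝔄.An p v = 0) : v = 0 :=
  eq_zero_of_mvfderiv_mem (𝔄.isLift_An hp hx) (c := 0) (by rw [hv, zero_smul])

/-- The forms `ω_n^0`, `ω_n^i` are a coframe when `A_n = x`. -/
lemma eq_zero_of_coframe (hn : 2 ≤ n) (hp : p ∈ O) (hx : ∀ q ∈ O, U.pt q = ℝ ∙ 𝔄.An q)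
    {v : TangentSpace (𝓡 n) p} (h0 : 𝔄.wn0 p v = 0) (hi : ∀ i, 𝔄.wni p i v = 0) : v = 0 :=
  𝔄.eq_zero_of_dAn hp hx (by rw [𝔄.dAn_eq hn hp, h0]; simp [hi])

/-- The coordinates `ω_n^i`, as a linear map. -/
def wniL (p : M) : TangentSpace (𝓡 n) p →ₗ[ℝ] (Fin (n - 1) → ℝ) :=
  LinearMap.pi fun i => 𝔄.coordL p i ∘ₗ (mvfderiv (𝓡 n) 𝔄.An p).toLinearMap

/-- The coordinates `ω_0^i`, as a linear map. -/
def w0iL (p : M) : TangentSpace (𝓡 n) p →ₗ[ℝ] (Fin (n - 1) → ℝ) :=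
  LinearMap.pi fun i => 𝔄.coordL p i ∘ₗ (mvfderiv (𝓡 n) 𝔄.A0 p).toLinearMap

/-- The coordinate `ω_n^0`, as a linear map. -/
def wn0L (p : M) : TangentSpace (𝓡 n) p →ₗ[ℝ] ℝ where
  toFun := 𝔄.wn0 p
  map_add' u v := by simp only [wn0, map_add, coord0_add]
  map_smul' c v := by simp only [wn0, map_smul, coord0_smul, smul_eq_mul, RingHom.id_apply]

lemma wniL_apply (i) (v : TangentSpace (𝓡 n) p) : 𝔄.wniL p v i = 𝔄.wni p i v := rfl
lemma w0iL_apply (i) (v : TangentSpace (𝓡 n) p) : 𝔄.w0iL p v i = 𝔄.w0i p i v := rfl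
lemma wn0L_apply (v : TangentSpace (𝓡 n) p) : 𝔄.wn0L p v = 𝔄.wn0 p v := rfl

lemma finrank_tangent (p : M) : finrank ℝ (TangentSpace (𝓡 n) p) = n := finrank_euclideanSpace_fin

instance (p : M) : FiniteDimensional ℝ (TangentSpace (𝓡 n) p) :=
  inferInstanceAs (FiniteDimensional ℝ (EuclideanSpace ℝ (Fin n)))

/-- There are `n - 1` forms `ω_0^i` on an `n`-dimensional space, so they have a common zero. -/
lemma exists_isotropic (hn : 2 ≤ n) (p : M) :
    ∃ v : TangentSpace (𝓡 n) p, v ≠ 0 ∧ ∀ i, 𝔄.w0i p i v = 0 := by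
  have h : LinearMap.ker (𝔄.w0iL p) ≠ ⊥ := by
    apply LinearMap.ker_ne_bot_of_finrank_lt
    rw [finrank_tangent, finrank_fin_fun]
    omega
  obtain ⟨v, hv, hv0⟩ := Submodule.exists_mem_ne_zero_of_ne_bot h
  exact ⟨v, hv0, fun i => congrFun (LinearMap.mem_ker.1 hv) i⟩

variable [IsManifold (𝓡 n) ∞ M]

/-- The point `A₀` does not move, to the first order, along the generators. -/
lemma w0i_eq_zero_of_wni (hn : 2 ≤ n) (hp : p ∈ O) (hV : finrank ℝ (U.tangentV p) = n)
    (hx : ∀ q ∈ O, U.pt q = ℝ ∙ 𝔄.An q) {v : TangentSpace (𝓡 n) p} (hv : ∀ i, 𝔄.wni p i v = 0)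
    (i) : 𝔄.w0i p i v = 0 := by
  obtain ⟨w, hw0, hw⟩ := 𝔄.exists_isotropic hn p
  have h1 : ∀ j, 𝔄.wni p j w = 0 := by
    intro j
    have : ∀ k, form n (mvfderiv (𝓡 n) 𝔄.An p w) (𝔄.A k p) = 0 := by
      intro k
      have h2 := 𝔄.win_spec hn hp hV k w
      rw [𝔄.win_eq hp] at h2
      simpa [hw] using h2
    simp [wni, coord, this]
  have h2 : 𝔄.wn0 p w ≠ 0 := fun h => hw0 (𝔄.eq_zero_of_coframe hn hp hx h h1)
  -- the common kernel of the `ω_n^i` is one-dimensional, hence spanned by `w`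
  have h3 : v - (𝔄.wn0 p v / 𝔄.wn0 p w) • w = 0 := by
    refine 𝔄.eq_zero_of_coframe hn hp hx ?_ fun j => ?_
    · rw [← wn0L_apply, map_sub, map_smul, wn0L_apply, wn0L_apply, smul_eq_mul,
        div_mul_cancel₀ _ h2, sub_self]
    · rw [← wniL_apply, map_sub, map_smul, Pi.sub_apply, Pi.smul_apply, wniL_apply, wniL_apply,
        hv, h1]
      simp
  rw [sub_eq_zero.1 h3, ← w0iL_apply, map_smul, Pi.smul_apply, w0iL_apply, hw, smul_zero]

/-- Reduced frames have `ω_i^0 = 0` along the generators. -/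
lemma wi0_eq_zero (hn : 2 ≤ n) (hV : ∀ q ∈ O, finrank ℝ (U.tangentV q) = n) (hp : p ∈ O)
    (hz : ∀ q ∈ O, U.zeta q = Submodule.span ℝ (Set.range fun i => 𝔄.A i q))
    {v : TangentSpace (𝓡 n) p} (hv : ∀ i, 𝔄.w0i p i v = 0) (i) : 𝔄.wi0 p i v = 0 := by
  have hC := 𝔄.smoothAt_C hn hV hp
  have hI := (𝔄.smoothAt_Ainf hp).diffAt
  have h0 : ∀ q ∈ O, ∀ w, form n (mvfderiv (𝓡 n) 𝔄.C q w) (𝔄.Ainf q) = 0 := by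
    intro q hq w
    have h1 : mvfderiv (𝓡 n) 𝔄.C q w ∈ U.zeta q := by
      rw [𝔄.zeta_eq_range hn hV hq]
      exact ⟨w, rfl⟩
    rw [hz q hq] at h1
    obtain ⟨c, hc⟩ := (Submodule.mem_span_range_iff_exists_fun ℝ).1 h1
    rw [← hc]
    simp [𝔄.gram_i_inf q hq]
  -- the second differential of `C` gives the symmetry of `(dC(u), dA_{n+1}(v))` in `u` and `v`, and
  -- `dC(v) = 0` for the isotropic vector `v`
  have h1 : ∀ u v : TangentSpace (𝓡 n) p,
      form n (mvfderiv (𝓡 n) (fun q => mvfderiv (𝓡 n) 𝔄.C q (tangentField p u q)) p v) (𝔄.Ainf p) =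
        - form n (mvfderiv (𝓡 n) 𝔄.C p u) (mvfderiv (𝓡 n) 𝔄.Ainf p v) := by
    intro u v
    have := form_mvfderiv_of_const (F := fun q => mvfderiv (𝓡 n) 𝔄.C q (tangentField p u q))
      (hC.tangentDeriv u).diffAt hI
      ((𝔄.eventually_mem hp).mono fun q hq => h0 q hq _) v
    rw [this, tangentField_self]
  have h2 : ∀ u, form n (mvfderiv (𝓡 n) 𝔄.C p u) (mvfderiv (𝓡 n) 𝔄.Ainf p v) = 0 := by
    intro u
    have h3 := h1 u v
    rw [hC.tangentDeriv_comm, h1 v u, 𝔄.dC_eq hn hV hp v] at h3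
    simpa [hv] using h3
  have h3 : 𝔄.A i p ∈ U.zeta p := by
    rw [hz p hp]; exact Submodule.subset_span ⟨i, rfl⟩
  rw [𝔄.zeta_eq_range hn hV hp] at h3
  obtain ⟨u, hu⟩ := h3
  have h4 := h2 u
  rw [show mvfderiv (𝓡 n) 𝔄.C p u = 𝔄.A i p from hu] at h4
  rw [wi0, coord0, form_mvfderiv_of_const (𝔄.smoothAt_A hp i).diffAt hI
    ((𝔄.eventually_mem hp).mono fun q hq => 𝔄.gram_i_inf q hq i), h4]
  simp

/-- Along the generators the `A_i` of a reduced frame move in their own span, because all the other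
components of `dA_i` vanish there. -/
lemma dA_mem_span (hn : 2 ≤ n) (hV : ∀ q ∈ O, finrank ℝ (U.tangentV q) = n) (hp : p ∈ O)
    (hred : 𝔄.Reduced U.zeta) {v : TangentSpace (𝓡 n) p} (hv : ∀ i, 𝔄.wni p i v = 0) (i) :
    mvfderiv (𝓡 n) (𝔄.A i) p v ∈ Submodule.span ℝ (Set.range fun i => 𝔄.A i p) := by
  have h0 := 𝔄.w0i_eq_zero_of_wni hn hp (hV p hp) hred.1 hv
  rw [𝔄.expand hn hp (mvfderiv (𝓡 n) (𝔄.A i) p v)]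
  have h1 : 𝔄.coord0 p (mvfderiv (𝓡 n) (𝔄.A i) p v) = 0 := 𝔄.wi0_eq_zero hn hV hp hred.2 h0 i
  have h2 : form n (mvfderiv (𝓡 n) (𝔄.A i) p v) (𝔄.An p) = 0 := by
    have := 𝔄.win_spec hn hp (hV p hp) i v
    simp only [h0, mul_zero, Finset.sum_const_zero] at this
    exact this
  have h3 : form n (mvfderiv (𝓡 n) (𝔄.A i) p v) (𝔄.A0 p) = 0 := by
    rw [𝔄.dA_A0 hp, 𝔄.form_dA0_A hn hp]
    simp [h0]
  rw [h1, h2, h3, zero_smul, zero_smul, neg_zero, zero_smul, zero_add, add_zero, add_zero]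
  exact sum_mem fun j _ => Submodule.smul_mem _ _ (Submodule.subset_span ⟨j, rfl⟩)

/-- A curve along which `x` stays on the generator of `p₀` is tangent to the isotropic
directions. -/
lemma wni_eq_zero_of_curve {O₀ : Set M} (𝔅 : U.Frame O₀) {p₀ : M} (hp₀ : p₀ ∈ O₀)
    (hx : ∀ q ∈ O, U.pt q = ℝ ∙ 𝔄.An q) {γ : ℝ → M}
    (hγ : ContMDiff 𝓘(ℝ, ℝ) (𝓡 n) ∞ γ) (hγx : ∀ t, U.pt (γ t) ≤ U.generator p₀) {s : ℝ}
    (hs : γ s ∈ O) (i) : 𝔄.wni (γ s) i (mfderiv 𝓘(ℝ, ℝ) (𝓡 n) γ s (1 : ℝ)) = 0 := by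
  set v := mfderiv 𝓘(ℝ, ℝ) (𝓡 n) γ s (1 : ℝ) with hv
  -- `T` vanishes exactly on the generator of `p₀`, so `T x` vanishes along the curve
  let T : Amb n →L[ℝ] Amb n := ContinuousLinearMap.id ℝ (Amb n)
    - ((formL n) (𝔅.An p₀)).smulRight (𝔅.An p₀) + ((formL n) (𝔅.Ainf p₀)).smulRight (𝔅.A0 p₀)
  have hT : ∀ w, T w = w - form n (𝔅.An p₀) w • 𝔅.An p₀ + form n (𝔅.Ainf p₀) w • 𝔅.A0 p₀ := by
    intro w
    simp [T, formL_apply]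
  have s3 : form n (𝔅.An p₀) (𝔅.A0 p₀) = 0 := by rw [form_comm]; exact 𝔅.gram_0_n p₀ hp₀
  have s4 : form n (𝔅.Ainf p₀) (𝔅.A0 p₀) = -1 := by rw [form_comm]; exact 𝔅.gram_0_inf p₀ hp₀
  have s5 : form n (𝔅.Ainf p₀) (𝔅.An p₀) = 0 := by rw [form_comm]; exact 𝔅.gram_n_inf p₀ hp₀
  have hgen : ∀ t, γ t ∈ O → ∃ α β : ℝ, α • 𝔅.An p₀ + β • 𝔅.A0 p₀ = 𝔄.An (γ t) := by
    intro t ht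
    have h1 := hγx t
    rw [hx _ ht, 𝔅.generator_eq hp₀] at h1
    exact Submodule.mem_span_pair.1 (h1 (Submodule.mem_span_singleton_self _))
  have hTA : ∀ t, γ t ∈ O → T (𝔄.An (γ t)) = 0 := by
    intro t ht
    obtain ⟨α, β, h⟩ := hgen t ht
    rw [hT, ← h]
    simp [s3, s4, s5, 𝔅.gram_n_n p₀ hp₀]
  have hAn := (𝔄.smoothAt_An hs).diffAt
  have hγs : MDifferentiableAt 𝓘(ℝ, ℝ) (𝓡 n) γ s := (hγ s).mdifferentiableAt (by simp)
  have hTx : T (mvfderiv (𝓡 n) 𝔄.An (γ s) v) = 0 := by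
    rw [← mvfderiv_clm T hAn, hv]
    have hd : MDifferentiableAt (𝓡 n) 𝓘(ℝ, Amb n) (fun q => T (𝔄.An q)) (γ s) :=
      T.mdifferentiableAt.comp _ hAn
    rw [← (hasDerivAt_curve hd hγs).deriv]
    have h1 : (fun t => T (𝔄.An (γ t))) =ᶠ[𝓝 s] fun _ => 0 := by
      filter_upwards [hγ.continuous.continuousAt.eventually (𝔄.eventually_mem hs)] with t ht
      exact hTA t ht
    rw [h1.deriv_eq, deriv_const]
  obtain ⟨α, β, hαβ⟩ := hgen s hs
  set w := mvfderiv (𝓡 n) 𝔄.An (γ s) v with hw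
  have hw1 : w = form n (𝔅.An p₀) w • 𝔅.An p₀ - form n (𝔅.Ainf p₀) w • 𝔅.A0 p₀ := by
    rw [hT] at hTx
    rw [← sub_eq_zero, ← hTx]
    abel
  have hα : α * α = 1 := by
    have := 𝔄.gram_n_n _ hs
    rw [← hαβ] at this
    simpa [s3, 𝔅.gram_0_n p₀ hp₀, 𝔅.gram_n_n p₀ hp₀, 𝔅.gram_0_0 p₀ hp₀] using this
  have h0 : form n (𝔅.An p₀) w = 0 := by
    have h1 := 𝔄.dAn_An hs v
    rw [← hw, hw1, ← hαβ] at h1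
    simp [s3, 𝔅.gram_0_n p₀ hp₀, 𝔅.gram_n_n p₀ hp₀, 𝔅.gram_0_0 p₀ hp₀] at h1
    rcases h1 with h1 | h1
    · exact h1
    · rw [h1] at hα; simp at hα
  rw [h0, zero_smul, zero_sub] at hw1
  have h2 := 𝔄.dAn_A0 hs v
  rw [← hw, hw1, map_neg, LinearMap.neg_apply, map_smul, LinearMap.smul_apply, smul_eq_mul,
    neg_eq_zero, mul_eq_zero] at h2
  -- `w` is a multiple of `A₀(p₀)` orthogonal to `A₀(γ s)`: either `w` vanishes, or these isotropic
  -- points coincide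
  have hmul : ∃ c : ℝ, w = c • 𝔄.A0 (γ s) := by
    rcases h2 with h2 | h2
    · exact ⟨0, by rw [hw1, h2]; simp⟩
    · obtain ⟨c, hc⟩ := isotropic_orthogonal (𝔅.gram_0_0 p₀ hp₀) (𝔄.gram_0_0 _ hs) h2 (𝔄.A0_ne hs)
      exact ⟨-(form n (𝔅.Ainf p₀) w * c), by rw [neg_smul, mul_smul, ← hc, ← hw1]⟩
  obtain ⟨c, hc⟩ := hmul
  rw [wni, ← hw, hc, coord_smul, 𝔄.coord_A0 hs, mul_zero]

end Frame

variable [IsManifold (𝓡 n) ∞ M]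

/-- The subspaces `ζ` are constant along the generators. -/
lemma zeta_const (hn : 2 ≤ n) (hV : ∀ q, finrank ℝ (U.tangentV q) = n)
    (hred : ∀ p, ∃ (O : Set M) (𝔄 : U.Frame O), p ∈ O ∧ 𝔄.Reduced U.zeta) {γ : ℝ → M}
    (hγ : ContMDiff 𝓘(ℝ, ℝ) (𝓡 n) ∞ γ) (hγx : ∀ t, U.pt (γ t) ≤ U.generator (γ 0)) (t : ℝ) :
    U.zeta (γ t) = U.zeta (γ 0) := by
  -- a locally constant function on the connected line is constant
  have hloc : IsLocallyConstant fun t => U.zeta (γ t) := by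
    rw [IsLocallyConstant.iff_eventually_eq]
    intro t₀
    obtain ⟨O, 𝔄, hp, hr⟩ := hred (γ t₀)
    obtain ⟨O₀, 𝔅, hp₀, -⟩ := hred (γ 0)
    have hO : ∀ᶠ s in 𝓝 t₀, γ s ∈ O :=
      hγ.continuous.continuousAt.eventually (𝔄.eventually_mem hp)
    have hd : ∀ s, γ s ∈ O → ∀ i, HasDerivAt (fun s => 𝔄.A i (γ s))
        (mvfderiv (𝓡 n) (𝔄.A i) (γ s) (mfderiv 𝓘(ℝ, ℝ) (𝓡 n) γ s (1 : ℝ))) s := by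
      exact fun s hs i => hasDerivAt_curve (𝔄.smoothAt_A hs i).diffAt
        ((hγ s).mdifferentiableAt (by simp))
    have h := eventually_span_eq (K := fun i s => 𝔄.A i (γ s)) (t₀ := t₀)
      (hO.mono fun s hs i => (hd s hs i).differentiableAt) (𝔄.indep _ hp)
      (hO.mono fun s hs i => by
        rw [(hd s hs i).deriv]
        exact 𝔄.dA_mem_span hn (fun q _ => hV q) hs hr
          (𝔄.wni_eq_zero_of_curve 𝔅 hp₀ hr.1 hγ hγx hs) i)
    filter_upwards [h, hO] with s hs hsO
    rw [hr.2 _ hsO, hr.2 _ hp]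
    exact hs
  exact hloc.apply_eq_of_preconnectedSpace t 0

/-- The tensor `a` is nondegenerate in all frames as soon as it is in one frame at each point. -/
lemma det_a_ne_zero (hn : 2 ≤ n) (hU : U.MaximalRank) (ha : U.Nondegenerate) {O : Set M}
    (𝔄 : U.Frame O) {p : M} (hp : p ∈ O) : (𝔄.a p).det ≠ 0 := by
  obtain ⟨O', 𝔅, hp', h⟩ := ha p
  exact 𝔅.det_a_change 𝔄 hn hp' hp (fun q _ => hU q) (fun q _ => hU q) h

lemma exists_reduced_of_lift (hn : 2 ≤ n) (hU : U.MaximalRank) (ha : U.Nondegenerate) {p : M}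
    {f : M → Amb n} (hf : IsLift U.pt p f) (hf1 : ∀ᶠ q in 𝓝 p, form n (f q) (f q) = 1) :
    ∃ (O : Set M) (𝔄 : U.Frame O), p ∈ O ∧ 𝔄.An = f ∧ 𝔄.Reduced U.zeta := by
  obtain ⟨O, 𝔄, hp, -⟩ := ha p
  exact 𝔄.exists_reduced hn (fun q _ => hU q) hp
    (fun q hq => det_a_ne_zero hn hU ha 𝔄 hq) hf hf1

lemma exists_reduced (hn : 2 ≤ n) (hU : U.MaximalRank) (ha : U.Nondegenerate) (p : M) :
    ∃ (O : Set M) (𝔄 : U.Frame O), p ∈ O ∧ 𝔄.Reduced U.zeta := by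
  obtain ⟨f, hf, hf1⟩ := U.exists_unit_lift p
  obtain ⟨O, 𝔄, hp, -, h⟩ := exists_reduced_of_lift hn hU ha hf hf1
  exact ⟨O, 𝔄, hp, h⟩

lemma isNormalization_zeta (hn : 2 ≤ n) (hU : U.MaximalRank) (ha : U.Nondegenerate) :
    U.IsNormalization U.zeta where
  le_tangentV p := by
    obtain ⟨O, 𝔄, hp, -⟩ := ha p
    rw [𝔄.zeta_eq_inf hn (fun q _ => hU q) hp]
    exact inf_le_left
  finrank_eq p := by
    obtain ⟨O, 𝔄, hp, -⟩ := ha p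
    rw [𝔄.zeta_eq hn (fun q _ => hU q) hp, 𝔄.finrank_span_Ci hn hp (det_a_ne_zero hn hU ha 𝔄 hp)]
  not_mem p := by
    obtain ⟨O, 𝔄, hp, h⟩ := exists_reduced hn hU ha p
    rw [h.2 p hp, 𝔄.tangency_eq hp, eq_bot_iff]
    rintro w ⟨h1, h2⟩
    obtain ⟨c, rfl⟩ := Submodule.mem_span_singleton.1 h2
    obtain ⟨d, hd⟩ := (Submodule.mem_span_range_iff_exists_fun ℝ).1 h1
    have h3 := congrArg (fun w => form n w (𝔄.Ainf p)) hd
    simp [𝔄.gram_i_inf p hp, 𝔄.gram_0_inf p hp] at h3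
    simp [h3]
  smooth p := exists_reduced hn hU ha p
  const γ hγ hγx t := zeta_const hn hU (exists_reduced hn hU ha) hγ hγx t

end LightlikeHypersurface
end DeSitter

end


/-! ### The induced affine connection -/

noncomputable section
namespace DeSitter
namespace LightlikeHypersurface

variable {n : ℕ} {M : Type*} [TopologicalSpace M] [ChartedSpace (EuclideanSpace ℝ (Fin n)) M]
  {U : LightlikeHypersurface n M}

namespace Frame

variable {O : Set M} (𝔄 : U.Frame O) {p : M}

/-- The coordinates on `A₀` and the `A_i`, together. -/
def tangentCoords (p : M) : Amb n →ₗ[ℝ] ℝ × (Fin (n - 1) → ℝ) where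
  toFun w := (𝔄.coord0 p w, fun i => 𝔄.coord p i w)
  map_add' w w' := by ext <;> simp [coord0_add, coord_add]
  map_smul' c w := by ext <;> simp [coord0_smul, coord_smul]

lemma tangentCoords_apply (w : Amb n) :
    𝔄.tangentCoords p w = (𝔄.coord0 p w, fun i => 𝔄.coord p i w) := rfl

lemma tangentCoords_eq_zero_iff (hn : 2 ≤ n) (hp : p ∈ O) {w : Amb n} :
    𝔄.tangentCoords p w = 0 ↔
      form n w (𝔄.Ainf p) = 0 ∧ ∀ i, form n w (𝔄.A i p) = 0 := by
  rw [tangentCoords_apply, Prod.mk_eq_zero, funext_iff]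
  refine and_congr (by simp [coord0]) ⟨fun h i => ?_, fun h i => ?_⟩
  · rw [← 𝔄.sum_coord_g hn hp]
    exact Finset.sum_eq_zero fun k _ => by rw [h k]; simp
  · simp [coord, h]

/-- The coframe `ω_n^0`, `ω_n^i`, as a linear map. -/
def coframe (p : M) : TangentSpace (𝓡 n) p →ₗ[ℝ] ℝ × (Fin (n - 1) → ℝ) :=
  𝔄.tangentCoords p ∘ₗ (mvfderiv (𝓡 n) 𝔄.An p).toLinearMap

lemma coframe_apply (v : TangentSpace (𝓡 n) p) :
    𝔄.coframe p v = (𝔄.wn0 p v, fun i => 𝔄.wni p i v) := rfl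

lemma coframe_injective (hn : 2 ≤ n) (hp : p ∈ O) (hx : ∀ q ∈ O, U.pt q = ℝ ∙ 𝔄.An q) :
    Function.Injective (𝔄.coframe p) := by
  rw [← LinearMap.ker_eq_bot, LinearMap.ker_eq_bot']
  intro v hv
  rw [coframe_apply, Prod.mk_eq_zero] at hv
  exact 𝔄.eq_zero_of_coframe hn hp hx hv.1 fun i => congrFun hv.2 i

/-- The coframe `ω_n^0`, `ω_n^i`, as an isomorphism. -/
def coframeEquiv (hn : 2 ≤ n) (hp : p ∈ O) (hx : ∀ q ∈ O, U.pt q = ℝ ∙ 𝔄.An q) :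
    TangentSpace (𝓡 n) p ≃ₗ[ℝ] ℝ × (Fin (n - 1) → ℝ) :=
  LinearEquiv.ofInjectiveOfFinrankEq (𝔄.coframe p) (𝔄.coframe_injective hn hp hx) (by
    rw [finrank_tangent, Module.finrank_prod, finrank_fin_fun, Module.finrank_self]
    omega)

/-- A tangent vector is determined by the position of `dA_n(v)` relative to the vertices
`A_{n+1}` and `A_i`. -/
lemma eq_of_tangentCoords (hn : 2 ≤ n) (hp : p ∈ O) (hx : ∀ q ∈ O, U.pt q = ℝ ∙ 𝔄.An q)
    {u v : TangentSpace (𝓡 n) p} (h : 𝔄.tangentCoords p (mvfderiv (𝓡 n) 𝔄.An p u) =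
      𝔄.tangentCoords p (mvfderiv (𝓡 n) 𝔄.An p v)) : u = v :=
  𝔄.coframe_injective hn hp hx h

section Change

variable {O' : Set M} (𝔅 : U.Frame O')

/-- Two frames with the same points `A₀`, `A_n` and the same span of the `A_i` define the same
space `A_n ∧ A_{n+1}`, transversal to the `A₀, A_i`. -/
lemma tangentCoords_change {U' : LightlikeHypersurface n M} {O' : Set M} (𝔅 : U'.Frame O')
    (hn : 2 ≤ n) (hp : p ∈ O) (hp' : p ∈ O') {c : ℝ} (h0 : 𝔅.A0 p = c • 𝔄.A0 p)
    (hx : 𝔄.An p ∈ ℝ ∙ 𝔅.An p) (hz : Submodule.span ℝ (Set.range fun i => 𝔄.A i p) =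
      Submodule.span ℝ (Set.range fun i => 𝔅.A i p)) {w : Amb n}
    (hw : 𝔄.tangentCoords p w = 0) : 𝔅.tangentCoords p w = 0 := by
  rw [tangentCoords_eq_zero_iff _ hn hp] at hw
  rw [tangentCoords_eq_zero_iff _ hn hp']
  have hζ : ∀ z ∈ Submodule.span ℝ (Set.range fun i => 𝔄.A i p), form n w z = 0 := by
    intro z hz
    obtain ⟨c, hc⟩ := (Submodule.mem_span_range_iff_exists_fun ℝ).1 hz
    rw [← hc]
    simp [hw.2]
  refine ⟨?_, fun i => hζ _ (by rw [hz]; exact Submodule.subset_span ⟨i, rfl⟩)⟩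
  have h1 : ∀ i, form n (𝔅.Ainf p) (𝔄.A i p) = 0 := by
    intro i
    have : 𝔄.A i p ∈ Submodule.span ℝ (Set.range fun i => 𝔅.A i p) := by
      rw [← hz]; exact Submodule.subset_span ⟨i, rfl⟩
    obtain ⟨c, hc⟩ := (Submodule.mem_span_range_iff_exists_fun ℝ).1 this
    have s : ∀ i, form n (𝔅.Ainf p) (𝔅.A i p) = 0 := fun i => by
      rw [form_comm]; exact 𝔅.gram_i_inf p hp' i
    rw [← hc]
    simp [s]
  have h2 : form n (𝔅.Ainf p) (𝔄.An p) = 0 := by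
    obtain ⟨c, hc⟩ := Submodule.mem_span_singleton.1 hx
    have s : form n (𝔅.Ainf p) (𝔅.An p) = 0 := by rw [form_comm]; exact 𝔅.gram_n_inf p hp'
    rw [← hc]
    simp [s]
  -- the vertex `A_{n+1}` of the second frame lies on the line `A₀ ∧ A_{n+1}` of the first; it is
  -- isotropic and not orthogonal to `A₀`, so it is a multiple of the vertex `A_{n+1}` of the first
  have h3 := 𝔄.expand hn hp (𝔅.Ainf p)
  have h4 : ∀ i, 𝔄.coord p i (𝔅.Ainf p) = 0 := fun i => by simp [coord, h1]
  simp only [h2, h4, zero_smul, Finset.sum_const_zero, add_zero] at h3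
  set s := 𝔄.coord0 p (𝔅.Ainf p)
  set t := -form n (𝔅.Ainf p) (𝔄.A0 p) with ht
  have ht0 : t ≠ 0 := by
    intro h5
    have h6 := 𝔅.gram_0_inf p hp'
    rw [h0, form_comm, map_smul, smul_eq_mul, ← neg_neg (form n (𝔅.Ainf p) (𝔄.A0 p)), ← ht,
      h5] at h6
    simp at h6
  have hs : s = 0 := by
    have h5 := 𝔅.gram_inf_inf p hp'
    have s4 : form n (𝔄.Ainf p) (𝔄.A0 p) = -1 := by rw [form_comm]; exact 𝔄.gram_0_inf p hp
    rw [h3] at h5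
    simp [𝔄.gram_0_0 p hp, 𝔄.gram_0_inf p hp, 𝔄.gram_inf_inf p hp, s4] at h5
    have : 2 * (s * t) = 0 := by linarith
    simpa [ht0] using this
  rw [h3, hs, zero_smul, zero_add, map_smul, hw.1, smul_zero]

/-- Two unit lifts of `x` differ by the sign `(A_n′, A_n)`. -/
lemma An_eq_smul (hp : p ∈ O) (hp' : p ∈ O') (hx : ∀ q ∈ O, U.pt q = ℝ ∙ 𝔄.An q)
    (hx' : ∀ q ∈ O', U.pt q = ℝ ∙ 𝔅.An q) :
    𝔅.An p = form n (𝔅.An p) (𝔄.An p) • 𝔄.An p := by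
  have : 𝔅.An p ∈ U.pt p := by rw [hx' p hp']; exact Submodule.mem_span_singleton_self _
  rw [hx p hp] at this
  obtain ⟨c, hc⟩ := Submodule.mem_span_singleton.1 this
  rw [← hc]
  simp [𝔄.gram_n_n p hp]

/-- The square of `(A_n′, A_n)` is `1`, so this function is locally constant. -/
lemma mvfderiv_form_An_An (hp : p ∈ O) (hp' : p ∈ O') (v : TangentSpace (𝓡 n) p) :
    mvfderiv (𝓡 n) (fun q => form n (𝔅.An q) (𝔄.An q)) p v = 0 := by
  have hs := ((𝔅.smoothAt_An hp').form (𝔄.smoothAt_An hp)).diffAt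
  have hc : ∀ᶠ q in 𝓝 p, form n (𝔅.An q) (𝔄.An q) • form n (𝔅.An q) (𝔄.An q) = 1 := by
    filter_upwards [𝔄.eventually_mem hp, 𝔅.eventually_mem hp'] with q hq hq'
    exact (𝔄.An_change 𝔅 hq hq').2
  have h0 := mvfderiv_eq_zero_of_eventually_const hc v
  rw [mvfderiv_smul_apply hs hs] at h0
  have hne := 𝔄.form_An_An_ne 𝔅 hp hp'
  simp only [smul_eq_mul] at h0
  have : 2 * (form n (𝔅.An p) (𝔄.An p) *
      mvfderiv (𝓡 n) (fun q => form n (𝔅.An q) (𝔄.An q)) p v) = 0 := by linarith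
  simpa [hne] using this

lemma dAn_eq_smul (hp : p ∈ O) (hp' : p ∈ O') (hx : ∀ q ∈ O, U.pt q = ℝ ∙ 𝔄.An q)
    (hx' : ∀ q ∈ O', U.pt q = ℝ ∙ 𝔅.An q) (v : TangentSpace (𝓡 n) p) :
    mvfderiv (𝓡 n) 𝔅.An p v = form n (𝔅.An p) (𝔄.An p) • mvfderiv (𝓡 n) 𝔄.An p v := by
  have hev : 𝔅.An =ᶠ[𝓝 p] fun q => form n (𝔅.An q) (𝔄.An q) • 𝔄.An q := by
    filter_upwards [𝔄.eventually_mem hp, 𝔅.eventually_mem hp'] with q hq hq'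
    exact 𝔄.An_eq_smul 𝔅 hq hq' hx hx'
  have hs := ((𝔅.smoothAt_An hp').form (𝔄.smoothAt_An hp)).diffAt
  rw [mvfderiv_congr hev, mvfderiv_smul_apply hs (𝔄.smoothAt_An hp).diffAt,
    𝔄.mvfderiv_form_An_An 𝔅 hp hp', zero_smul, zero_add]

end Change

variable [IsManifold (𝓡 n) ∞ M]

/-- The second derivative of `A_n = x`, along the vector field `Y` and the vector `v`. -/
def secondDeriv (Y : (q : M) → TangentSpace (𝓡 n) q) (p : M) :
    TangentSpace (𝓡 n) p →L[ℝ] Amb n :=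
  mvfderiv (𝓡 n) (fun q => mvfderiv (𝓡 n) 𝔄.An q (Y q)) p

lemma secondDeriv_change {O' : Set M} (𝔅 : U.Frame O') (hp : p ∈ O) (hp' : p ∈ O')
    (hx : ∀ q ∈ O, U.pt q = ℝ ∙ 𝔄.An q) (hx' : ∀ q ∈ O', U.pt q = ℝ ∙ 𝔅.An q)
    {Y : (q : M) → TangentSpace (𝓡 n) q} (hY : FieldDiffAt Y p) (v : TangentSpace (𝓡 n) p) :
    𝔅.secondDeriv Y p v = form n (𝔅.An p) (𝔄.An p) • 𝔄.secondDeriv Y p v := by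
  have hev : (fun q => mvfderiv (𝓡 n) 𝔅.An q (Y q)) =ᶠ[𝓝 p]
      fun q => form n (𝔅.An q) (𝔄.An q) • mvfderiv (𝓡 n) 𝔄.An q (Y q) := by
    filter_upwards [𝔄.eventually_mem hp, 𝔅.eventually_mem hp'] with q hq hq'
    exact 𝔄.dAn_eq_smul 𝔅 hq hq' hx hx' _
  have hs := ((𝔅.smoothAt_An hp').form (𝔄.smoothAt_An hp)).diffAt
  rw [secondDeriv, mvfderiv_congr hev,
    mvfderiv_smul_apply hs ((𝔄.smoothAt_An hp).diffAt_field hY),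
    𝔄.mvfderiv_form_An_An 𝔅 hp hp', zero_smul, zero_add]
  rfl

lemma diffAt_wn0 (hp : p ∈ O) {Y : (q : M) → TangentSpace (𝓡 n) q} (hY : FieldDiffAt Y p) :
    DiffAt n (fun q => 𝔄.wn0 q (Y q)) p :=
  (((𝔄.smoothAt_An hp).diffAt_field hY).form (𝔄.smoothAt_Ainf hp).diffAt).neg

lemma diffAt_wni (hn : 2 ≤ n) (hp : p ∈ O) {Y : (q : M) → TangentSpace (𝓡 n) q}
    (hY : FieldDiffAt Y p) (i) : DiffAt n (fun q => 𝔄.wni q i (Y q)) p := by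
  unfold wni coord
  exact DiffAt.sum fun j _ => DiffAt.smul (𝔄.smoothAt_ginv hn hp i j).diffAt
    (((𝔄.smoothAt_An hp).diffAt_field hY).form (𝔄.smoothAt_A hp j).diffAt)

lemma secondDeriv_eq (hn : 2 ≤ n) (hp : p ∈ O) {Y : (q : M) → TangentSpace (𝓡 n) q}
    (hY : FieldDiffAt Y p) (v : TangentSpace (𝓡 n) p) :
    𝔄.secondDeriv Y p v =
      (mvfderiv (𝓡 n) (fun q => 𝔄.wn0 q (Y q)) p v • 𝔄.A0 p +
        𝔄.wn0 p (Y p) • mvfderiv (𝓡 n) 𝔄.A0 p v) +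
      ∑ j, (mvfderiv (𝓡 n) (fun q => 𝔄.wni q j (Y q)) p v • 𝔄.A j p +
        𝔄.wni p j (Y p) • mvfderiv (𝓡 n) (𝔄.A j) p v) := by
  have hev : (fun q => mvfderiv (𝓡 n) 𝔄.An q (Y q)) =ᶠ[𝓝 p]
      fun q => 𝔄.wn0 q (Y q) • 𝔄.A0 q + ∑ j, 𝔄.wni q j (Y q) • 𝔄.A j q :=
    (𝔄.eventually_mem hp).mono fun q hq => 𝔄.dAn_eq hn hq (Y q)
  have h0 := (𝔄.smoothAt_A0 hp).diffAt
  have hA := fun j => (𝔄.smoothAt_A hp j).diffAt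
  have d0 := 𝔄.diffAt_wn0 hp hY
  have di := 𝔄.diffAt_wni hn hp hY
  rw [secondDeriv, mvfderiv_congr hev, ← mvfderiv_smul_apply d0 h0]
  simp only [← mvfderiv_smul_apply (di _) (hA _)]
  rw [← mvfderiv_finsum fun j _ => DiffAt.smul (di j) (hA j)]
  have h1 := mvfderiv_fun_add (DiffAt.smul d0 h0)
    (DiffAt.sum (s := Finset.univ) fun j _ => DiffAt.smul (di j) (hA j))
  exact congrArg (fun T : TangentSpace (𝓡 n) p →L[ℝ] Amb n => T v) h1

/-- The component of the second derivative of `x` along `A₀`, with the entries `ω_0^0`, `ω_i^0` of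
the matrix of the connection. -/
lemma coord0_secondDeriv (hn : 2 ≤ n) (hp : p ∈ O) {Y : (q : M) → TangentSpace (𝓡 n) q}
    (hY : FieldDiffAt Y p) (v : TangentSpace (𝓡 n) p) :
    𝔄.coord0 p (𝔄.secondDeriv Y p v) = mvfderiv (𝓡 n) (fun q => 𝔄.wn0 q (Y q)) p v
      + 𝔄.w00 p v * 𝔄.wn0 p (Y p) + ∑ j, 𝔄.wi0 p j v * 𝔄.wni p j (Y p) := by
  rw [𝔄.secondDeriv_eq hn hp hY, coord0_add, coord0_add, coord0_smul, coord0_smul, coord0_sum,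
    𝔄.coord0_A0 hp]
  simp only [coord0_add, coord0_smul, 𝔄.coord0_A hp, mul_zero, zero_add, mul_one, w00, wi0]
  rw [mul_comm (𝔄.wn0 p (Y p))]
  congr 1
  exact Finset.sum_congr rfl fun j _ => mul_comm _ _

/-- The component of the second derivative of `x` along `A_i`, with the entries `ω_0^i`, `ω_j^i` of
the matrix of the connection. -/
lemma coord_secondDeriv (hn : 2 ≤ n) (hp : p ∈ O) {Y : (q : M) → TangentSpace (𝓡 n) q}
    (hY : FieldDiffAt Y p) (v : TangentSpace (𝓡 n) p) (i) :
    𝔄.coord p i (𝔄.secondDeriv Y p v) = mvfderiv (𝓡 n) (fun q => 𝔄.wni q i (Y q)) p v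
      + 𝔄.w0i p i v * 𝔄.wn0 p (Y p) + ∑ j, 𝔄.wij p j i v * 𝔄.wni p j (Y p) := by
  rw [𝔄.secondDeriv_eq hn hp hY, coord_add, coord_add, coord_smul, coord_smul, coord_sum,
    𝔄.coord_A0 hp]
  have h := 𝔄.coord_A hn hp i
  simp only [coord_add, coord_smul, h, mul_zero, zero_add, mul_ite, mul_one, w0i, wij,
    Finset.sum_add_distrib, Finset.sum_ite_eq, Finset.mem_univ, if_true]
  rw [mul_comm (𝔄.wn0 p (Y p)), ← add_assoc, add_comm (_ * _)]
  congr 1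
  exact Finset.sum_congr rfl fun j _ => mul_comm _ _

end Frame

variable [IsManifold (𝓡 n) ∞ M]

/-- The induced connection: `dx(∇_v Y)` and the second derivative of `x` agree modulo the
transversal space `A_n, A_{n+1}` of the reduced frames. -/
lemma isInducedConnection_iff (hn : 2 ≤ n) {ζ : M → Submodule ℝ (Amb n)} {D : Connection n M} :
    U.IsInducedConnection ζ D ↔ ∀ (O : Set M) (𝔄 : U.Frame O), 𝔄.Reduced ζ → ∀ p ∈ O,
      ∀ Y : (q : M) → TangentSpace (𝓡 n) q, FieldDiffAt Y p → ∀ v : TangentSpace (𝓡 n) p,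
        𝔄.tangentCoords p (mvfderiv (𝓡 n) 𝔄.An p (D Y p v)) =
          𝔄.tangentCoords p (𝔄.secondDeriv Y p v) := by
  unfold IsInducedConnection
  refine forall_congr' fun O => forall_congr' fun 𝔄 => forall_congr' fun _ => forall_congr' fun p =>
    forall_congr' fun hp => forall_congr' fun Y => forall_congr' fun hY => forall_congr' fun v => ?_
  rw [Frame.tangentCoords_apply, Frame.tangentCoords_apply, Prod.mk.injEq, funext_iff,
    𝔄.coord0_secondDeriv hn hp hY]
  simp only [𝔄.coord_secondDeriv hn hp hY]
  rfl

section Construction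

variable (hn : 2 ≤ n) (hU : U.MaximalRank) (ha : U.Nondegenerate)

/-- A domain around each point on which a reduced frame is chosen. -/
def redDom (p : M) : Set M := (exists_reduced hn hU ha p).choose

/-- A reduced frame chosen at each point. -/
def redFrame (p : M) : U.Frame (redDom hn hU ha p) := (exists_reduced hn hU ha p).choose_spec.choose

lemma mem_redDom (p : M) : p ∈ redDom hn hU ha p :=
  (exists_reduced hn hU ha p).choose_spec.choose_spec.1

lemma redFrame_reduced (p : M) : (redFrame hn hU ha p).Reduced U.zeta :=
  (exists_reduced hn hU ha p).choose_spec.choose_spec.2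

/-- The projection of a vector to the tangent space along the transversal space. -/
def tangentProj (p : M) : Amb n →L[ℝ] TangentSpace (𝓡 n) p :=
  LinearMap.toContinuousLinearMap
    (((redFrame hn hU ha p).coframeEquiv hn (mem_redDom hn hU ha p)
      (redFrame_reduced hn hU ha p).1).symm.toLinearMap ∘ₗ (redFrame hn hU ha p).tangentCoords p)

lemma coframe_tangentProj (p : M) (w : Amb n) :
    (redFrame hn hU ha p).coframe p (tangentProj hn hU ha p w) =
      (redFrame hn hU ha p).tangentCoords p w :=
  ((redFrame hn hU ha p).coframeEquiv hn (mem_redDom hn hU ha p)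
    (redFrame_reduced hn hU ha p).1).apply_symm_apply _

lemma tangentProj_dAn (p : M) (v : TangentSpace (𝓡 n) p) :
    tangentProj hn hU ha p (mvfderiv (𝓡 n) (redFrame hn hU ha p).An p v) = v :=
  ((redFrame hn hU ha p).coframeEquiv hn (mem_redDom hn hU ha p)
    (redFrame_reduced hn hU ha p).1).symm_apply_apply v

/-- The affine connection induced by the normalization `ζ`: the tangential part of the second
derivative of `x`. -/
def inducedConnection : Connection n M where
  toFun Y p := (tangentProj hn hU ha p).comp ((redFrame hn hU ha p).secondDeriv Y p)
  isCovariantDerivativeOnUniv :=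
    { add := by
        intro Y Y' p hY hY' _
        have hs := (redFrame hn hU ha p).smoothAt_An (mem_redDom hn hU ha p)
        ext1 v
        have h1 := mvfderiv_fun_add (hs.diffAt_field hY) (hs.diffAt_field hY')
        have h2 : (redFrame hn hU ha p).secondDeriv (Y + Y') p =
            (redFrame hn hU ha p).secondDeriv Y p + (redFrame hn hU ha p).secondDeriv Y' p := by
          rw [Frame.secondDeriv, Frame.secondDeriv, Frame.secondDeriv, ← h1]
          congr 1
          funext q
          exact map_add _ _ _
        simp [h2]
      leibniz := by
        intro Y g p hY hg _
        have hs := (redFrame hn hU ha p).smoothAt_An (mem_redDom hn hU ha p)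
        ext1 v
        have h2 : (redFrame hn hU ha p).secondDeriv (g • Y) p v =
            mvfderiv (𝓡 n) g p v • mvfderiv (𝓡 n) (redFrame hn hU ha p).An p (Y p) +
              g p • (redFrame hn hU ha p).secondDeriv Y p v := by
          rw [Frame.secondDeriv, Frame.secondDeriv, ← mvfderiv_smul_apply hg (hs.diffAt_field hY)]
          congr 2
          funext q
          exact map_smul (mvfderiv (𝓡 n) (redFrame hn hU ha p).An q) (g q) (Y q)
        simp only [ContinuousLinearMap.comp_apply, h2, map_add, map_smul,
          tangentProj_dAn]
        simp [add_comm] }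

lemma isInducedConnection_inducedConnection :
    U.IsInducedConnection U.zeta (inducedConnection hn hU ha) := by
  rw [isInducedConnection_iff hn]
  intro O 𝔅 h𝔅 p hp Y hY v
  set 𝔄 := redFrame hn hU ha p with h𝔄
  have hp' := mem_redDom hn hU ha p
  have hr := redFrame_reduced hn hU ha p
  have h1 : 𝔄.tangentCoords p (mvfderiv (𝓡 n) 𝔄.An p (inducedConnection hn hU ha Y p v)) =
      𝔄.tangentCoords p (𝔄.secondDeriv Y p v) := coframe_tangentProj hn hU ha p _
  rw [← sub_eq_zero, ← map_sub] at h1 ⊢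
  rw [𝔄.dAn_eq_smul 𝔅 hp' hp hr.1 h𝔅.1, 𝔄.secondDeriv_change 𝔅 hp' hp hr.1 h𝔅.1 hY, ← smul_sub,
    map_smul, 𝔄.tangentCoords_change 𝔅 hn hp' hp (𝔄.A0_change 𝔅 hp' hp).1 ?_ ?_ h1, smul_zero]
  · rw [← h𝔅.1 p hp, hr.1 p hp']
    exact Submodule.mem_span_singleton_self _
  · rw [← hr.2 p hp', ← h𝔅.2 p hp]

end Construction

lemma isSmoothConnection_of_isInducedConnection (hn : 2 ≤ n) {ζ : M → Submodule ℝ (Amb n)}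
    {D : Connection n M} (hD : U.IsInducedConnection ζ D)
    (hred : ∀ p, ∃ (O : Set M) (𝔄 : U.Frame O), p ∈ O ∧ 𝔄.Reduced ζ) : IsSmoothConnection D := by
  rw [isInducedConnection_iff hn] at hD
  intro O hO X Y hX hY p hp
  obtain ⟨O', 𝔄, hp', hr⟩ := hred p
  have hXp := (hX p hp).contMDiffAt (hO.mem_nhds hp)
  have hYp := (hY p hp).contMDiffAt (hO.mem_nhds hp)
  refine ContMDiffAt.contMDiffWithinAt (fieldSmoothAt_of_mvfderiv (𝔄.smoothAt_An hp')
    (fun v hv => 𝔄.eq_zero_of_dAn hp' hr.1 hv) ?_)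
  have hs : SmoothAt n (fun q => 𝔄.secondDeriv Y q (X q)) p :=
    ((𝔄.smoothAt_An hp').smoothAt_field hYp).smoothAt_field hXp
  have hs2 : SmoothAt n (fun q => 𝔄.coord0 q (𝔄.secondDeriv Y q (X q)) • 𝔄.A0 q +
      ∑ i, 𝔄.coord q i (𝔄.secondDeriv Y q (X q)) • 𝔄.A i q) p :=
    ((𝔄.smoothAt_coord0 hp' hs).smul (𝔄.smoothAt_A0 hp')).add (SmoothAt.sum fun i _ =>
      (𝔄.smoothAt_coord hn hp' hs i).smul (𝔄.smoothAt_A hp' i))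
  refine hs2.congr_of_eventuallyEq ?_
  filter_upwards [hO.mem_nhds hp, 𝔄.eventually_mem hp'] with q hq hq'
  have hYq : FieldDiffAt Y q :=
    ((hY q hq).contMDiffAt (hO.mem_nhds hq)).mdifferentiableAt (by simp)
  have h1 := hD O' 𝔄 hr q hq' Y hYq (X q)
  rw [Frame.tangentCoords_apply, Frame.tangentCoords_apply, Prod.mk.injEq, funext_iff] at h1
  rw [𝔄.dAn_eq hn hq']
  simp only [Frame.wn0, Frame.wni, h1.1, h1.2]

/-- The torsion vanishes because the mixed second derivatives of `x` along the commuting coordinate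
fields are equal. -/
lemma torsion_eq_zero_of_isInducedConnection (hn : 2 ≤ n) {ζ : M → Submodule ℝ (Amb n)}
    {D : Connection n M} (hD : U.IsInducedConnection ζ D)
    (hred : ∀ p, ∃ (O : Set M) (𝔄 : U.Frame O), p ∈ O ∧ 𝔄.Reduced ζ) : D.torsion = 0 := by
  rw [isInducedConnection_iff hn] at hD
  have key : ∀ p (u v : TangentSpace (𝓡 n) p), D.torsion p u v = 0 := by
    intro p u v
    obtain ⟨O, 𝔄, hp, hr⟩ := hred p
    have h1 := D.torsion_apply (fieldDiffAt_tangentField p u) (fieldDiffAt_tangentField p v)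
    rw [mlieBracket_tangentField, tangentField_self, tangentField_self, sub_zero] at h1
    rw [h1, sub_eq_zero]
    apply 𝔄.eq_of_tangentCoords hn hp hr.1
    rw [hD O 𝔄 hr p hp _ (fieldDiffAt_tangentField p v),
      hD O 𝔄 hr p hp _ (fieldDiffAt_tangentField p u)]
    congr 1
    exact (𝔄.smoothAt_An hp).tangentDeriv_comm v u
  ext p u v : 3
  exact key p u v

end LightlikeHypersurface
end DeSitter

end


/-! ### The screen distribution -/

noncomputable section
namespace DeSitter
namespace LightlikeHypersurface

variable {n : ℕ} {M : Type*} [TopologicalSpace M] [ChartedSpace (EuclideanSpace ℝ (Fin n)) M]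
  {U : LightlikeHypersurface n M}

namespace Frame

variable {O : Set M} (𝔄 : U.Frame O) {p : M}

lemma coord0_An (hp : p ∈ O) : 𝔄.coord0 p (𝔄.An p) = 0 := by simp [coord0, 𝔄.gram_n_inf p hp]

lemma coord_An (hp : p ∈ O) (i) : 𝔄.coord p i (𝔄.An p) = 0 := by
  have s : ∀ i, form n (𝔄.An p) (𝔄.A i p) = 0 := fun i => by
    rw [form_comm]; exact 𝔄.gram_i_n p hp i
  simp [coord, s]

lemma mem_screen_iff (hp : p ∈ O) (hr : 𝔄.Reduced U.zeta) {w : Amb n} :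
    w ∈ U.screen p ↔ ∃ (c : ℝ) (d : Fin (n - 1) → ℝ), w = c • 𝔄.An p + ∑ i, d i • 𝔄.A i p := by
  rw [screen, hr.1 p hp, hr.2 p hp, Submodule.mem_sup]
  constructor
  · rintro ⟨y, hy, z, hz, rfl⟩
    obtain ⟨c, rfl⟩ := Submodule.mem_span_singleton.1 hy
    obtain ⟨d, rfl⟩ := (Submodule.mem_span_range_iff_exists_fun ℝ).1 hz
    exact ⟨c, d, rfl⟩
  · rintro ⟨c, d, rfl⟩
    exact ⟨_, Submodule.smul_mem _ _ (Submodule.mem_span_singleton_self _), _,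
      (Submodule.mem_span_range_iff_exists_fun ℝ).2 ⟨d, rfl⟩, rfl⟩

lemma coord0_of_mem_screen (hp : p ∈ O) (hr : 𝔄.Reduced U.zeta) {w : Amb n}
    (hw : w ∈ U.screen p) : 𝔄.coord0 p w = 0 := by
  obtain ⟨c, d, rfl⟩ := (𝔄.mem_screen_iff hp hr).1 hw
  simp [coord0_add, coord0_smul, coord0_sum, 𝔄.coord0_A hp, 𝔄.coord0_An hp]

lemma mem_screenDistribution_iff (hn : 2 ≤ n) (hp : p ∈ O) (hr : 𝔄.Reduced U.zeta)
    (v : TangentSpace (𝓡 n) p) : v ∈ U.screenDistribution p ↔ 𝔄.wn0 p v = 0 := by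
  rw [screenDistribution, (𝔄.isLift_An hp hr.1).directionsIn_eq (S := U.screen p) le_sup_left]
  change mvfderiv (𝓡 n) 𝔄.An p v ∈ U.screen p ↔ _
  refine ⟨fun h => 𝔄.coord0_of_mem_screen hp hr h, fun h => ?_⟩
  rw [𝔄.mem_screen_iff hp hr]
  exact ⟨0, fun i => 𝔄.wni p i v, by rw [𝔄.dAn_eq hn hp, h, zero_smul, zero_smul]⟩

/-- The direction of the generators is given by `ω_n^i = 0`. -/
lemma mem_isotropicDistribution_iff (hn : 2 ≤ n) (hp : p ∈ O) (hx : ∀ q ∈ O, U.pt q = ℝ ∙ 𝔄.An q)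
    (v : TangentSpace (𝓡 n) p) : v ∈ U.isotropicDistribution p ↔ ∀ i, 𝔄.wni p i v = 0 := by
  rw [isotropicDistribution, (𝔄.isLift_An hp hx).directionsIn_eq (S := U.generator p) le_sup_left]
  change mvfderiv (𝓡 n) 𝔄.An p v ∈ U.generator p ↔ _
  rw [𝔄.generator_eq hp]
  constructor
  · intro h i
    obtain ⟨α, β, h⟩ := Submodule.mem_span_pair.1 h
    rw [wni, ← h, coord_add, coord_smul, coord_smul, 𝔄.coord_An hp, 𝔄.coord_A0 hp]
    simp
  · intro h
    exact Submodule.mem_span_pair.2 ⟨0, 𝔄.wn0 p v, by rw [𝔄.dAn_eq hn hp]; simp [h]⟩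

lemma screen_le (hp : p ∈ O) (hr : 𝔄.Reduced U.zeta) : U.screen p ≤ U.tangentHyperplane p := by
  intro w hw
  obtain ⟨c, d, rfl⟩ := (𝔄.mem_screen_iff hp hr).1 hw
  rw [𝔄.mem_tangentHyperplane_iff hp]
  simp [𝔄.gram_0_n p hp, 𝔄.gram_0_i p hp]

lemma screen_inf_generator (hn : 2 ≤ n) (hp : p ∈ O) (hr : 𝔄.Reduced U.zeta) :
    U.screen p ⊓ U.generator p = U.pt p := by
  apply le_antisymm
  · rintro w ⟨hw, hw'⟩
    obtain ⟨c, d, rfl⟩ := (𝔄.mem_screen_iff hp hr).1 hw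
    rw [SetLike.mem_coe, 𝔄.generator_eq hp] at hw'
    obtain ⟨α, β, h⟩ := Submodule.mem_span_pair.1 hw'
    have hd : ∀ i, d i = 0 := by
      intro i
      have h1 := congrArg (𝔄.coord p i) h
      have h2 := 𝔄.coord_A hn hp i
      simpa [coord_add, coord_smul, coord_sum, 𝔄.coord_An hp, 𝔄.coord_A0 hp, h2, eq_comm] using h1
    rw [hr.1 p hp]
    simp only [hd, zero_smul, Finset.sum_const_zero, add_zero]
    exact Submodule.smul_mem _ _ (Submodule.mem_span_singleton_self _)
  · exact le_inf le_sup_left le_sup_left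

lemma screen_sup_generator (hn : 2 ≤ n) (hp : p ∈ O) (hr : 𝔄.Reduced U.zeta) :
    U.screen p ⊔ U.generator p = U.tangentHyperplane p := by
  apply le_antisymm
  · refine sup_le (𝔄.screen_le hp hr) ?_
    rw [𝔄.generator_eq hp, Submodule.span_le]
    rintro w (rfl | rfl)
    · exact (𝔄.mem_tangentHyperplane_iff hp).2 (𝔄.gram_0_n p hp)
    · exact (𝔄.mem_tangentHyperplane_iff hp).2 (𝔄.gram_0_0 p hp)
  · intro w hw
    rw [𝔄.mem_tangentHyperplane_iff hp, form_comm] at hw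
    have h1 := 𝔄.expand hn hp w
    rw [hw, neg_zero, zero_smul, add_zero] at h1
    rw [Submodule.mem_sup]
    refine ⟨form n w (𝔄.An p) • 𝔄.An p + ∑ i, 𝔄.coord p i w • 𝔄.A i p,
      (𝔄.mem_screen_iff hp hr).2 ⟨_, _, rfl⟩, 𝔄.coord0 p w • 𝔄.A0 p, ?_, ?_⟩
    · rw [𝔄.generator_eq hp]
      exact Submodule.smul_mem _ _ (Submodule.subset_span (by simp))
    · conv_rhs => rw [h1]
      abel

lemma isCompl_screenDistribution (hn : 2 ≤ n) (hp : p ∈ O) (hr : 𝔄.Reduced U.zeta) :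
    IsCompl (U.screenDistribution p) (U.isotropicDistribution p) := by
  constructor
  · rw [Submodule.disjoint_def]
    intro v h1 h2
    exact 𝔄.eq_zero_of_coframe hn hp hr.1 ((𝔄.mem_screenDistribution_iff hn hp hr v).1 h1)
      ((𝔄.mem_isotropicDistribution_iff hn hp hr.1 v).1 h2)
  · rw [codisjoint_iff, eq_top_iff]
    intro v _
    let E := 𝔄.coframeEquiv hn hp hr.1
    have hE : ∀ z, 𝔄.coframe p (E.symm z) = z := fun z => E.apply_symm_apply z
    have h1 := hE (0, fun i => 𝔄.wni p i v)
    have h2 := hE (𝔄.wn0 p v, 0)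
    rw [coframe_apply, Prod.mk.injEq] at h1 h2
    refine Submodule.mem_sup.2 ⟨E.symm (0, fun i => 𝔄.wni p i v),
      (𝔄.mem_screenDistribution_iff hn hp hr _).2 h1.1, E.symm (𝔄.wn0 p v, 0),
      (𝔄.mem_isotropicDistribution_iff hn hp hr.1 _).2 fun i => congrFun h2.2 i, ?_⟩
    rw [← map_add, Prod.mk_add_mk, zero_add, add_zero]
    exact E.symm_apply_apply v

lemma finrank_screenDistribution (hn : 2 ≤ n) (hp : p ∈ O) (hr : 𝔄.Reduced U.zeta) :
    finrank ℝ (U.screenDistribution p) = n - 1 := by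
  have h1 : U.screenDistribution p = LinearMap.ker (𝔄.wn0L p) := by
    ext v
    rw [𝔄.mem_screenDistribution_iff hn hp hr, LinearMap.mem_ker, wn0L_apply]
  have h2 : LinearMap.range (𝔄.wn0L p) = ⊤ := by
    rw [eq_top_iff]
    intro c _
    let E := 𝔄.coframeEquiv hn hp hr.1
    exact ⟨E.symm (c, 0), congrArg Prod.fst (E.apply_symm_apply (c, 0))⟩
  have h3 := LinearMap.finrank_range_add_finrank_ker (𝔄.wn0L p)
  rw [h2, finrank_top, Module.finrank_self, finrank_tangent] at h3
  rw [h1]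
  omega

end Frame
end LightlikeHypersurface
end DeSitter

end


/-! ### Motions, changes of parameters and displacements along the generators -/

noncomputable section
namespace DeSitter

section Push

variable {n : ℕ} {M : Type*} [TopologicalSpace M] [ChartedSpace (EuclideanSpace ℝ (Fin n)) M]
  {M' : Type*} [TopologicalSpace M'] [ChartedSpace (EuclideanSpace ℝ (Fin n)) M']
  {φ : M' → M} {q : M'} {W : Type*} [NormedAddCommGroup W] [NormedSpace ℝ W]

/-- The chain rule under a change of parameters `φ` followed by a linear map `L`. -/
lemma mvfderiv_push (hφ : MDifferentiableAt (𝓡 n) (𝓡 n) φ q) (L : W →L[ℝ] W) {F : M → W}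
    (hF : DiffAt n F (φ q)) (v : TangentSpace (𝓡 n) q) :
    mvfderiv (𝓡 n) (fun r => L (F (φ r))) q v =
      L (mvfderiv (𝓡 n) F (φ q) (mfderiv (𝓡 n) (𝓡 n) φ q v)) := by
  have h1 : DiffAt n (fun r => F (φ r)) q := hF.comp q hφ
  rw [mvfderiv_clm L h1]
  exact congrArg L (mfderiv_comp_apply (I'' := 𝓘(ℝ, W)) q hF hφ v)

lemma SmoothAt.push (hφ : ContMDiffAt (𝓡 n) (𝓡 n) ∞ φ q) (L : W →L[ℝ] W) {F : M → W}
    (hF : SmoothAt n F (φ q)) : SmoothAt n (fun r => L (F (φ r))) q :=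
  L.contMDiff.contMDiffAt.comp q (hF.comp q hφ)

variable (hφ : IsLocalDiffeomorph (𝓡 n) (𝓡 n) ∞ φ) (L : Amb n ≃ₗ[ℝ] Amb n)
include hφ

lemma mfderiv_surjective (q : M') : Function.Surjective (mfderiv (𝓡 n) (𝓡 n) φ q) := by
  have h := (hφ.mfderivToContinuousLinearEquiv (by simp) q).surjective
  exact h

lemma mdiffAt_localDiffeo (q : M') : MDifferentiableAt (𝓡 n) (𝓡 n) φ q :=
  (hφ.contMDiff q).mdifferentiableAt (by simp)

lemma IsLift.push {P : M → Submodule ℝ (Amb n)} {f : M → Amb n} (hf : IsLift P (φ q) f) :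
    IsLift (fun r => (P (φ r)).map L.toLinearMap) q (fun r => L (f (φ r))) := by
  have h := hφ.contMDiff.continuous.continuousAt.eventually hf.eventually
  filter_upwards [h] with r hr
  refine ⟨SmoothAt.push (hφ.contMDiff r) L.toContinuousLinearEquiv.toContinuousLinearMap
    hr.smoothAt, fun h0 => hr.ne_zero (by simpa using h0), ?_⟩
  rw [hr.eq, Submodule.map_span, Set.image_singleton]
  rfl

lemma mvfderiv_push_lift {f : M → Amb n} (hf : SmoothAt n f (φ q)) (v : TangentSpace (𝓡 n) q) :
    mvfderiv (𝓡 n) (fun r => L (f (φ r))) q v =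
      L (mvfderiv (𝓡 n) f (φ q) (mfderiv (𝓡 n) (𝓡 n) φ q v)) :=
  mvfderiv_push (mdiffAt_localDiffeo hφ q) L.toContinuousLinearEquiv.toContinuousLinearMap
    hf.diffAt v

lemma projTangent_push {P : M → Submodule ℝ (Amb n)} {f : M → Amb n} (hf : IsLift P (φ q) f) :
    projTangent (fun r => (P (φ r)).map L.toLinearMap) q =
      (projTangent P (φ q)).map L.toLinearMap := by
  rw [(hf.push hφ L).projTangent_eq, hf.projTangent_eq, Submodule.map_sup, Submodule.map_span,
    Set.image_singleton]
  congr 1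
  ext w
  constructor
  · rintro ⟨v, rfl⟩
    exact ⟨_, ⟨mfderiv (𝓡 n) (𝓡 n) φ q v, rfl⟩, (mvfderiv_push_lift hφ L hf.smoothAt v).symm⟩
  · rintro ⟨_, ⟨u, rfl⟩, rfl⟩
    obtain ⟨v, rfl⟩ := mfderiv_surjective hφ q u
    exact ⟨v, mvfderiv_push_lift hφ L hf.smoothAt v⟩

end Push

lemma projTangent_congr {n : ℕ} {M : Type*} [TopologicalSpace M]
    [ChartedSpace (EuclideanSpace ℝ (Fin n)) M] {P P' : M → Submodule ℝ (Amb n)} {p : M}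
    {f : M → Amb n} (hf : IsLift P p f) (h : ∀ᶠ q in 𝓝 p, P' q = P q) :
    projTangent P' p = projTangent P p := by
  rw [(hf.congr h).projTangent_eq, hf.projTangent_eq]

namespace LightlikeHypersurface

variable {n : ℕ} {M : Type*} [TopologicalSpace M] [ChartedSpace (EuclideanSpace ℝ (Fin n)) M]
  {U : LightlikeHypersurface n M}

section Invariance

variable {M' : Type*} [TopologicalSpace M'] [ChartedSpace (EuclideanSpace ℝ (Fin n)) M']
  {U' : LightlikeHypersurface n M'} {φ : M' → M} (hφ : IsLocalDiffeomorph (𝓡 n) (𝓡 n) ∞ φ)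
  {L : Amb n ≃ₗ[ℝ] Amb n} (hL : ∀ x y, form n (L x) (L y) = form n x y)
  (hpt : ∀ q, U'.pt q = (U.pt (φ q)).map L.toLinearMap)

include hφ hpt in
lemma tangentHyperplane_push (q : M') :
    U'.tangentHyperplane q = (U.tangentHyperplane (φ q)).map L.toLinearMap := by
  obtain ⟨f, hf⟩ := U.pt_lift (φ q)
  rw [tangentHyperplane, tangentHyperplane, ← projTangent_push hφ L hf]
  congr 1
  funext r
  exact hpt r

include hφ hL hpt in
lemma tangency_push (q : M') : U'.tangency q = (U.tangency (φ q)).map L.toLinearMap := by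
  rw [tangency, tangency, tangentHyperplane_push hφ hpt]
  ext w
  simp only [LinearMap.BilinForm.mem_orthogonal_iff, Submodule.mem_map]
  constructor
  · intro h
    refine ⟨L.symm w, fun m hm => ?_, by simp⟩
    have := h (L m) ⟨m, hm, rfl⟩
    rw [← hL]
    simpa using this
  · rintro ⟨y, hy, rfl⟩ _ ⟨m, hm, rfl⟩
    exact (hL m y).trans (hy m hm)

include hφ hL hpt in
lemma tangentV_push [IsManifold (𝓡 n) ∞ M] (q : M') {O : Set M} (𝔄 : U.Frame O) (hq : φ q ∈ O) :
    U'.tangentV q = (U.tangentV (φ q)).map L.toLinearMap := by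
  rw [tangentV, tangentV, ← projTangent_push hφ L (𝔄.isLift_A0 hq)]
  congr 1
  funext r
  exact tangency_push hφ hL hpt r

/-- The image of a frame field under a motion `L` and a change `φ` of the parameters. -/
def Frame.push {O : Set M} (𝔄 : U.Frame O) : U'.Frame (φ ⁻¹' O) where
  A0 q := L (𝔄.A0 (φ q))
  A i q := L (𝔄.A i (φ q))
  An q := L (𝔄.An (φ q))
  Ainf q := L (𝔄.Ainf (φ q))
  isOpen := 𝔄.isOpen.preimage hφ.contMDiff.continuous
  smooth_A0 q hq := (SmoothAt.push (hφ.contMDiff q)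
    L.toContinuousLinearEquiv.toContinuousLinearMap (𝔄.smoothAt_A0 hq)).contMDiffWithinAt
  smooth_A i q hq := (SmoothAt.push (hφ.contMDiff q)
    L.toContinuousLinearEquiv.toContinuousLinearMap (𝔄.smoothAt_A hq i)).contMDiffWithinAt
  smooth_An q hq := (SmoothAt.push (hφ.contMDiff q)
    L.toContinuousLinearEquiv.toContinuousLinearMap (𝔄.smoothAt_An hq)).contMDiffWithinAt
  smooth_Ainf q hq := (SmoothAt.push (hφ.contMDiff q)
    L.toContinuousLinearEquiv.toContinuousLinearMap (𝔄.smoothAt_Ainf hq)).contMDiffWithinAt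
  gram_0_0 q hq := (hL _ _).trans (𝔄.gram_0_0 _ hq)
  gram_0_i q hq i := (hL _ _).trans (𝔄.gram_0_i _ hq i)
  gram_0_n q hq := (hL _ _).trans (𝔄.gram_0_n _ hq)
  gram_0_inf q hq := (hL _ _).trans (𝔄.gram_0_inf _ hq)
  gram_i_n q hq i := (hL _ _).trans (𝔄.gram_i_n _ hq i)
  gram_i_inf q hq i := (hL _ _).trans (𝔄.gram_i_inf _ hq i)
  gram_n_n q hq := (hL _ _).trans (𝔄.gram_n_n _ hq)
  gram_n_inf q hq := (hL _ _).trans (𝔄.gram_n_inf _ hq)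
  gram_inf_inf q hq := (hL _ _).trans (𝔄.gram_inf_inf _ hq)
  indep q hq := (𝔄.indep _ hq).map' L.toLinearMap L.ker
  A0_mem q hq := by
    rw [tangency_push hφ hL hpt]
    exact ⟨_, 𝔄.A0_mem _ hq, rfl⟩
  pt_le q hq := by
    rw [hpt]
    refine (Submodule.map_mono (𝔄.pt_le _ hq)).trans ?_
    rw [Submodule.map_span, Set.image_pair]
    rfl

variable {O : Set M} (𝔄 : U.Frame O)

lemma Frame.tangentCoords_push (q : M') (w : Amb n) :
    (𝔄.push hφ hL hpt).tangentCoords q (L w) = 𝔄.tangentCoords (φ q) w := by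
  have hg : (𝔄.push hφ hL hpt).g q = 𝔄.g (φ q) := by
    ext i j
    exact hL _ _
  rw [tangentCoords_apply, tangentCoords_apply]
  refine Prod.ext (congrArg Neg.neg (hL _ _)) (funext fun i => ?_)
  change (𝔄.push hφ hL hpt).coord q i (L w) = 𝔄.coord (φ q) i w
  unfold coord
  rw [hg]
  exact Finset.sum_congr rfl fun j _ => congrArg _ (hL _ _)

lemma Frame.dAn_push {q : M'} (hq : φ q ∈ O) (v : TangentSpace (𝓡 n) q) :
    mvfderiv (𝓡 n) (𝔄.push hφ hL hpt).An q v =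
      L (mvfderiv (𝓡 n) 𝔄.An (φ q) (mfderiv (𝓡 n) (𝓡 n) φ q v)) :=
  mvfderiv_push_lift hφ L (𝔄.smoothAt_An hq) v

lemma Frame.dA0_push {q : M'} (hq : φ q ∈ O) (v : TangentSpace (𝓡 n) q) :
    mvfderiv (𝓡 n) (𝔄.push hφ hL hpt).A0 q v =
      L (mvfderiv (𝓡 n) 𝔄.A0 (φ q) (mfderiv (𝓡 n) (𝓡 n) φ q v)) :=
  mvfderiv_push_lift hφ L (𝔄.smoothAt_A0 hq) v

variable [IsManifold (𝓡 n) ∞ M] [IsManifold (𝓡 n) ∞ M']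

include hφ hL hpt in
lemma finrank_tangentV_push {O : Set M} (𝔄 : U.Frame O)
    (hV : ∀ q ∈ O, finrank ℝ (U.tangentV q) = n) {q : M'}
    (hq : φ q ∈ O) : finrank ℝ (U'.tangentV q) = n := by
  rw [tangentV_push hφ hL hpt q 𝔄 hq]
  exact (L.finrank_map_eq _).trans (hV _ hq)

/-- `λ` is a trace built from scalar products of derivatives, so motions and changes of parameters
preserve it, and `C` with it. -/
lemma Frame.C_push (hn : 2 ≤ n) (hV : ∀ q ∈ O, finrank ℝ (U.tangentV q) = n) {q : M'}
    (hq : φ q ∈ O) : (𝔄.push hφ hL hpt).C q = L (𝔄.C (φ q)) := by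
  have hlam : (𝔄.push hφ hL hpt).lamMean q = 𝔄.lamMean (φ q) := by
    obtain ⟨e, he⟩ := 𝔄.exists_dual hn hq (hV _ hq)
    choose e' he' using fun i => mfderiv_surjective hφ q (e i)
    let H : Matrix (Fin (n - 1)) (Fin (n - 1)) ℝ := Matrix.of fun i j =>
      form n (mvfderiv (𝓡 n) 𝔄.A0 (φ q) (e i)) (mvfderiv (𝓡 n) 𝔄.A0 (φ q) (e j))
    let K : Matrix (Fin (n - 1)) (Fin (n - 1)) ℝ := Matrix.of fun i j =>
      form n (mvfderiv (𝓡 n) 𝔄.A0 (φ q) (e i)) (mvfderiv (𝓡 n) 𝔄.An (φ q) (e j))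
    have hHd : H.det ≠ 0 := by
      have hH : H = 𝔄.g (φ q) := 𝔄.gram_dual hn hq he
      rw [hH]
      exact 𝔄.det_g_ne_zero hn hq
    rw [𝔄.lamMean_eq_trace hn hq (hV _ hq) e (H := H) (K := K) (fun i j => rfl)
      (fun i j => rfl) hHd, (𝔄.push hφ hL hpt).lamMean_eq_trace hn hq
      (finrank_tangentV_push hφ hL hpt 𝔄 hV hq) e' (H := H) (K := K) (fun i j => ?_)
      (fun i j => ?_) hHd]
    · rw [𝔄.dA0_push hφ hL hpt hq, 𝔄.dA0_push hφ hL hpt hq, hL, he', he']; rfl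
    · rw [𝔄.dA0_push hφ hL hpt hq, 𝔄.dAn_push hφ hL hpt hq, hL, he', he']; rfl
  rw [C, C, hlam, map_add, map_smul]
  rfl

lemma Frame.range_dC_push (hn : 2 ≤ n) (hV : ∀ q ∈ O, finrank ℝ (U.tangentV q) = n) {q : M'}
    (hq : φ q ∈ O) : LinearMap.range (mvfderiv (𝓡 n) (𝔄.push hφ hL hpt).C q).toLinearMap =
      (LinearMap.range (mvfderiv (𝓡 n) 𝔄.C (φ q)).toLinearMap).map L.toLinearMap := by
  have hev : (𝔄.push hφ hL hpt).C =ᶠ[𝓝 q] fun r => L (𝔄.C (φ r)) :=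
    ((𝔄.push hφ hL hpt).eventually_mem hq).mono fun r hr => 𝔄.C_push hφ hL hpt hn hV hr
  have hd : ∀ v, mvfderiv (𝓡 n) (𝔄.push hφ hL hpt).C q v =
      L (mvfderiv (𝓡 n) 𝔄.C (φ q) (mfderiv (𝓡 n) (𝓡 n) φ q v)) := fun v => by
    rw [mvfderiv_congr hev]
    exact mvfderiv_push_lift hφ L (𝔄.smoothAt_C hn hV hq) v
  ext w
  constructor
  · rintro ⟨v, rfl⟩
    exact ⟨_, ⟨mfderiv (𝓡 n) (𝓡 n) φ q v, rfl⟩, (hd v).symm⟩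
  · rintro ⟨_, ⟨u, rfl⟩, rfl⟩
    obtain ⟨v, rfl⟩ := mfderiv_surjective hφ q u
    exact ⟨v, hd v⟩

include hφ hL hpt

lemma pole_push {O : Set M} (𝔄 : U.Frame O) (hn : 2 ≤ n)
    (hV : ∀ q ∈ O, finrank ℝ (U.tangentV q) = n) {q : M'}
    (hq : φ q ∈ O) : U'.pole q = (U.pole (φ q)).map L.toLinearMap := by
  rw [𝔄.pole_eq hn hq (hV _ hq), (𝔄.push hφ hL hpt).pole_eq hn hq
    (finrank_tangentV_push hφ hL hpt 𝔄 hV hq), 𝔄.C_push hφ hL hpt hn hV hq, Submodule.map_span,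
    Set.image_singleton]
  rfl

lemma zeta_push {O : Set M} (𝔄 : U.Frame O) (hn : 2 ≤ n)
    (hV : ∀ q ∈ O, finrank ℝ (U.tangentV q) = n) {q : M'}
    (hq : φ q ∈ O) : U'.zeta q = (U.zeta (φ q)).map L.toLinearMap := by
  rw [𝔄.zeta_eq_range hn hV hq, (𝔄.push hφ hL hpt).zeta_eq_range hn
    (fun r hr => finrank_tangentV_push hφ hL hpt 𝔄 hV hr) hq, 𝔄.range_dC_push hφ hL hpt hn hV hq]

lemma screen_push {O : Set M} (𝔄 : U.Frame O) (hn : 2 ≤ n)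
    (hV : ∀ q ∈ O, finrank ℝ (U.tangentV q) = n) {q : M'}
    (hq : φ q ∈ O) : U'.screen q = (U.screen (φ q)).map L.toLinearMap := by
  rw [screen, screen, Submodule.map_sup, hpt, zeta_push hφ hL hpt 𝔄 hn hV hq]

lemma screenDistribution_push {O : Set M} (𝔄 : U.Frame O) (hn : 2 ≤ n)
    (hV : ∀ q ∈ O, finrank ℝ (U.tangentV q) = n) {q : M'}
    (hq : φ q ∈ O) : U'.screenDistribution q =
      (U.screenDistribution (φ q)).comap (mfderiv (𝓡 n) (𝓡 n) φ q).toLinearMap := by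
  obtain ⟨f, hf⟩ := U.pt_lift (φ q)
  have hf' : IsLift U'.pt q (fun r => L (f (φ r))) :=
    (hf.push hφ L).congr (Eventually.of_forall fun r => hpt r)
  rw [screenDistribution, screenDistribution, hf.directionsIn_eq (S := U.screen (φ q)) le_sup_left,
    hf'.directionsIn_eq (S := U'.screen q) le_sup_left, screen_push hφ hL hpt 𝔄 hn hV hq]
  ext v
  change mvfderiv (𝓡 n) (fun r => L (f (φ r))) q v ∈ (U.screen (φ q)).map L.toLinearMap ↔
    mvfderiv (𝓡 n) f (φ q) (mfderiv (𝓡 n) (𝓡 n) φ q v) ∈ U.screen (φ q)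
  rw [mvfderiv_push_lift hφ L hf.smoothAt v]
  exact L.injective.mem_set_image

lemma reduced_push (hn : 2 ≤ n) (hV : ∀ q ∈ O, finrank ℝ (U.tangentV q) = n)
    (hr : 𝔄.Reduced U.zeta) : (𝔄.push hφ hL hpt).Reduced U'.zeta := by
  constructor
  · intro q hq
    rw [hpt, hr.1 _ hq, Submodule.map_span, Set.image_singleton]
    rfl
  · intro q hq
    rw [zeta_push hφ hL hpt 𝔄 hn hV hq, hr.2 _ hq, Submodule.map_span, ← Set.range_comp]
    rfl

lemma connection_push (hn : 2 ≤ n) (hV : ∀ q ∈ O, finrank ℝ (U.tangentV q) = n)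
    (hr : 𝔄.Reduced U.zeta) {D : Connection n M} {D' : Connection n M'}
    (hD : U.IsInducedConnection U.zeta D) (hD' : U'.IsInducedConnection U'.zeta D') {q : M'}
    (hq : φ q ∈ O) {Y : (p : M) → TangentSpace (𝓡 n) p} {Y' : (p : M') → TangentSpace (𝓡 n) p}
    (hY : FieldDiffAt Y (φ q)) (hY' : FieldDiffAt Y' q)
    (hYY : ∀ᶠ r in 𝓝 q, mfderiv (𝓡 n) (𝓡 n) φ r (Y' r) = Y (φ r)) (v : TangentSpace (𝓡 n) q) :
    mfderiv (𝓡 n) (𝓡 n) φ q (D' Y' q v) = D Y (φ q) (mfderiv (𝓡 n) (𝓡 n) φ q v) := by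
  rw [isInducedConnection_iff hn] at hD hD'
  have h1 := hD O 𝔄 hr _ hq Y hY (mfderiv (𝓡 n) (𝓡 n) φ q v)
  have h2 := hD' _ _ (reduced_push hφ hL hpt 𝔄 hn hV hr) q hq Y' hY' v
  apply 𝔄.eq_of_tangentCoords hn hq hr.1
  rw [h1, ← 𝔄.tangentCoords_push hφ hL hpt, ← 𝔄.dAn_push hφ hL hpt hq, h2,
    ← 𝔄.tangentCoords_push hφ hL hpt]
  congr 1
  have hev : (fun r => mvfderiv (𝓡 n) (𝔄.push hφ hL hpt).An r (Y' r)) =ᶠ[𝓝 q]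
      fun r => L (mvfderiv (𝓡 n) 𝔄.An (φ r) (Y (φ r))) := by
    filter_upwards [hYY, (𝔄.push hφ hL hpt).eventually_mem hq] with r hr1 hr2
    rw [𝔄.dAn_push hφ hL hpt hr2, hr1]
  rw [Frame.secondDeriv, mvfderiv_congr hev]
  exact mvfderiv_push (mdiffAt_localDiffeo hφ q) L.toContinuousLinearEquiv.toContinuousLinearMap
    ((𝔄.smoothAt_An hq).diffAt_field hY) v

end Invariance

section Generators

variable {U' : LightlikeHypersurface n M} {O : Set M} (𝔄 : U.Frame O) {p : M}

/-- The generator determines the point `A₀`, its only isotropic point. -/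
lemma tangency_eq_of_generator_eq {O : Set M} (𝔄 : U.Frame O) {p : M} (hp : p ∈ O)
    (h : U'.generator p = U.generator p) : U'.tangency p = U.tangency p := by
  obtain ⟨y, hy0, hyy, hy⟩ := U'.exists_tangency p
  have h1 : y ∈ U.generator p := by
    rw [← h, generator, hy]
    exact Submodule.mem_sup_right (Submodule.mem_span_singleton_self _)
  rw [𝔄.generator_eq hp] at h1
  obtain ⟨α, β, h2⟩ := Submodule.mem_span_pair.1 h1
  have s3 : form n (𝔄.An p) (𝔄.A0 p) = 0 := by rw [form_comm]; exact 𝔄.gram_0_n p hp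
  have hα : α = 0 := by
    rw [← h2] at hyy
    simpa [s3, 𝔄.gram_0_n p hp, 𝔄.gram_n_n p hp, 𝔄.gram_0_0 p hp] using hyy
  rw [hα, zero_smul, zero_add] at h2
  rw [hy]
  exact (tangency_eq_span (by rw [← h2]; exact Submodule.smul_mem _ _ (𝔄.A0_mem p hp)) hy0).symm

/-- An adapted frame of a hypersurface, seen as a frame of a hypersurface with the same
generators. -/
def Frame.transfer (h : ∀ q ∈ O, U'.generator q = U.generator q) : U'.Frame O where
  A0 := 𝔄.A0
  A := 𝔄.A
  An := 𝔄.An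
  Ainf := 𝔄.Ainf
  isOpen := 𝔄.isOpen
  smooth_A0 := 𝔄.smooth_A0
  smooth_A := 𝔄.smooth_A
  smooth_An := 𝔄.smooth_An
  smooth_Ainf := 𝔄.smooth_Ainf
  gram_0_0 := 𝔄.gram_0_0
  gram_0_i := 𝔄.gram_0_i
  gram_0_n := 𝔄.gram_0_n
  gram_0_inf := 𝔄.gram_0_inf
  gram_i_n := 𝔄.gram_i_n
  gram_i_inf := 𝔄.gram_i_inf
  gram_n_n := 𝔄.gram_n_n
  gram_n_inf := 𝔄.gram_n_inf
  gram_inf_inf := 𝔄.gram_inf_inf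
  indep := 𝔄.indep
  A0_mem q hq := by
    rw [tangency_eq_of_generator_eq 𝔄 hq (h q hq)]
    exact 𝔄.A0_mem q hq
  pt_le q hq := by
    rw [← 𝔄.generator_eq hq, ← h q hq]
    exact le_sup_left

lemma pole_zeta_eq_of_generator_eq [IsManifold (𝓡 n) ∞ M] {O : Set M} (𝔄 : U.Frame O)
    {p : M} (hn : 2 ≤ n) (hV : ∀ q ∈ O, finrank ℝ (U.tangentV q) = n) (hp : p ∈ O)
    (h : ∀ᶠ q in 𝓝 p, U'.generator q = U.generator q) :
    U'.pole p = U.pole p ∧ U'.zeta p = U.zeta p := by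
  obtain ⟨O₁, hO₁, hO₁o, hp₁⟩ := eventually_nhds_iff.1 (h.and (𝔄.eventually_mem hp))
  let 𝔅 := 𝔄.restrict hO₁o fun q hq => (hO₁ q hq).2
  let 𝔅' : U'.Frame O₁ := 𝔅.transfer fun q hq => (hO₁ q hq).1
  have hV' : ∀ q ∈ O₁, finrank ℝ (U'.tangentV q) = n := by
    intro q hq
    have hT : U'.tangentV q = U.tangentV q := by
      rw [tangentV, tangentV, projTangent_congr (𝔅.isLift_A0 hq)]
      filter_upwards [𝔅.eventually_mem hq] with r hr
      exact tangency_eq_of_generator_eq 𝔅 hr (hO₁ r hr).1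
    rw [hT]
    exact hV q (hO₁ q hq).2
  constructor
  · rw [𝔄.pole_eq hn hp (hV p hp), 𝔅'.pole_eq hn hp₁ (hV' p hp₁)]
    rfl
  · rw [𝔄.zeta_eq hn hV hp, 𝔅'.zeta_eq hn hV' hp₁]
    rfl

end Generators

end LightlikeHypersurface
end DeSitter

end


/-! ### Calculus of jets -/

noncomputable section
namespace DeSitter

section Jets

variable {n : ℕ} {M : Type*} [TopologicalSpace M] [ChartedSpace (EuclideanSpace ℝ (Fin n)) M]
  [IsManifold (𝓡 n) ∞ M]
  {W W₁ W₂ : Type*} [NormedAddCommGroup W] [NormedSpace ℝ W]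
  [NormedAddCommGroup W₁] [NormedSpace ℝ W₁] [NormedAddCommGroup W₂] [NormedSpace ℝ W₂]

/-- The derivative of `F` along a coordinate field of the chart at `p`. -/
def coordD (p : M) (u : EuclideanSpace ℝ (Fin n)) (F : M → W) (q : M) : W :=
  mvfderiv (𝓡 n) F q (coordField p u q)

/-- Equality of the `k`-jets at `p`, in terms of iterated derivatives along the coordinate fields
of the chart at `p`. -/
def JetEq (n : ℕ) {M : Type*} [TopologicalSpace M]
    [ChartedSpace (EuclideanSpace ℝ (Fin n)) M] [IsManifold (𝓡 n) ∞ M]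
    {W : Type*} [NormedAddCommGroup W] [NormedSpace ℝ W] (p : M) : ℕ → (M → W) → (M → W) → Prop
  | 0, F, G => F p = G p
  | k + 1, F, G => F p = G p ∧
      ∀ u : EuclideanSpace ℝ (Fin n), JetEq n p k (coordD p u F) (coordD p u G)

variable {p : M} {k : ℕ} {F G F₁ G₁ : M → W}

lemma coordD_at (p : M) (u : EuclideanSpace ℝ (Fin n)) (F : M → W) :
    coordD p u F p = mvfderiv (𝓡 n) F p (show TangentSpace (𝓡 n) p from u) := by
  rw [coordD, coordField_self]

lemma smoothNear_coordD (hF : ∀ᶠ q in 𝓝 p, SmoothAt n F q) (u : EuclideanSpace ℝ (Fin n)) :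
    ∀ᶠ q in 𝓝 p, SmoothAt n (coordD p u F) q := by
  filter_upwards [hF, (chartAt (EuclideanSpace ℝ (Fin n)) p).open_source.mem_nhds
    (mem_chart_source _ p)] with q hq hqs
  exact hq.coordDeriv hqs u

lemma coordD_congr (h : F =ᶠ[𝓝 p] G) (u : EuclideanSpace ℝ (Fin n)) :
    coordD p u F =ᶠ[𝓝 p] coordD p u G := by
  filter_upwards [eventually_eventually_nhds.2 h] with q hq
  rw [coordD, coordD, mvfderiv_congr hq]

lemma JetEq.eq (h : JetEq n p k F G) : F p = G p := by
  cases k with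
  | zero => exact h
  | succ k => exact h.1

lemma JetEq.of_succ (h : JetEq n p (k + 1) F G) : JetEq n p k F G := by
  induction k generalizing F G with
  | zero => exact h.1
  | succ k ih => exact ⟨h.1, fun u => ih (h.2 u)⟩

lemma JetEq.refl (F : M → W) : JetEq n p k F F := by
  induction k generalizing F with
  | zero => rfl
  | succ k ih => exact ⟨rfl, fun u => ih _⟩

lemma JetEq.congr (h : JetEq n p k F G) (hF : F₁ =ᶠ[𝓝 p] F) (hG : G₁ =ᶠ[𝓝 p] G) :
    JetEq n p k F₁ G₁ := by
  induction k generalizing F G F₁ G₁ with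
  | zero => exact (hF.self_of_nhds.trans h).trans hG.self_of_nhds.symm
  | succ k ih =>
    exact ⟨(hF.self_of_nhds.trans h.1).trans hG.self_of_nhds.symm,
      fun u => ih (h.2 u) (coordD_congr hF u) (coordD_congr hG u)⟩

lemma JetEq.mvfderiv_eq (h : JetEq n p (k + 1) F G) : mvfderiv (𝓡 n) F p = mvfderiv (𝓡 n) G p := by
  ext v
  exact (coordD_at p v F).symm.trans ((h.2 v).eq.trans (coordD_at p v G))

lemma coordD_add (hF : ∀ᶠ q in 𝓝 p, SmoothAt n F q) (hG : ∀ᶠ q in 𝓝 p, SmoothAt n G q)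
    (u : EuclideanSpace ℝ (Fin n)) : coordD p u (fun q => F q + G q) =ᶠ[𝓝 p]
      fun q => coordD p u F q + coordD p u G q := by
  filter_upwards [hF, hG] with q hq hq'
  have := mvfderiv_fun_add hq.diffAt hq'.diffAt
  exact congrArg (fun T : TangentSpace (𝓡 n) q →L[ℝ] W => T (coordField p u q)) this

lemma JetEq.add (hF : ∀ᶠ q in 𝓝 p, SmoothAt n F q) (hG : ∀ᶠ q in 𝓝 p, SmoothAt n G q)
    (hF₁ : ∀ᶠ q in 𝓝 p, SmoothAt n F₁ q) (hG₁ : ∀ᶠ q in 𝓝 p, SmoothAt n G₁ q)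
    (h : JetEq n p k F F₁) (h' : JetEq n p k G G₁) :
    JetEq n p k (fun q => F q + G q) (fun q => F₁ q + G₁ q) := by
  induction k generalizing F G F₁ G₁ with
  | zero => exact congrArg₂ (· + ·) h h'
  | succ k ih =>
    refine ⟨congrArg₂ (· + ·) h.1 h'.1, fun u => ?_⟩
    exact (ih (smoothNear_coordD hF u) (smoothNear_coordD hG u) (smoothNear_coordD hF₁ u)
      (smoothNear_coordD hG₁ u) (h.2 u) (h'.2 u)).congr (coordD_add hF hG u) (coordD_add hF₁ hG₁ u)

lemma JetEq.clm (B : W →L[ℝ] W₁) (hF : ∀ᶠ q in 𝓝 p, SmoothAt n F q)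
    (hF₁ : ∀ᶠ q in 𝓝 p, SmoothAt n F₁ q) (h : JetEq n p k F F₁) :
    JetEq n p k (fun q => B (F q)) (fun q => B (F₁ q)) := by
  have hc : ∀ {F : M → W}, (∀ᶠ q in 𝓝 p, SmoothAt n F q) → ∀ u,
      coordD p u (fun q => B (F q)) =ᶠ[𝓝 p] fun q => B (coordD p u F q) := fun hF u =>
    hF.mono fun q hq => mvfderiv_clm B hq.diffAt _
  induction k generalizing F F₁ with
  | zero => exact congrArg B h
  | succ k ih =>
    exact ⟨congrArg B h.1, fun u => (ih (smoothNear_coordD hF u) (smoothNear_coordD hF₁ u)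
      (h.2 u)).congr (hc hF u) (hc hF₁ u)⟩

lemma coordD_bilin (B : W →L[ℝ] W₁ →L[ℝ] W₂) {G : M → W₁} (hF : ∀ᶠ q in 𝓝 p, SmoothAt n F q)
    (hG : ∀ᶠ q in 𝓝 p, SmoothAt n G q) (u : EuclideanSpace ℝ (Fin n)) :
    coordD p u (fun q => B (F q) (G q)) =ᶠ[𝓝 p]
      fun q => B (coordD p u F q) (G q) + B (F q) (coordD p u G q) := by
  filter_upwards [hF, hG] with q hq hq'
  exact mvfderiv_bilin B hq.diffAt hq'.diffAt _

lemma smoothNear_bilin (B : W →L[ℝ] W₁ →L[ℝ] W₂) {G : M → W₁}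
    (hF : ∀ᶠ q in 𝓝 p, SmoothAt n F q) (hG : ∀ᶠ q in 𝓝 p, SmoothAt n G q) :
    ∀ᶠ q in 𝓝 p, SmoothAt n (fun q => B (F q) (G q)) q := by
  filter_upwards [hF, hG] with q hq hq' using hq.bilin B hq'

lemma JetEq.bilin (B : W →L[ℝ] W₁ →L[ℝ] W₂) {G G₁ : M → W₁}
    (hF : ∀ᶠ q in 𝓝 p, SmoothAt n F q) (hG : ∀ᶠ q in 𝓝 p, SmoothAt n G q)
    (hF₁ : ∀ᶠ q in 𝓝 p, SmoothAt n F₁ q) (hG₁ : ∀ᶠ q in 𝓝 p, SmoothAt n G₁ q)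
    (h : JetEq n p k F F₁) (h' : JetEq n p k G G₁) :
    JetEq n p k (fun q => B (F q) (G q)) (fun q => B (F₁ q) (G₁ q)) := by
  induction k generalizing F G F₁ G₁ with
  | zero => exact congrArg₂ (fun x y => B x y) h h'
  | succ k ih =>
    refine ⟨congrArg₂ (fun x y => B x y) h.1 h'.1, fun u => ?_⟩
    have sF := smoothNear_coordD hF u
    have sG := smoothNear_coordD hG u
    have sF₁ := smoothNear_coordD hF₁ u
    have sG₁ := smoothNear_coordD hG₁ u
    exact (JetEq.add (smoothNear_bilin B sF hG) (smoothNear_bilin B hF sG)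
      (smoothNear_bilin B sF₁ hG₁) (smoothNear_bilin B hF₁ sG₁)
      (ih sF hG sF₁ hG₁ (h.2 u) h'.of_succ) (ih hF sG hF₁ sG₁ h.of_succ (h'.2 u))).congr
      (coordD_bilin B hF hG u) (coordD_bilin B hF₁ hG₁ u)

lemma JetEq.sub (hF : ∀ᶠ q in 𝓝 p, SmoothAt n F q) (hG : ∀ᶠ q in 𝓝 p, SmoothAt n G q)
    (hF₁ : ∀ᶠ q in 𝓝 p, SmoothAt n F₁ q) (hG₁ : ∀ᶠ q in 𝓝 p, SmoothAt n G₁ q)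
    (h : JetEq n p k F F₁) (h' : JetEq n p k G G₁) :
    JetEq n p k (fun q => F q - G q) (fun q => F₁ q - G₁ q) := by
  have := JetEq.add hF (hG.mono fun q hq => hq.neg) hF₁ (hG₁.mono fun q hq => hq.neg) h
    (JetEq.clm (-ContinuousLinearMap.id ℝ W) hG hG₁ h')
  simpa [sub_eq_add_neg] using this

lemma JetEq.sum {ι : Type*} {s : Finset ι} {F F₁ : ι → M → W}
    (hF : ∀ i, ∀ᶠ q in 𝓝 p, SmoothAt n (F i) q) (hF₁ : ∀ i, ∀ᶠ q in 𝓝 p, SmoothAt n (F₁ i) q)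
    (h : ∀ i, JetEq n p k (F i) (F₁ i)) :
    JetEq n p k (fun q => ∑ i ∈ s, F i q) (fun q => ∑ i ∈ s, F₁ i q) := by
  classical
  have hs : ∀ {s : Finset ι} {F : ι → M → W}, (∀ i, ∀ᶠ q in 𝓝 p, SmoothAt n (F i) q) →
      ∀ᶠ q in 𝓝 p, SmoothAt n (fun q => ∑ i ∈ s, F i q) q := by
    intro s F hF
    filter_upwards [(eventually_all_finset s).2 fun i _ => hF i] with q hq
    exact SmoothAt.sum hq
  induction s using Finset.induction_on with
  | empty => simpa using JetEq.refl _
  | insert i s hi ih =>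
    simp only [Finset.sum_insert hi]
    exact JetEq.add (hF i) (hs hF) (hF₁ i) (hs hF₁) (h i) ih

lemma JetEq.pi {ι : Type*} [Fintype ι] {F F₁ : ι → M → W}
    (hF : ∀ i, ∀ᶠ q in 𝓝 p, SmoothAt n (F i) q) (hF₁ : ∀ i, ∀ᶠ q in 𝓝 p, SmoothAt n (F₁ i) q)
    (h : ∀ i, JetEq n p k (F i) (F₁ i)) :
    JetEq n p k (fun q i => F i q) (fun q i => F₁ i q) := by
  classical
  have := JetEq.sum (s := Finset.univ)
    (F := fun i q => ContinuousLinearMap.single ℝ (fun _ : ι => W) i (F i q))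
    (F₁ := fun i q => ContinuousLinearMap.single ℝ (fun _ : ι => W) i (F₁ i q)) (p := p) (k := k)
    (fun i => (hF i).mono fun q hq => (ContinuousLinearMap.contMDiff _).contMDiffAt.comp q hq)
    (fun i => (hF₁ i).mono fun q hq => (ContinuousLinearMap.contMDiff _).contMDiffAt.comp q hq)
    fun i => JetEq.clm _ (hF i) (hF₁ i) (h i)
  have he : ∀ x : ι → W, ∑ i, ContinuousLinearMap.single ℝ (fun _ : ι => W) i (x i) = x := fun x =>
    Finset.univ_sum_single x
  simpa only [he] using this

/-- Solving a system of linear equations preserves the equality of jets. -/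
lemma JetEq.solve (B : W →L[ℝ] W₁ →L[ℝ] W₂) {ι : Type*} {m m₁ : ι → M → W₁} {b b₁ : ι → M → W₂}
    (hinj : ∀ w : W, (∀ i, B w (m i p) = 0) → w = 0)
    (sF : ∀ᶠ q in 𝓝 p, SmoothAt n F q) (sF₁ : ∀ᶠ q in 𝓝 p, SmoothAt n F₁ q)
    (sm : ∀ i, ∀ᶠ q in 𝓝 p, SmoothAt n (m i) q) (sm₁ : ∀ i, ∀ᶠ q in 𝓝 p, SmoothAt n (m₁ i) q)
    (hb : ∀ i, ∀ᶠ q in 𝓝 p, b i q = B (F q) (m i q))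
    (hb₁ : ∀ i, ∀ᶠ q in 𝓝 p, b₁ i q = B (F₁ q) (m₁ i q))
    (hm : ∀ i, JetEq n p k (m i) (m₁ i)) (hJ : ∀ i, JetEq n p k (b i) (b₁ i)) :
    JetEq n p k F F₁ := by
  induction k generalizing F F₁ b b₁ with
  | zero =>
    have h : F p - F₁ p = 0 := hinj _ fun i => by
      rw [map_sub, ContinuousLinearMap.sub_apply, ← (hb i).self_of_nhds, (hm i).eq,
        ← (hb₁ i).self_of_nhds, (hJ i).eq, sub_self]
    exact sub_eq_zero.1 h
  | succ k ih =>
    have h0 : JetEq n p k F F₁ := ih sF sF₁ hb hb₁ (fun i => (hm i).of_succ) fun i => (hJ i).of_succ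
    refine ⟨h0.eq, fun u => ?_⟩
    have sb : ∀ i, ∀ᶠ q in 𝓝 p, SmoothAt n (b i) q := fun i => by
      filter_upwards [smoothNear_bilin B sF (sm i), eventually_eventually_nhds.2 (hb i)]
        with q h1 h2
      exact h1.congr_of_eventuallyEq h2
    have sb₁ : ∀ i, ∀ᶠ q in 𝓝 p, SmoothAt n (b₁ i) q := fun i => by
      filter_upwards [smoothNear_bilin B sF₁ (sm₁ i), eventually_eventually_nhds.2 (hb₁ i)]
        with q h1 h2
      exact h1.congr_of_eventuallyEq h2
    -- the derivative of the equation `B F m = b` is a system for the derivative of `F`, with the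
    -- same coefficients `m` and with the right-hand sides `db - B F (dm)`
    refine ih (b := fun i q => coordD p u (b i) q - B (F q) (coordD p u (m i) q))
      (b₁ := fun i q => coordD p u (b₁ i) q - B (F₁ q) (coordD p u (m₁ i) q))
      (smoothNear_coordD sF u) (smoothNear_coordD sF₁ u) (fun i => ?_) (fun i => ?_)
      (fun i => (hm i).of_succ) fun i => ?_
    · filter_upwards [coordD_congr (hb i) u, coordD_bilin B sF (sm i) u] with q h1 h2
      rw [h1, h2]; abel
    · filter_upwards [coordD_congr (hb₁ i) u, coordD_bilin B sF₁ (sm₁ i) u] with q h1 h2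
      rw [h1, h2]; abel
    · exact JetEq.sub (smoothNear_coordD (sb i) u)
        (smoothNear_bilin B sF (smoothNear_coordD (sm i) u)) (smoothNear_coordD (sb₁ i) u)
        (smoothNear_bilin B sF₁ (smoothNear_coordD (sm₁ i) u)) ((hJ i).2 u)
        (JetEq.bilin B sF (smoothNear_coordD (sm i) u) sF₁ (smoothNear_coordD (sm₁ i) u) h0
          ((hm i).2 u))

/-- Positive functions whose squares have the same jets have the same jets. -/
lemma JetEq.of_mul_self {f g : M → ℝ} (sf : ∀ᶠ q in 𝓝 p, SmoothAt n f q)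
    (sg : ∀ᶠ q in 𝓝 p, SmoothAt n g q) (hf : 0 < f p) (hg : 0 < g p)
    (h : JetEq n p k (fun q => f q * f q) (fun q => g q * g q)) : JetEq n p k f g := by
  have hp : f p = g p := by
    have := h.eq
    nlinarith
  induction k with
  | zero => exact hp
  | succ k ih =>
    have h0 := ih h.of_succ
    refine ⟨hp, fun u => ?_⟩
    have hc : ∀ {f : M → ℝ}, (∀ᶠ q in 𝓝 p, SmoothAt n f q) → ∀ᶠ q in 𝓝 p,
        coordD p u (fun q => f q * f q) q =
          ContinuousLinearMap.mul ℝ ℝ (coordD p u f q) (f q + f q) := fun sf => by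
      filter_upwards [coordD_bilin (ContinuousLinearMap.mul ℝ ℝ) sf sf u] with q hq
      refine Eq.trans hq ?_
      simp only [ContinuousLinearMap.mul_apply']
      ring
    -- the derivative of `f` solves the linear equation `(f + f) df = d(f²)`
    refine JetEq.solve (ContinuousLinearMap.mul ℝ ℝ) (ι := Unit) (m := fun _ q => f q + f q)
      (m₁ := fun _ q => g q + g q) (b := fun _ => coordD p u (fun q => f q * f q))
      (b₁ := fun _ => coordD p u (fun q => g q * g q)) (fun w hw => ?_)
      (smoothNear_coordD sf u) (smoothNear_coordD sg u) (fun _ => sf.mono fun q hq => hq.add hq)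
      (fun _ => sg.mono fun q hq => hq.add hq) (fun _ => hc sf) (fun _ => hc sg)
      (fun _ => JetEq.add sf sf sg sg h0 h0) (fun _ => h.2 u)
    have h1 := hw ()
    simp only [ContinuousLinearMap.mul_apply', mul_eq_zero] at h1
    rcases h1 with h1 | h1
    · exact h1
    · linarith

/-- Equality of the jets, read in the chart, implies equality of the iterated derivatives along
coordinate fields. -/
lemma JetEq.of_sameJet {f g : M → Amb n} (sf : ∀ᶠ q in 𝓝 p, SmoothAt n f q)
    (sg : ∀ᶠ q in 𝓝 p, SmoothAt n g q) (h : SameJet k f g p) : JetEq n p k f g := by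
  have h0 : f p = g p := by
    have := congrArg (fun T => T 0) (h 0 (Nat.zero_le _))
    simpa using this
  induction k generalizing f g with
  | zero => exact h0
  | succ k ih =>
    refine ⟨h0, fun u => ?_⟩
    have key : ∀ {f : M → Amb n}, (∀ᶠ q in 𝓝 p, SmoothAt n f q) → ∀ j,
        iteratedFDeriv ℝ j (coordD p u f ∘ (extChartAt (𝓡 n) p).symm) (extChartAt (𝓡 n) p p) =
          (ContinuousLinearMap.apply ℝ (Amb n) u).compContinuousMultilinearMap
            (iteratedFDeriv ℝ j (fun y => fderiv ℝ (f ∘ (extChartAt (𝓡 n) p).symm) y)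
              (extChartAt (𝓡 n) p p)) := by
      intro f sf j
      have hs : ContDiffAt ℝ ∞ (f ∘ (extChartAt (𝓡 n) p).symm) (extChartAt (𝓡 n) p p) :=
        (contMDiffAt_iff_chart (mem_chart_source _ p) le_rfl).1 sf.self_of_nhds
      have hev : coordD p u f ∘ (extChartAt (𝓡 n) p).symm =ᶠ[𝓝 (extChartAt (𝓡 n) p p)]
          (ContinuousLinearMap.apply ℝ (Amb n) u) ∘
            fun y => fderiv ℝ (f ∘ (extChartAt (𝓡 n) p).symm) y := by
        have hcont : ContinuousAt (extChartAt (𝓡 n) p).symm (extChartAt (𝓡 n) p p) :=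
          continuousAt_extChartAt_symm p
        have h1 : ∀ᶠ y in 𝓝 (extChartAt (𝓡 n) p p),
            SmoothAt n f ((extChartAt (𝓡 n) p).symm y) ∧
              (extChartAt (𝓡 n) p).symm y ∈ (chartAt (EuclideanSpace ℝ (Fin n)) p).source := by
          have h3 := sf.and ((chartAt (EuclideanSpace ℝ (Fin n)) p).open_source.mem_nhds
            (mem_chart_source _ p))
          rw [ContinuousAt, extChartAt_to_inv] at hcont
          exact hcont.eventually h3
        have h2 : ∀ᶠ y in 𝓝 (extChartAt (𝓡 n) p p), y ∈ (extChartAt (𝓡 n) p).target :=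
          extChartAt_target_mem_nhds p
        filter_upwards [h1, h2] with y hy hyt
        simp only [Function.comp_apply, coordD]
        rw [mvfderiv_coordField hy.2 hy.1.diffAt, (extChartAt (𝓡 n) p).right_inv hyt]
        rfl
      rw [(hev.iteratedFDeriv ℝ j).self_of_nhds]
      have hd : ContDiffAt ℝ j (fun y => fderiv ℝ (f ∘ (extChartAt (𝓡 n) p).symm) y)
          (extChartAt (𝓡 n) p p) :=
        hs.fderiv_right (m := j) (by exact_mod_cast le_top)
      exact ContinuousLinearMap.iteratedFDeriv_comp_left _ hd le_rfl
    refine ih (smoothNear_coordD sf u) (smoothNear_coordD sg u) (fun j hj => ?_) ?_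
    · rw [key sf j, key sg j]
      congr 1
      ext m v : 2
      have h1 := congrArg (fun T => T (Fin.snoc m v)) (h (j + 1) (by omega))
      simp only [iteratedFDeriv_succ_apply_right, Fin.init_snoc, Fin.snoc_last] at h1
      exact h1
    · have h1 := h 1 (by omega)
      have sf1 := sf.self_of_nhds.diffAt
      have sg1 := sg.self_of_nhds.diffAt
      have h2 := congrArg (fun T => T (fun _ => u)) h1
      simp only [iteratedFDeriv_one_apply] at h2
      rw [coordD, coordD, mvfderiv_coordField (mem_chart_source _ p) sf1,
        mvfderiv_coordField (mem_chart_source _ p) sg1]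
      exact h2

end Jets
end DeSitter

end


/-! ### Jets of the point of tangency -/

noncomputable section
namespace DeSitter

section Jets

variable {n : ℕ} {M : Type*} [TopologicalSpace M] [ChartedSpace (EuclideanSpace ℝ (Fin n)) M]
  [IsManifold (𝓡 n) ∞ M] {p : M} {k : ℕ}

lemma IsLift.smoothNear {P : M → Submodule ℝ (Amb n)} {f : M → Amb n} (h : IsLift P p f) :
    ∀ᶠ q in 𝓝 p, SmoothAt n f q := h.mono fun _ hq => hq.1

lemma smoothNear_const {W : Type*} [NormedAddCommGroup W] [NormedSpace ℝ W] (c : W) :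
    ∀ᶠ q in 𝓝 p, SmoothAt n (fun _ => c) q := Eventually.of_forall fun _ => contMDiffAt_const

lemma smoothNear_form {F G : M → Amb n} (hF : ∀ᶠ q in 𝓝 p, SmoothAt n F q)
    (hG : ∀ᶠ q in 𝓝 p, SmoothAt n G q) : ∀ᶠ q in 𝓝 p, SmoothAt n (fun q => form n (F q) (G q)) q :=
  smoothNear_bilin (formL n) hF hG

lemma JetEq.form {F G F₁ G₁ : M → Amb n}
    (hF : ∀ᶠ q in 𝓝 p, SmoothAt n F q) (hG : ∀ᶠ q in 𝓝 p, SmoothAt n G q)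
    (hF₁ : ∀ᶠ q in 𝓝 p, SmoothAt n F₁ q) (hG₁ : ∀ᶠ q in 𝓝 p, SmoothAt n G₁ q)
    (h : JetEq n p k F F₁) (h' : JetEq n p k G G₁) :
    JetEq n p k (fun q => DeSitter.form n (F q) (G q)) (fun q => DeSitter.form n (F₁ q) (G₁ q)) :=
  JetEq.bilin (formL n) hF hG hF₁ hG₁ h h'

lemma JetEq.smul {W : Type*} [NormedAddCommGroup W] [NormedSpace ℝ W] {F F₁ : M → ℝ} {G G₁ : M → W}
    (hF : ∀ᶠ q in 𝓝 p, SmoothAt n F q) (hG : ∀ᶠ q in 𝓝 p, SmoothAt n G q)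
    (hF₁ : ∀ᶠ q in 𝓝 p, SmoothAt n F₁ q) (hG₁ : ∀ᶠ q in 𝓝 p, SmoothAt n G₁ q)
    (h : JetEq n p k F F₁) (h' : JetEq n p k G G₁) :
    JetEq n p k (fun q => F q • G q) (fun q => F₁ q • G₁ q) :=
  JetEq.bilin (ContinuousLinearMap.lsmul ℝ ℝ) hF hG hF₁ hG₁ h h'

lemma JetEq.inv {f g : M → ℝ} (sf : ∀ᶠ q in 𝓝 p, SmoothAt n f q)
    (sg : ∀ᶠ q in 𝓝 p, SmoothAt n g q) (hf : ∀ᶠ q in 𝓝 p, f q ≠ 0) (hg : ∀ᶠ q in 𝓝 p, g q ≠ 0)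
    (h : JetEq n p k f g) : JetEq n p k (fun q => (f q)⁻¹) (fun q => (g q)⁻¹) := by
  refine JetEq.solve (ContinuousLinearMap.mul ℝ ℝ) (ι := Unit) (m := fun _ => f)
    (m₁ := fun _ => g) (b := fun _ _ => 1) (b₁ := fun _ _ => 1) (fun w hw => ?_)
    ?_ ?_ (fun _ => sf) (fun _ => sg) (fun _ => ?_) (fun _ => ?_) (fun _ => h)
    fun _ => JetEq.refl _
  · have h1 := hw ()
    simpa [hf.self_of_nhds] using h1
  · filter_upwards [sf, hf] with q h1 h2 using h1.inv₀ h2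
  · filter_upwards [sg, hg] with q h1 h2 using h1.inv₀ h2
  · filter_upwards [hf] with q h1
    simp [h1]
  · filter_upwards [hg] with q h1
    simp [h1]

/-- The dot product, as a continuous bilinear map. -/
def dotL (ι : Type*) [Fintype ι] : (ι → ℝ) →L[ℝ] (ι → ℝ) →L[ℝ] ℝ :=
  (dotProductBilin ℝ ℝ).toContinuousBilinearMap

lemma dotL_apply {ι : Type*} [Fintype ι] (x y : ι → ℝ) : dotL ι x y = x ⬝ᵥ y := rfl

lemma eventually_det_ne_zero {ι : Type*} [Fintype ι] [DecidableEq ι] {H : M → Matrix ι ι ℝ}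
    (sH : ∀ i j, ∀ᶠ q in 𝓝 p, SmoothAt n (fun q => H q i j) q) (h : (H p).det ≠ 0) :
    ∀ᶠ q in 𝓝 p, (H q).det ≠ 0 := by
  have h1 : ContinuousAt (fun q => (H q).det) p := by
    have h2 : ContinuousAt H p := continuousAt_pi.2 fun i => continuousAt_pi.2 fun j =>
      (sH i j).self_of_nhds.continuousAt
    exact continuous_id.matrix_det.continuousAt.comp h2
  exact h1.eventually_ne h

lemma smoothNear_inv_mul {ι : Type*} [Fintype ι] [DecidableEq ι] {H K : M → Matrix ι ι ℝ}
    (sH : ∀ i j, ∀ᶠ q in 𝓝 p, SmoothAt n (fun q => H q i j) q)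
    (sK : ∀ i j, ∀ᶠ q in 𝓝 p, SmoothAt n (fun q => K q i j) q) (h : (H p).det ≠ 0) (i j : ι) :
    ∀ᶠ q in 𝓝 p, SmoothAt n (fun q => ((H q)⁻¹ * K q) i j) q := by
  filter_upwards [eventually_det_ne_zero sH h, eventually_all.2 fun i => eventually_all.2 (sH i),
    eventually_all.2 fun i => eventually_all.2 (sK i)] with q h0 hH hK
  simp only [Matrix.mul_apply]
  exact SmoothAt.sum fun l _ => (SmoothAt.inv_entry hH h0 i l).mul (hK l j)

lemma JetEq.inv_mul {ι : Type*} [Fintype ι] [DecidableEq ι] {H H₁ K K₁ : M → Matrix ι ι ℝ}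
    (sH : ∀ i j, ∀ᶠ q in 𝓝 p, SmoothAt n (fun q => H q i j) q)
    (sH₁ : ∀ i j, ∀ᶠ q in 𝓝 p, SmoothAt n (fun q => H₁ q i j) q)
    (sK : ∀ i j, ∀ᶠ q in 𝓝 p, SmoothAt n (fun q => K q i j) q)
    (sK₁ : ∀ i j, ∀ᶠ q in 𝓝 p, SmoothAt n (fun q => K₁ q i j) q)
    (h : (H p).det ≠ 0) (h₁ : (H₁ p).det ≠ 0)
    (jH : ∀ i j, JetEq n p k (fun q => H q i j) (fun q => H₁ q i j))
    (jK : ∀ i j, JetEq n p k (fun q => K q i j) (fun q => K₁ q i j)) (i j : ι) :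
    JetEq n p k (fun q => ((H q)⁻¹ * K q) i j) (fun q => ((H₁ q)⁻¹ * K₁ q) i j) := by
  have hpi : ∀ {F : ι → M → ℝ}, (∀ i, ∀ᶠ q in 𝓝 p, SmoothAt n (F i) q) →
      ∀ᶠ q in 𝓝 p, SmoothAt n (fun q i => F i q) q := fun hF => by
    filter_upwards [eventually_all.2 hF] with q hq using SmoothAt.pi hq
  have sX := fun i => smoothNear_inv_mul sH sK h i j
  have sX₁ := fun i => smoothNear_inv_mul sH₁ sK₁ h₁ i j
  have hs : ∀ {H K : M → Matrix ι ι ℝ}, (∀ᶠ q in 𝓝 p, (H q).det ≠ 0) → ∀ l, ∀ᶠ q in 𝓝 p,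
      K q l j = dotL ι (fun i => ((H q)⁻¹ * K q) i j) (fun m => H q l m) := by
    intro H K h0 l
    filter_upwards [h0] with q hq
    rw [dotL_apply, dotProduct_comm]
    change _ = (H q * ((H q)⁻¹ * K q)) l j
    rw [← Matrix.mul_assoc, Matrix.mul_nonsing_inv _ (isUnit_iff_ne_zero.2 hq), Matrix.one_mul]
  have key : JetEq n p k (fun q i => ((H q)⁻¹ * K q) i j) (fun q i => ((H₁ q)⁻¹ * K₁ q) i j) := by
    refine JetEq.solve (dotL ι) (ι := ι) (m := fun l q m => H q l m) (m₁ := fun l q m => H₁ q l m)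
      (b := fun l q => K q l j) (b₁ := fun l q => K₁ q l j) (fun w hw => ?_)
      (hpi sX) (hpi sX₁) (fun l => hpi (sH l)) (fun l => hpi (sH₁ l))
      (hs (eventually_det_ne_zero sH h)) (hs (eventually_det_ne_zero sH₁ h₁))
      (fun l => JetEq.pi (sH l) (sH₁ l) (jH l)) fun l => jK l j
    by_contra hne
    refine h (Matrix.exists_mulVec_eq_zero_iff.1 ⟨w, hne, funext fun l => ?_⟩)
    have := hw l
    rw [dotL_apply, dotProduct_comm] at this
    exact this
  exact JetEq.clm (ContinuousLinearMap.proj (R := ℝ) (φ := fun _ : ι => ℝ) i) (hpi sX) (hpi sX₁) key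

end Jets

namespace LightlikeHypersurface

variable {n : ℕ} {M : Type*} [TopologicalSpace M] [ChartedSpace (EuclideanSpace ℝ (Fin n)) M]
  [IsManifold (𝓡 n) ∞ M] {U U' : LightlikeHypersurface n M} {p : M} {k : ℕ}

lemma jetEq_normalize {f f' : M → Amb n} (hf : IsLift U.pt p f) (hf' : IsLift U'.pt p f')
    (h : JetEq n p k f f') :
    JetEq n p k (fun q => (√(form n (f q) (f q)))⁻¹ • f q)
      (fun q => (√(form n (f' q) (f' q)))⁻¹ • f' q) := by
  have hpos : ∀ {U : LightlikeHypersurface n M} {f : M → Amb n}, IsLift U.pt p f →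
      ∀ᶠ q in 𝓝 p, 0 < form n (f q) (f q) := fun hf =>
    hf.eventually.mono fun q hq => form_lift_pos hq
  have hs : ∀ {U : LightlikeHypersurface n M} {f : M → Amb n}, IsLift U.pt p f →
      ∀ᶠ q in 𝓝 p, SmoothAt n (fun q => √(form n (f q) (f q))) q := fun hf => by
    filter_upwards [hpos hf, smoothNear_form hf.smoothNear hf.smoothNear] with q h1 h2
    exact SmoothAt.comp_fun (φ := Real.sqrt) (Real.contDiffAt_sqrt h1.ne') h2
  have hne : ∀ {U : LightlikeHypersurface n M} {f : M → Amb n}, IsLift U.pt p f →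
      ∀ᶠ q in 𝓝 p, √(form n (f q) (f q)) ≠ 0 := fun hf =>
    (hpos hf).mono fun q hq => (Real.sqrt_pos.2 hq).ne'
  have hsq : ∀ {U : LightlikeHypersurface n M} {f : M → Amb n}, IsLift U.pt p f →
      (fun q => √(form n (f q) (f q)) * √(form n (f q) (f q))) =ᶠ[𝓝 p]
        fun q => form n (f q) (f q) := fun hf =>
    (hpos hf).mono fun q hq => Real.mul_self_sqrt hq.le
  have h1 : JetEq n p k (fun q => √(form n (f q) (f q))) (fun q => √(form n (f' q) (f' q))) :=
    JetEq.of_mul_self (hs hf) (hs hf') (Real.sqrt_pos.2 (hpos hf).self_of_nhds)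
      (Real.sqrt_pos.2 (hpos hf').self_of_nhds)
      ((JetEq.form hf.smoothNear hf.smoothNear hf'.smoothNear hf'.smoothNear h h).congr
        (hsq hf) (hsq hf'))
  have h2 := JetEq.inv (hs hf) (hs hf') (hne hf) (hne hf') h1
  refine JetEq.smul ?_ hf.smoothNear ?_ hf'.smoothNear h2 h
  · filter_upwards [hs hf, hne hf] with q h3 h4 using h3.inv₀ h4
  · filter_upwards [hs hf', hne hf'] with q h3 h4 using h3.inv₀ h4

lemma tangency_eq_of_jetEq {x x' : M → Amb n} (hx : IsLift U.pt p x) (hx' : IsLift U'.pt p x')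
    (h : JetEq n p (k + 1) x x') : U'.tangency p = U.tangency p := by
  unfold tangency tangentHyperplane
  rw [hx.projTangent_eq, hx'.projTangent_eq, h.eq, h.mvfderiv_eq]

/-- A lift of the point `A₀` on which a given linear form takes the value `-1`. -/
lemma exists_lift_tangency {O : Set M} (𝔄 : U.Frame O) (hp : p ∈ O) {c : Amb n}
    (hc : form n (𝔄.A0 p) c ≠ 0) :
    ∃ a, IsLift U.tangency p a ∧ ∀ᶠ q in 𝓝 p, form n (a q) c = -1 := by
  have hs : SmoothAt n (fun q => form n (𝔄.A0 q) c) p :=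
    (𝔄.smoothAt_A0 hp).form contMDiffAt_const
  have hne : ∀ᶠ q in 𝓝 p, form n (𝔄.A0 q) c ≠ 0 := hs.continuousAt.eventually_ne hc
  refine ⟨fun q => (-(form n (𝔄.A0 q) c)⁻¹) • 𝔄.A0 q, ?_, ?_⟩
  · filter_upwards [hne, 𝔄.eventually_mem hp] with q h1 hq
    have h2 : SmoothAt n (fun q => form n (𝔄.A0 q) c) q :=
      (𝔄.smoothAt_A0 hq).form contMDiffAt_const
    have h3 : -(form n (𝔄.A0 q) c)⁻¹ ≠ 0 := neg_ne_zero.2 (inv_ne_zero h1)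
    refine ⟨((h2.inv₀ h1).neg).smul (𝔄.smoothAt_A0 hq), smul_ne_zero h3 (𝔄.A0_ne hq), ?_⟩
    rw [𝔄.tangency_eq hq, Submodule.span_singleton_smul_eq (isUnit_iff_ne_zero.2 h3)]
  · filter_upwards [hne] with q h1
    simp [h1]

/-- The point `A₀` is polar to the point `x` and its derivatives, so that the `k`-jet of its lift,
normalized by a linear form, is found from the `k + 1`-jet of `x`. -/
lemma jetEq_tangency {x x' a a' : M → Amb n} {c : Amb n}
    (hx : IsLift U.pt p x) (hx' : IsLift U'.pt p x') (ha : IsLift U.tangency p a)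
    (ha' : IsLift U'.tangency p a') (hc : ∀ᶠ q in 𝓝 p, form n (a q) c = -1)
    (hc' : ∀ᶠ q in 𝓝 p, form n (a' q) c = -1) (h : JetEq n p (k + 1) x x') :
    JetEq n p k a a' := by
  -- `a` is the solution of the equations `(a, x) = 0`, `(a, c) = -1`, `(a, dx(u)) = 0`
  let m : (M → Amb n) → Option (Option (EuclideanSpace ℝ (Fin n))) → M → Amb n := fun x i =>
    match i with
    | none => x
    | some none => fun _ => c
    | some (some u) => coordD p u x
  let b : Option (Option (EuclideanSpace ℝ (Fin n))) → M → ℝ := fun i =>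
    match i with
    | none => fun _ => 0
    | some none => fun _ => -1
    | some (some u) => fun _ => 0
  have hs : ∀ {x : M → Amb n}, (∀ᶠ q in 𝓝 p, SmoothAt n x q) → ∀ i,
      ∀ᶠ q in 𝓝 p, SmoothAt n (m x i) q := by
    intro x hx i
    match i with
    | none => exact hx
    | some none => exact smoothNear_const c
    | some (some u) => exact smoothNear_coordD hx u
  have hb : ∀ {U : LightlikeHypersurface n M} {x a : M → Amb n}, IsLift U.pt p x →
      IsLift U.tangency p a → (∀ᶠ q in 𝓝 p, form n (a q) c = -1) → ∀ i, ∀ᶠ q in 𝓝 p,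
        b i q = formL n (a q) (m x i q) := by
    intro U x a hx ha hc i
    have hmem : ∀ᶠ q in 𝓝 p, ∀ w ∈ U.tangentHyperplane q, form n (a q) w = 0 := by
      filter_upwards [ha.eventually] with q hq w hw
      refine (mem_tangentHyperplane_iff ?_ hq.ne_zero).1 hw
      rw [hq.eq]
      exact Submodule.mem_span_singleton_self _
    match i with
    | none =>
      filter_upwards [hx.eventually, hmem] with q h1 h2
      exact (h2 _ (lift_mem_tangentHyperplane h1)).symm
    | some none =>
      filter_upwards [hc] with q h1
      exact h1.symm
    | some (some u) =>
      filter_upwards [hx.eventually, hmem] with q h1 h2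
      exact (h2 _ (mvfderiv_lift_mem_tangentHyperplane h1 _)).symm
  refine JetEq.solve (formL n) (m := m x) (m₁ := m x') (b := b) (b₁ := b) (fun w hw => ?_)
    ha.smoothNear ha'.smoothNear (hs hx.smoothNear) (hs hx'.smoothNear) (hb hx ha hc)
    (hb hx' ha' hc') (fun i => ?_) fun i => JetEq.refl _
  · have h1 : w ∈ U.tangency p := by
      unfold tangency tangentHyperplane
      rw [hx.projTangent_eq]
      intro y hy
      change form n y w = 0
      obtain ⟨s, hs, t, ht, rfl⟩ := Submodule.mem_sup.1 hy
      obtain ⟨d, rfl⟩ := Submodule.mem_span_singleton.1 hs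
      obtain ⟨v, rfl⟩ := ht
      have e1 : form n w (x p) = 0 := hw none
      have e2 : form n w (mvfderiv (𝓡 n) x p v) = 0 := by
        have := hw (some (some v))
        change form n w (coordD p v x p) = 0 at this
        rw [coordD_at p v x] at this
        exact this
      rw [form_comm] at e1 e2
      have e3 : form n (((mvfderiv (𝓡 n) x p).toLinearMap) v) w = 0 := e2
      rw [map_add, LinearMap.add_apply, e3, map_smul, LinearMap.smul_apply, e1]
      simp
    rw [ha.eq] at h1
    obtain ⟨d, rfl⟩ := Submodule.mem_span_singleton.1 h1
    have h2 : form n (d • a p) c = 0 := hw (some none)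
    rw [map_smul, LinearMap.smul_apply, hc.self_of_nhds] at h2
    have : d = 0 := by simpa using h2
    rw [this, zero_smul]
  · match i with
    | none => exact h.of_succ
    | some none => exact JetEq.refl _
    | some (some u) => exact h.2 u

end LightlikeHypersurface
end DeSitter

end


/-! ### Dependence on the third-order neighborhood -/

noncomputable section
namespace DeSitter
namespace LightlikeHypersurface

variable {n : ℕ} {M : Type*} [TopologicalSpace M] [ChartedSpace (EuclideanSpace ℝ (Fin n)) M]
  [IsManifold (𝓡 n) ∞ M] {U U' : LightlikeHypersurface n M} {p : M}

namespace Frame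

variable {O O' : Set M} (𝔄 : U.Frame O) (𝔄' : U'.Frame O')

/-- The `1`-jet of `λ` is found from the `2`-jets of `A₀` and `A_n`: `λ` is, up to a factor, the
trace of the form `(dA₀, dA_n)` with respect to the form `(dA₀, dA₀)`. -/
lemma jetEq_lamMean (hn : 2 ≤ n) (hp : p ∈ O) (hp' : p ∈ O') (hU : U.MaximalRank)
    (hU' : U'.MaximalRank) (h0 : JetEq n p 2 𝔄.A0 𝔄'.A0) (h1 : JetEq n p 2 𝔄.An 𝔄'.An) :
    JetEq n p 1 (fun q => 𝔄.lamMean q) (fun q => 𝔄'.lamMean q) := by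
  obtain ⟨e, he⟩ := 𝔄.exists_dual hn hp (hU p)
  let u : Fin (n - 1) → EuclideanSpace ℝ (Fin n) := e
  have s0 : ∀ᶠ q in 𝓝 p, SmoothAt n 𝔄.A0 q := (𝔄.eventually_mem hp).mono fun q => 𝔄.smoothAt_A0
  have s0' : ∀ᶠ q in 𝓝 p, SmoothAt n 𝔄'.A0 q :=
    (𝔄'.eventually_mem hp').mono fun q => 𝔄'.smoothAt_A0
  have s1 : ∀ᶠ q in 𝓝 p, SmoothAt n 𝔄.An q := (𝔄.eventually_mem hp).mono fun q => 𝔄.smoothAt_An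
  have s1' : ∀ᶠ q in 𝓝 p, SmoothAt n 𝔄'.An q :=
    (𝔄'.eventually_mem hp').mono fun q => 𝔄'.smoothAt_An
  let G : (M → Amb n) → (M → Amb n) → M → Matrix (Fin (n - 1)) (Fin (n - 1)) ℝ := fun a x q =>
    Matrix.of fun i j => form n (coordD p (u i) a q) (coordD p (u j) x q)
  have sG : ∀ {a x : M → Amb n}, (∀ᶠ q in 𝓝 p, SmoothAt n a q) → (∀ᶠ q in 𝓝 p, SmoothAt n x q) →
      ∀ i j, ∀ᶠ q in 𝓝 p, SmoothAt n (fun q => G a x q i j) q := fun ha hx i j =>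
    smoothNear_form (smoothNear_coordD ha _) (smoothNear_coordD hx _)
  have hH0 : (G 𝔄.A0 𝔄.A0 p).det ≠ 0 := by
    have h2 : G 𝔄.A0 𝔄.A0 p = 𝔄.g p := by
      rw [← 𝔄.gram_dual hn hp he]
      ext i j
      simp only [G, Matrix.of_apply, coordD_at]
      rfl
    rw [h2]
    exact 𝔄.det_g_ne_zero hn hp
  have hH0' : (G 𝔄'.A0 𝔄'.A0 p).det ≠ 0 := by
    have h2 : G 𝔄'.A0 𝔄'.A0 p = G 𝔄.A0 𝔄.A0 p := by
      ext i j
      simp only [G, Matrix.of_apply, coordD_at, h0.mvfderiv_eq]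
    rw [h2]
    exact hH0
  have hev : ∀ {U : LightlikeHypersurface n M} {O : Set M} (𝔄 : U.Frame O), U.MaximalRank → p ∈ O →
      (∀ᶠ q in 𝓝 p, (G 𝔄.A0 𝔄.A0 q).det ≠ 0) → (fun q => 𝔄.lamMean q) =ᶠ[𝓝 p] fun q =>
        (-(1 / ((n : ℝ) - 1))) • ∑ i, ((G 𝔄.A0 𝔄.A0 q)⁻¹ * G 𝔄.A0 𝔄.An q) i i := by
    intro U O 𝔄 hU hp hdet
    filter_upwards [𝔄.eventually_mem hp, hdet] with q hq hd
    rw [𝔄.lamMean_eq_trace hn hq (hU q) (fun i => coordField p (u i) q) (fun i j => rfl)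
      (fun i j => rfl) hd, smul_eq_mul, neg_mul]
    rfl
  have sH := sG s0 s0
  have sH' := sG s0' s0'
  have sK := sG s0 s1
  have sK' := sG s0' s1'
  have jG : ∀ {a x a' x' : M → Amb n}, (∀ᶠ q in 𝓝 p, SmoothAt n a q) →
      (∀ᶠ q in 𝓝 p, SmoothAt n x q) → (∀ᶠ q in 𝓝 p, SmoothAt n a' q) →
      (∀ᶠ q in 𝓝 p, SmoothAt n x' q) → JetEq n p 2 a a' → JetEq n p 2 x x' →
      ∀ i j, JetEq n p 1 (fun q => G a x q i j) (fun q => G a' x' q i j) :=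
    fun ha hx ha' hx' h h' i j => JetEq.form (smoothNear_coordD ha _) (smoothNear_coordD hx _)
      (smoothNear_coordD ha' _) (smoothNear_coordD hx' _) (h.2 _) (h'.2 _)
  have sX := smoothNear_inv_mul sH sK hH0
  have sX' := smoothNear_inv_mul sH' sK' hH0'
  have jX := JetEq.inv_mul sH sH' sK sK' hH0 hH0' (jG s0 s0 s0' s0' h0 h0) (jG s0 s1 s0' s1' h0 h1)
  have hsum : ∀ {X : M → Matrix (Fin (n - 1)) (Fin (n - 1)) ℝ},
      (∀ i j, ∀ᶠ q in 𝓝 p, SmoothAt n (fun q => X q i j) q) →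
      ∀ᶠ q in 𝓝 p, SmoothAt n (fun q => ∑ i, X q i i) q := fun hX => by
    filter_upwards [eventually_all.2 fun i => hX i i] with q hq
    exact SmoothAt.sum fun i _ => hq i
  exact (JetEq.smul (smoothNear_const _) (hsum sX) (smoothNear_const _) (hsum sX') (JetEq.refl _)
    (JetEq.sum (fun i => sX i i) (fun i => sX' i i) fun i => jX i i)).congr
    (hev 𝔄 hU hp (eventually_det_ne_zero sH hH0)) (hev 𝔄' hU' hp' (eventually_det_ne_zero sH' hH0'))

lemma jetEq_C (hn : 2 ≤ n) (hp : p ∈ O) (hp' : p ∈ O') (hU : U.MaximalRank)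
    (hU' : U'.MaximalRank) (h0 : JetEq n p 2 𝔄.A0 𝔄'.A0) (h1 : JetEq n p 2 𝔄.An 𝔄'.An) :
    JetEq n p 1 𝔄.C 𝔄'.C := by
  have hl := 𝔄.jetEq_lamMean 𝔄' hn hp hp' hU hU' h0 h1
  have s0 : ∀ {U : LightlikeHypersurface n M} {O : Set M} (𝔄 : U.Frame O), p ∈ O →
      ∀ᶠ q in 𝓝 p, SmoothAt n 𝔄.A0 q := fun 𝔄 hp =>
    (𝔄.eventually_mem hp).mono fun q => 𝔄.smoothAt_A0
  have s1 : ∀ {U : LightlikeHypersurface n M} {O : Set M} (𝔄 : U.Frame O), p ∈ O →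
      ∀ᶠ q in 𝓝 p, SmoothAt n 𝔄.An q := fun 𝔄 hp =>
    (𝔄.eventually_mem hp).mono fun q => 𝔄.smoothAt_An
  have sl : ∀ {U : LightlikeHypersurface n M} {O : Set M} (𝔄 : U.Frame O), U.MaximalRank → p ∈ O →
      ∀ᶠ q in 𝓝 p, SmoothAt n (fun q => 𝔄.lamMean q) q := fun 𝔄 hU hp =>
    (𝔄.eventually_mem hp).mono fun q => 𝔄.smoothAt_lamMean hn fun q _ => hU q
  have sm : ∀ {U : LightlikeHypersurface n M} {O : Set M} (𝔄 : U.Frame O), U.MaximalRank → p ∈ O →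
      ∀ᶠ q in 𝓝 p, SmoothAt n (fun q => 𝔄.lamMean q • 𝔄.A0 q) q := fun 𝔄 hU hp => by
    filter_upwards [sl 𝔄 hU hp, s0 𝔄 hp] with q h2 h3 using h2.smul h3
  exact JetEq.add (s1 𝔄 hp) (sm 𝔄 hU hp) (s1 𝔄' hp') (sm 𝔄' hU' hp') h1.of_succ
    (JetEq.smul (sl 𝔄 hU hp) (s0 𝔄 hp) (sl 𝔄' hU' hp') (s0 𝔄' hp') hl h0.of_succ)

end Frame

/-- The third-order neighborhood of the hypersurface determines `ζ`, `T_C(W)` and the screen. -/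
lemma eq_of_jetEq (hn : 2 ≤ n) (hU : U.MaximalRank) (hU' : U'.MaximalRank)
    {O O' : Set M} (𝔄 : U.Frame O) (𝔄' : U'.Frame O') (hp : p ∈ O) (hp' : p ∈ O')
    {x x' : M → Amb n} (hx : IsLift U.pt p x) (hx' : IsLift U'.pt p x')
    (h1 : ∀ᶠ q in 𝓝 p, form n (x q) (x q) = 1) (h1' : ∀ᶠ q in 𝓝 p, form n (x' q) (x' q) = 1)
    (h : JetEq n p 3 x x') :
    U'.tangentW p = U.tangentW p ∧ U'.zeta p = U.zeta p ∧ U'.screen p = U.screen p ∧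
      U'.screenDistribution p = U.screenDistribution p := by
  have ht : U'.tangency p = U.tangency p := tangency_eq_of_jetEq hx hx' h
  -- the vertex `A_{n+1}(p)` serves as a constant vector that normalizes the lifts of both points
  -- of tangency
  have hc : form n (𝔄.A0 p) (𝔄.Ainf p) ≠ 0 := by simp [𝔄.gram_0_inf p hp]
  have hc' : form n (𝔄'.A0 p) (𝔄.Ainf p) ≠ 0 := by
    have h2 : 𝔄'.A0 p ∈ U.tangency p := by rw [← ht]; exact 𝔄'.A0_mem p hp'
    rw [𝔄.tangency_eq hp] at h2
    obtain ⟨d, hd⟩ := Submodule.mem_span_singleton.1 h2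
    rw [← hd, map_smul, LinearMap.smul_apply]
    refine smul_ne_zero ?_ hc
    rintro rfl
    rw [zero_smul] at hd
    exact 𝔄'.A0_ne hp' hd.symm
  obtain ⟨a, ha, hac⟩ := exists_lift_tangency 𝔄 hp hc
  obtain ⟨a', ha', hac'⟩ := exists_lift_tangency 𝔄' hp' hc'
  obtain ⟨O₁, 𝔅, hq, h𝔅0, -, h𝔅n⟩ := 𝔄.exists_frame_unit_lift hn hp ha hx h1
  obtain ⟨O₁', 𝔅', hq', h𝔅0', -, h𝔅n'⟩ := 𝔄'.exists_frame_unit_lift hn hp' ha' hx' h1'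
  have hj : JetEq n p 1 𝔅.C 𝔅'.C := by
    refine 𝔅.jetEq_C 𝔅' hn hq hq' hU hU' ?_ ?_
    · rw [h𝔅0, h𝔅0']
      exact jetEq_tangency hx hx' ha ha' hac hac' h
    · rw [h𝔅n, h𝔅n']
      exact h.of_succ
  have hV : ∀ q ∈ O₁, finrank ℝ (U.tangentV q) = n := fun q _ => hU q
  have hV' : ∀ q ∈ O₁', finrank ℝ (U'.tangentV q) = n := fun q _ => hU' q
  have hz : U'.zeta p = U.zeta p := by
    rw [𝔅.zeta_eq_range hn hV hq, 𝔅'.zeta_eq_range hn hV' hq', hj.mvfderiv_eq]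
  have hpt : U'.pt p = U.pt p := by rw [hx.eq, hx'.eq, h.eq]
  have hs : U'.screen p = U.screen p := by unfold screen; rw [hz, hpt]
  refine ⟨?_, hz, hs, ?_⟩
  · rw [𝔅.tangentW_eq hn hV hq, 𝔅'.tangentW_eq hn hV' hq', ← 𝔅.zeta_eq hn hV hq,
      ← 𝔅'.zeta_eq hn hV' hq', hz, hj.eq]
  · unfold screenDistribution
    rw [hx.directionsIn_eq (S := U.screen p) le_sup_left,
      hx'.directionsIn_eq (S := U'.screen p) le_sup_left, hs, h.mvfderiv_eq]

/-- The second derivative along a field is determined by the `2`-jet of the function, even for a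
field that is only differentiable at `p`. -/
lemma mvfderiv_field_of_jetEq {x x' : M → Amb n} (sx : ∀ᶠ q in 𝓝 p, SmoothAt n x q)
    (sx' : ∀ᶠ q in 𝓝 p, SmoothAt n x' q) (h : JetEq n p 2 x x')
    {Y : (q : M) → TangentSpace (𝓡 n) q} (hY : FieldDiffAt Y p) :
    mvfderiv (𝓡 n) (fun q => mvfderiv (𝓡 n) x q (Y q)) p =
      mvfderiv (𝓡 n) (fun q => mvfderiv (𝓡 n) x' q (Y q)) p := by
  obtain ⟨c, y, hc⟩ := mvfderiv_mvfderiv_field (W := Amb n) hY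
  ext1 v
  rw [hc x sx.self_of_nhds, hc x' sx'.self_of_nhds]
  refine Finset.sum_congr rfl fun i _ => ?_
  have h2 := (h.2 (EuclideanSpace.basisFun (Fin n) ℝ i)).mvfderiv_eq
  rw [h.mvfderiv_eq]
  congr 2
  exact congrArg (fun T : TangentSpace (𝓡 n) p →L[ℝ] Amb n => T v) h2

/-- The connection is determined at a point by the `2`-jet of the point `x` together with the
normalizing subspace there. -/
lemma connection_eq_of_jetEq (hn : 2 ≤ n) (hU : U.MaximalRank) (ha : U.Nondegenerate)
    (hU' : U'.MaximalRank) (ha' : U'.Nondegenerate)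
    {x x' : M → Amb n} (hx : IsLift U.pt p x) (hx' : IsLift U'.pt p x')
    (h1 : ∀ᶠ q in 𝓝 p, form n (x q) (x q) = 1) (h1' : ∀ᶠ q in 𝓝 p, form n (x' q) (x' q) = 1)
    (h : JetEq n p 2 x x') (hz : U'.zeta p = U.zeta p) {D D' : Connection n M}
    (hD : U.IsInducedConnection U.zeta D) (hD' : U'.IsInducedConnection U'.zeta D')
    {Y : (q : M) → TangentSpace (𝓡 n) q} (hY : FieldDiffAt Y p) (v : TangentSpace (𝓡 n) p) :
    D' Y p v = D Y p v := by
  rw [isInducedConnection_iff hn] at hD hD'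
  obtain ⟨O, 𝔄, hp, hAx, hr⟩ := exists_reduced_of_lift hn hU ha hx h1
  obtain ⟨O', 𝔄', hp', hAx', hr'⟩ := exists_reduced_of_lift hn hU' ha' hx' h1'
  have ht : U'.tangency p = U.tangency p := tangency_eq_of_jetEq hx hx' h
  have h2 : 𝔄'.A0 p ∈ ℝ ∙ 𝔄.A0 p := by
    rw [← 𝔄.tangency_eq hp, ← ht]
    exact 𝔄'.A0_mem p hp'
  obtain ⟨c, hc⟩ := Submodule.mem_span_singleton.1 h2
  have e1 : mvfderiv (𝓡 n) 𝔄'.An p = mvfderiv (𝓡 n) 𝔄.An p := by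
    rw [hAx, hAx', h.mvfderiv_eq]
  have e2 : 𝔄'.secondDeriv Y p = 𝔄.secondDeriv Y p := by
    unfold Frame.secondDeriv
    rw [hAx, hAx', mvfderiv_field_of_jetEq hx.smoothNear hx'.smoothNear h hY]
  have h3 := hD O 𝔄 hr p hp Y hY v
  rw [← sub_eq_zero, ← map_sub] at h3
  have h4 := 𝔄.tangentCoords_change 𝔄' hn hp hp' hc.symm
    (by rw [hAx, hAx', h.eq]; exact Submodule.mem_span_singleton_self _)
    (by rw [← hr.2 p hp, ← hr'.2 p hp', hz]) h3
  rw [map_sub, sub_eq_zero] at h4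
  apply 𝔄'.eq_of_tangentCoords hn hp' hr'.1
  rw [hD' O' 𝔄' hr' p hp' Y hY v, e1, e2, h4]

end LightlikeHypersurface
end DeSitter

end


theorem theorem6 {n : ℕ} (hn : 2 ≤ n)
    {M : Type*} [TopologicalSpace M] [ChartedSpace (EuclideanSpace ℝ (Fin n)) M]
    [IsManifold (𝓡 n) ∞ M]
    (U : DeSitter.LightlikeHypersurface n M) (hU : U.MaximalRank) (ha : U.Nondegenerate) :
    -- the points `C`, `C_i`, found in any adapted frame, span `T_C(W)`, and `C_1 ∧ … ∧ C_{n-1} = ζ`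
    (∀ (O : Set M) (𝔄 : U.Frame O), ∀ p ∈ O,
      𝔄.Expansions p ∧ (𝔄.a p).det ≠ 0 ∧
      U.pole p = Submodule.span ℝ {𝔄.C p} ∧
      LinearIndependent ℝ (𝔄.Ci p) ∧
      U.zeta p = Submodule.span ℝ (Set.range (𝔄.Ci p)) ∧
      U.tangentW p = Submodule.span ℝ {𝔄.C p} ⊔ Submodule.span ℝ (Set.range (𝔄.Ci p))) ∧
    (∀ p, Module.finrank ℝ (U.tangentW p) = n ∧ U.zeta p = U.tangentV p ⊓ U.tangentW p) ∧
    -- the subspaces `ζ` form a normalization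
    U.IsNormalization U.zeta ∧
    -- it induces a torsion-free affine connection
    (∃ D : DeSitter.LightlikeHypersurface.Connection n M,
      U.IsInducedConnection U.zeta D ∧ DeSitter.LightlikeHypersurface.IsSmoothConnection D ∧
      D.torsion = 0) ∧
    -- it defines a screen distribution
    (∀ p, U.screen p ≤ U.tangentHyperplane p ∧
      U.screen p ⊓ U.generator p = U.pt p ∧
      U.screen p ⊔ U.generator p = U.tangentHyperplane p ∧
      Module.finrank ℝ (U.screenDistribution p) = n - 1 ∧
      IsCompl (U.screenDistribution p) (U.isotropicDistribution p)) ∧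
    (∀ (O : Set M) (𝔄 : U.Frame O), 𝔄.Reduced U.zeta → ∀ p ∈ O,
      ∀ v, v ∈ U.screenDistribution p ↔ 𝔄.wn0 p v = 0) ∧
    -- invariance under motions and under changes of the parametrization
    (∀ {M' : Type*} [TopologicalSpace M'] [ChartedSpace (EuclideanSpace ℝ (Fin n)) M']
      [IsManifold (𝓡 n) ∞ M'] (U' : DeSitter.LightlikeHypersurface n M')
      (φ : M' → M), IsLocalDiffeomorph (𝓡 n) (𝓡 n) ∞ φ →
      ∀ L : DeSitter.Amb n ≃ₗ[ℝ] DeSitter.Amb n,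
        (∀ x y, DeSitter.form n (L x) (L y) = DeSitter.form n x y) →
        (∀ q, U'.pt q = (U.pt (φ q)).map L.toLinearMap) →
        (∀ q, U'.pole q = (U.pole (φ q)).map L.toLinearMap ∧
          U'.zeta q = (U.zeta (φ q)).map L.toLinearMap ∧
          U'.screen q = (U.screen (φ q)).map L.toLinearMap ∧
          U'.screenDistribution q =
            (U.screenDistribution (φ q)).comap (mfderiv (𝓡 n) (𝓡 n) φ q).toLinearMap) ∧
        ∀ (D : DeSitter.LightlikeHypersurface.Connection n M)
          (D' : DeSitter.LightlikeHypersurface.Connection n M'),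
          U.IsInducedConnection U.zeta D → U'.IsInducedConnection U'.zeta D' →
          ∀ (q : M') (Y : (p : M) → TangentSpace (𝓡 n) p)
            (Y' : (p : M') → TangentSpace (𝓡 n) p),
            DeSitter.LightlikeHypersurface.FieldDiffAt Y (φ q) →
            DeSitter.LightlikeHypersurface.FieldDiffAt Y' q →
            (∀ᶠ r in nhds q, mfderiv (𝓡 n) (𝓡 n) φ r (Y' r) = Y (φ r)) →
            ∀ v, mfderiv (𝓡 n) (𝓡 n) φ q (D' Y' q v) =
              D Y (φ q) (mfderiv (𝓡 n) (𝓡 n) φ q v)) ∧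
    -- independence of the location of the point `x` on the generators
    (∀ (U' : DeSitter.LightlikeHypersurface n M) (p : M),
      (∀ᶠ q in nhds p, U'.generator q = U.generator q) →
      U'.pole p = U.pole p ∧ U'.zeta p = U.zeta p) ∧
    -- dependence on the third-order neighborhood only
    (∀ (U' : DeSitter.LightlikeHypersurface n M), U'.MaximalRank → U'.Nondegenerate → ∀ p : M,
      DeSitter.SamePointJet 3 U.pt U'.pt p →
      (U'.tangentW p = U.tangentW p ∧ U'.zeta p = U.zeta p ∧ U'.screen p = U.screen p ∧
        U'.screenDistribution p = U.screenDistribution p) ∧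
      (DeSitter.SamePointJet 3 U.tangency U'.tangency p →
        ∀ D D' : DeSitter.LightlikeHypersurface.Connection n M,
          U.IsInducedConnection U.zeta D → U'.IsInducedConnection U'.zeta D' →
          ∀ Y : (q : M) → TangentSpace (𝓡 n) q, DeSitter.LightlikeHypersurface.FieldDiffAt Y p →
            ∀ v, D' Y p v = D Y p v)) := by
  have hV : ∀ O : Set M, ∀ q ∈ O, Module.finrank ℝ (U.tangentV q) = n := fun _ q _ => hU q
  refine ⟨fun O 𝔄 p hp => ?_, fun p => ?_,
    DeSitter.LightlikeHypersurface.isNormalization_zeta hn hU ha, ?_, fun p => ?_,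
    fun O 𝔄 hr p hp v => 𝔄.mem_screenDistribution_iff hn hp hr v, ?_, ?_, ?_⟩
  · have hd := DeSitter.LightlikeHypersurface.det_a_ne_zero hn hU ha 𝔄 hp
    exact ⟨𝔄.expansions hn (hV O) hp, hd, 𝔄.pole_eq hn hp (hU p), 𝔄.linearIndependent_Ci hn hp hd,
      𝔄.zeta_eq hn (hV O) hp, 𝔄.tangentW_eq hn (hV O) hp⟩
  · obtain ⟨O, 𝔄, hp, hd⟩ := ha p
    exact ⟨𝔄.finrank_tangentW hn (hV O) hp hd, 𝔄.zeta_eq_inf hn (hV O) hp⟩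
  · have hD := DeSitter.LightlikeHypersurface.isInducedConnection_inducedConnection hn hU ha
    have hr := DeSitter.LightlikeHypersurface.exists_reduced hn hU ha
    exact ⟨_, hD, DeSitter.LightlikeHypersurface.isSmoothConnection_of_isInducedConnection hn hD hr,
      DeSitter.LightlikeHypersurface.torsion_eq_zero_of_isInducedConnection hn hD hr⟩
  · obtain ⟨O, 𝔄, hp, hr⟩ := DeSitter.LightlikeHypersurface.exists_reduced hn hU ha p
    exact ⟨𝔄.screen_le hp hr, 𝔄.screen_inf_generator hn hp hr, 𝔄.screen_sup_generator hn hp hr,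
      𝔄.finrank_screenDistribution hn hp hr, 𝔄.isCompl_screenDistribution hn hp hr⟩
  · intro M' _ _ _ U' φ hφ L hL hpt
    refine ⟨fun q => ?_, fun D D' hD hD' q Y Y' hY hY' hYY v => ?_⟩
    · obtain ⟨O, 𝔄, hp, -⟩ := ha (φ q)
      exact ⟨DeSitter.LightlikeHypersurface.pole_push hφ hL hpt 𝔄 hn (hV O) hp,
        DeSitter.LightlikeHypersurface.zeta_push hφ hL hpt 𝔄 hn (hV O) hp,
        DeSitter.LightlikeHypersurface.screen_push hφ hL hpt 𝔄 hn (hV O) hp,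
        DeSitter.LightlikeHypersurface.screenDistribution_push hφ hL hpt 𝔄 hn (hV O) hp⟩
    · obtain ⟨O, 𝔄, hp, hr⟩ := DeSitter.LightlikeHypersurface.exists_reduced hn hU ha (φ q)
      exact DeSitter.LightlikeHypersurface.connection_push hφ hL hpt 𝔄 hn (hV O) hr hD hD' hp hY hY'
        hYY v
  · intro U' p h
    obtain ⟨O, 𝔄, hp, -⟩ := ha p
    exact DeSitter.LightlikeHypersurface.pole_zeta_eq_of_generator_eq 𝔄 hn (hV O) hp h
  · rintro U' hU' ha' p ⟨f, f', hf, hf', hJ⟩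
    -- lifts with the same jets still have the same jets after normalization to unit vectors
    obtain ⟨hx, h1⟩ := DeSitter.LightlikeHypersurface.isLift_normalize hf
    obtain ⟨hx', h1'⟩ := DeSitter.LightlikeHypersurface.isLift_normalize hf'
    have h := DeSitter.LightlikeHypersurface.jetEq_normalize hf hf'
      (DeSitter.JetEq.of_sameJet hf.smoothNear hf'.smoothNear hJ)
    obtain ⟨O, 𝔄, hp, -⟩ := ha p
    obtain ⟨O', 𝔄', hp', -⟩ := ha' p
    have key := DeSitter.LightlikeHypersurface.eq_of_jetEq hn hU hU' 𝔄 𝔄' hp hp' hx hx' h1 h1' h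
    exact ⟨key, fun _ D D' hD hD' Y hY v =>
      DeSitter.LightlikeHypersurface.connection_eq_of_jetEq hn hU ha hU' ha' hx hx' h1 h1' h.of_succ
        key.2.1 hD hD' hY v⟩
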